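/- Let $\mathsf G$ be a compact Lie group acting smoothly on a compact connected smooth manifold $M$. Assume that $M$ has cohomogeneity one, i.e. that $\mathsf G$ acts by isometries for some smooth Riemannian metric on $M$ and that some orbit has codimension $1$. Let $S=\mathsf G(x)$ be a singular orbit, i.e. an orbit of dimension smaller than $\dim M-1$. Let $\mathsf K=\mathsf G_x$ be the isotropy group of $x$, with Lie algebra $\mathfrak k\subset\mathfrak g$, and let $\mathfrak m$ be any $\mathrm{Ad}(\mathsf K)$-invariant complement of $\mathfrak k$ in $\mathfrak g$. Then $M$ admits a $\mathsf G$-invariant smooth Riemannian metric $\mathtt g$ that is adapted near $S$, in the following sense. There are a unit speed geodesic $\gamma\colon\,]-\delta,\delta[\,\to M$ of $\mathtt g$, perpendicular to all orbits it meets, with $\gamma(0)=x$, and a subgroup $\mathsf H\subset\mathsf G$, with Lie algebra $\mathfrak h$, which is the isotropy group of $\gamma(t)$ for every $t\in\,]0,\delta[$, such that the following holds for every $\mathrm{Ad}(\mathsf H)$-invariant complement $\mathfrak p$ of $\mathfrak h$ in $\mathfrak k$. For $t\in\,]0,\delta[$ and $X,Y\in\mathfrak m\oplus\mathfrak p$,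 put $\langle X,Y\rangle_t=\mathtt g(X^*_{\gamma(t)},Y^*_{\gamma(t)})$, where $X^*$ is the action field of $X$. Then there exist $\varepsilon\in\,]0,\delta]$, a positive smooth function $\alpha\colon\,]0,\varepsilon[\,\to\mathbb R$ with $\lim_{t\to0}\alpha(t)=1$, and $\mathrm{Ad}(\mathsf H)$-invariant inner products $B_t$ on $\mathfrak p$ such that $$\langle X+U,\,Y+V\rangle_t=\alpha(t)^2A(X,Y)+B_t(U,V)\qquad\text{for all }X,Y\in\mathfrak m,\ U,V\in\mathfrak p,\ 0<t<\varepsilon,$$ where $A$ is the $\mathrm{Ad}(\mathsf K)$-invariant inner product on $\mathfrak m$ that induces the metric of $S$ inherited from $\mathtt g$, i.e. $A(X,Y)=\mathtt g(X^*_x,Y^*_x)$. -/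

import Mathlib

open scoped Manifold ContDiff Topology

noncomputable section

namespace CohomOne

section Actions

/-! `G` is a Lie group modelled on `EG`, acting on a manifold `M` modelled on `E`. -/

variable {EG : Type*} [NormedAddCommGroup EG] [NormedSpace ℝ EG]
  {G : Type*} [TopologicalSpace G] [ChartedSpace EG G] [Group G]

/-- The adjoint representation: `Ad a` is the derivative at the identity of `h ↦ a * h * a⁻¹`. -/
def Ad (a : G) (X : GroupLieAlgebra 𝓘(ℝ, EG) G) : GroupLieAlgebra 𝓘(ℝ, EG) G :=
  (mfderiv 𝓘(ℝ, EG) 𝓘(ℝ, EG) (fun h : G => a * h * a⁻¹) 1 :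
    TangentSpace 𝓘(ℝ, EG) (1 : G) →L[ℝ] EG) X

/-- `V` is an `Ad(L)`-invariant complement of the subspace `W` in the subspace `U` of the Lie
algebra of `G`. -/
structure IsInvariantComplement (L : Subgroup G)
    (W U V : Submodule ℝ (GroupLieAlgebra 𝓘(ℝ, EG) G)) : Prop where
  inf_eq : W ⊓ V = ⊥
  sup_eq : W ⊔ V = U
  ad_mem : ∀ a ∈ L, ∀ X ∈ V, Ad a X ∈ V

/-- `Q` is an `Ad(L)`-invariant inner product on the subspace `V` of the Lie algebra of `G`. -/
structure IsInvariantInner (L : Subgroup G)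
    (V : Submodule ℝ (GroupLieAlgebra 𝓘(ℝ, EG) G)) (Q : V →ₗ[ℝ] V →ₗ[ℝ] ℝ) : Prop where
  symm : ∀ X Y, Q X Y = Q Y X
  pos : ∀ X, X ≠ 0 → 0 < Q X X
  ad_eq : ∀ a ∈ L, ∀ X Y X' Y' : V,
    (X' : GroupLieAlgebra 𝓘(ℝ, EG) G) = Ad a (X : GroupLieAlgebra 𝓘(ℝ, EG) G) →
    (Y' : GroupLieAlgebra 𝓘(ℝ, EG) G) = Ad a (Y : GroupLieAlgebra 𝓘(ℝ, EG) G) →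
    Q X' Y' = Q X Y

variable {E : Type*} [NormedAddCommGroup E] [NormedSpace ℝ E]
  {M : Type*} [TopologicalSpace M] [ChartedSpace E M] [MulAction G M]

variable (EG G E) in
/-- The linear map sending `X` in the Lie algebra of `G` to the value at `y` of its action field,
that is, the derivative at the identity of the orbit map `a ↦ a • y`. -/
def actionField (y : M) :
    GroupLieAlgebra 𝓘(ℝ, EG) G →L[ℝ] TangentSpace 𝓘(ℝ, E) y :=
  (mfderiv 𝓘(ℝ, EG) 𝓘(ℝ, E) (fun a : G => a • y) 1 :
    TangentSpace 𝓘(ℝ, EG) (1 : G) →L[ℝ] E)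

variable (EG G E) in
/-- The Lie algebra of the isotropy group of `y`: the elements of the Lie algebra of `G` whose
action field vanishes at `y`. -/
def isotropyAlgebra (y : M) : Submodule ℝ (GroupLieAlgebra 𝓘(ℝ, EG) G) :=
  LinearMap.ker (actionField EG G E y).toLinearMap

variable (EG G E) in
/-- The dimension of the orbit of `y`, whose tangent space at `y` consists of the values at `y` of
the action fields. -/
def orbitDim (y : M) : ℕ :=
  Module.finrank ℝ (LinearMap.range (actionField EG G E y).toLinearMap)

variable (E M) in
/-- Smooth Riemannian metrics on `M`. -/
abbrev RMetric [IsManifold 𝓘(ℝ, E) ∞ M] : Type _ :=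
  Bundle.ContMDiffRiemannianMetric 𝓘(ℝ, E) ∞ E (fun y : M => TangentSpace 𝓘(ℝ, E) y)

variable (EG G E) in
/-- The orbit of `x` is singular: its dimension is smaller than that of the orbits of
codimension one. -/
def IsSingularAt (x : M) : Prop :=
  ∃ y : M, orbitDim EG G E y + 1 = Module.finrank ℝ E ∧ orbitDim EG G E x < orbitDim EG G E y

variable [IsManifold 𝓘(ℝ, E) ∞ M]

variable (G) in
/-- The metric `g` is `G`-invariant, i.e. `G` acts on `(M, g)` by isometries. -/
def IsInvariantMetric (g : RMetric E M) : Prop :=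
  ∀ (a : G) (y : M) (v w : TangentSpace 𝓘(ℝ, E) y),
    g.inner (a • y) (mfderiv 𝓘(ℝ, E) 𝓘(ℝ, E) (fun z : M => a • z) y v)
      (mfderiv 𝓘(ℝ, E) 𝓘(ℝ, E) (fun z : M => a • z) y w) = g.inner y v w

variable (EG G E M) in
/-- `M` has cohomogeneity one: it carries a Riemannian metric for which `G` acts by isometries,
and there is an orbit of codimension one. -/
def IsCohomogeneityOne : Prop :=
  (∃ g : RMetric E M, IsInvariantMetric G g) ∧
    ∃ y : M, orbitDim EG G E y + 1 = Module.finrank ℝ E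

/-- The velocity of a curve in `M`. -/
def velocity (γ : ℝ → M) (t : ℝ) : TangentSpace 𝓘(ℝ, E) (γ t) :=
  mfderiv 𝓘(ℝ, ℝ) 𝓘(ℝ, E) γ t (1 : ℝ)

/-- The metric `g` in the chart of `M` centred at `z`: the inner product of the vectors `u` and `v`
at the point `q` of the target of the chart. -/
def chartMetric (g : RMetric E M) (z : M) (q u v : E) : ℝ :=
  g.inner ((extChartAt 𝓘(ℝ, E) z).symm q)
    (mfderiv 𝓘(ℝ, E) 𝓘(ℝ, E) (extChartAt 𝓘(ℝ, E) z).symm q u)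
    (mfderiv 𝓘(ℝ, E) 𝓘(ℝ, E) (extChartAt 𝓘(ℝ, E) z).symm q v)

/-- The geodesic equation at time `t` of an affinely parametrized curve, in the chart centred at
`γ t`: with `c` the curve in the chart and `g_ij` the metric coefficients, it reads
`(g_ij(c) c'^i)' = (1/2) ∂_j g_ik(c) c'^i c'^k` for every `j` (Euler-Lagrange equation of the
energy functional). -/
def GeodesicEqAt (g : RMetric E M) (γ : ℝ → M) (t : ℝ) : Prop :=
  let c : ℝ → E := fun s => extChartAt 𝓘(ℝ, E) (γ t) (γ s)
  ∀ v : E, deriv (fun s => chartMetric g (γ t) (c s) (deriv c s) v) t =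
    (1 / 2) * fderiv ℝ (fun q : E => chartMetric g (γ t) q (deriv c t) (deriv c t)) (c t) v

variable (EG G) in
/-- On `(-δ, δ)`, the curve `γ` is a smooth geodesic of `g` parametrized by arc length and
perpendicular to all the orbits it meets. -/
structure IsHorizontalGeodesic (g : RMetric E M) (γ : ℝ → M) (δ : ℝ) : Prop where
  smooth : ContMDiffOn 𝓘(ℝ, ℝ) 𝓘(ℝ, E) ∞ γ (Set.Ioo (-δ) δ)
  geodesic : ∀ t ∈ Set.Ioo (-δ) δ, GeodesicEqAt g γ t
  unit_speed : ∀ t ∈ Set.Ioo (-δ) δ, g.inner (γ t) (velocity γ t) (velocity γ t) = 1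
  perp : ∀ t ∈ Set.Ioo (-δ) δ, ∀ X : GroupLieAlgebra 𝓘(ℝ, EG) G,
    g.inner (γ t) (velocity γ t) (actionField EG G E (γ t) X) = 0

/-- The invariant metric `g` is adapted near the orbit of `x`, with respect to the complement `m`
of the isotropy algebra `𝔨` of `x`. Here `γ` is a horizontal geodesic starting at `x`, the group
`K` is the isotropy group of `x`, and `H`, with Lie algebra `h`, is the isotropy group of `γ t` for
small `t > 0`. For every `Ad(H)`-invariant complement `p` of `h` in `𝔨`, the inner product on
`m ⊕ p` induced through action fields by `g` at `γ t` has the form `α(t)² A + B t`, where `A` is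
the `Ad(K)`-invariant inner product on `m` which induces the metric of the orbit of `x`, and
`B t` is an `Ad(H)`-invariant inner product on `p`. -/
def IsAdaptedNear (g : RMetric E M) (x : M)
    (m : Submodule ℝ (GroupLieAlgebra 𝓘(ℝ, EG) G)) : Prop :=
  ∃ (γ : ℝ → M) (δ : ℝ) (H : Subgroup G) (h : Submodule ℝ (GroupLieAlgebra 𝓘(ℝ, EG) G)),
    0 < δ ∧ IsHorizontalGeodesic EG G g γ δ ∧ γ 0 = x ∧
    (∀ t ∈ Set.Ioo 0 δ, MulAction.stabilizer G (γ t) = H) ∧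
    (∀ t ∈ Set.Ioo 0 δ, isotropyAlgebra EG G E (γ t) = h) ∧
    ∀ p : Submodule ℝ (GroupLieAlgebra 𝓘(ℝ, EG) G),
      IsInvariantComplement H h (isotropyAlgebra EG G E x) p →
      ∃ (ε : ℝ) (α : ℝ → ℝ) (A : m →ₗ[ℝ] m →ₗ[ℝ] ℝ) (B : ℝ → p →ₗ[ℝ] p →ₗ[ℝ] ℝ),
        0 < ε ∧ ε ≤ δ ∧
        ContDiffOn ℝ ∞ α (Set.Ioo 0 ε) ∧ (∀ t ∈ Set.Ioo 0 ε, 0 < α t) ∧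
        Filter.Tendsto α (𝓝[>] 0) (𝓝 1) ∧
        IsInvariantInner (MulAction.stabilizer G x) m A ∧
        (∀ X Y : m, A X Y = g.inner x (actionField EG G E x X) (actionField EG G E x Y)) ∧
        (∀ t ∈ Set.Ioo 0 ε, IsInvariantInner H p (B t)) ∧
        ∀ t ∈ Set.Ioo 0 ε, ∀ (X Y : m) (U V : p),
          g.inner (γ t)
              (actionField EG G E (γ t)
                ((X : GroupLieAlgebra 𝓘(ℝ, EG) G) + (U : GroupLieAlgebra 𝓘(ℝ, EG) G)))
              (actionField EG G E (γ t)
                ((Y : GroupLieAlgebra 𝓘(ℝ, EG) G) + (V : GroupLieAlgebra 𝓘(ℝ, EG) G))) =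
            α t ^ 2 * A X Y + B t U V

end Actions

end CohomOne

end

/-! The metric is changed near the orbit of x so that action fields from m have constant length
along a normal ray; the required `α` is then identically 1. Let K be the isotropy group of x and g
any invariant metric. The tangent space at x, identified with E, splits g-orthogonally into the
tangent space of the orbit, parametrized by m, and a normal space N (`exists_splitting`).

Averaging over K linearizes its action near x, giving a K-equivariant parametrization `ν` of a
neighbourhood of x (`exists_equivariant_param`). The map u ↦ `chartExp (q u) • ν (pr u)` has
derivative the identity at 0, so it restricts to a local diffeomorphism `Θ` whose coordinates are an
m-direction along the orbit and a point of the slice N. Compactness of G yields the slice property: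
a group element carrying a point of a small slice into the slice lies in K (`exists_tube`). Hence a
point a • ν(w) of the tube determines (a, w) up to K. Transporting g_x by dΘ⁻¹ ∘ da⁻¹ does not
depend on this ambiguity, because K acts isometrically at x and, m being Ad(K)-invariant, dΘ⁻¹
commutes with K (`mder_symm_dsm`). The transported form, blended with g by an invariant cutoff, is
the metric g' (`exists_tube_metric`).

On the slice, g' is g_x read through dΘ. The field of X ∈ m at ν(w) corresponds to the constant
vector X*_x (`mder_symm_act_of_mem`). The field of a general Z corresponds to Z*_x + D(w), where
D(w) lies in N, is orthogonal to w and is homogeneous in w, because small group elements move the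
slice by elements of K (`exists_vertical`). For U in the Lie algebra of K only D(w) remains, so m
and p are orthogonal and the m-block is the one at x (`met_act_ray`). Orthogonality of D(w) to w
makes γ(t) = ν(tv), for a unit vector v in N, perpendicular to the orbits. In the coordinates `Θ`
the vector v has length 1 everywhere near the ray and its pairings are constant along the ray, so
the Euler-Lagrange equation holds with both sides zero (`geodesicEqAt_of_line`). The isotropy group
of γ(t), t > 0, is the stabilizer of v in K, and homogeneity of D makes the isotropy algebra
independent of t. -/

open scoped Manifold ContDiff Topology
open Filter Set Bundle MeasureTheory

noncomputable section

namespace CohomOne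

/-! ### Derivatives between model spaces, bilinear forms in charts, smooth local inverses. -/

section Calculus

variable {E : Type*} [NormedAddCommGroup E] [NormedSpace ℝ E]
  {F : Type*} [NormedAddCommGroup F] [NormedSpace ℝ F]
  {H : Type*} [NormedAddCommGroup H] [NormedSpace ℝ H]
  {M : Type*} [TopologicalSpace M] [ChartedSpace E M]
  {N : Type*} [TopologicalSpace N] [ChartedSpace F N]
  {P : Type*} [TopologicalSpace P] [ChartedSpace H P]

variable (E F) in
/-- The derivative of a map between manifolds, as a map between the model spaces. -/
def mder (f : M → N) (y : M) : E →L[ℝ] F := mfderiv 𝓘(ℝ, E) 𝓘(ℝ, F) f y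

variable (E F) in
/-- Smoothness at a point of a map between manifolds. -/
abbrev SmoothAt (f : M → N) (y : M) : Prop := ContMDiffAt 𝓘(ℝ, E) 𝓘(ℝ, F) ∞ f y

theorem SmoothAt.mdiff {f : M → N} {y : M} (h : SmoothAt E F f y) :
    MDifferentiableAt 𝓘(ℝ, E) 𝓘(ℝ, F) f y := ContMDiffAt.mdifferentiableAt h (by simp)

theorem contDiffAt_clm_apply [FiniteDimensional ℝ E] {n : ℕ∞ω} {f : H → E →L[ℝ] F} {p : H} :
    ContDiffAt ℝ n f p ↔ ∀ y, ContDiffAt ℝ n (fun x => f x y) p := by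
  refine ⟨fun h y => h.clm_apply contDiffAt_const, fun h => ?_⟩
  let d := Module.finrank ℝ E
  have hd : d = Module.finrank ℝ (Fin d → ℝ) := (Module.finrank_fin_fun ℝ).symm
  let e₁ := ContinuousLinearEquiv.ofFinrankEq hd
  let e₂ := (e₁.arrowCongr (1 : F ≃L[ℝ] F)).trans (ContinuousLinearEquiv.piRing (Fin d))
  rw [← Function.id_comp f, ← e₂.symm_comp_self]
  exact e₂.symm.contDiff.contDiffAt.comp p (contDiffAt_pi.mpr fun i => h _)

theorem mder_comp {g : N → P} {f : M → N} {y : M} (hg : SmoothAt F H g (f y))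
    (hf : SmoothAt E F f y) :
    mder E H (fun z => g (f z)) y = (mder F H g (f y)).comp (mder E F f y) :=
  mfderiv_comp y hg.mdiff hf.mdiff

theorem mder_comp_apply {g : N → P} {f : M → N} {y : M} (hg : SmoothAt F H g (f y))
    (hf : SmoothAt E F f y) (v : E) :
    mder E H (fun z => g (f z)) y v = mder F H g (f y) (mder E F f y v) := by
  rw [mder_comp hg hf]; rfl

theorem mder_congr {f g : M → N} {y : M} (h : f =ᶠ[𝓝 y] g) : mder E F f y = mder E F g y :=
  h.mfderiv_eq

theorem mder_eq_fderiv (f : E → F) (y : E) : mder E F f y = fderiv ℝ f y := mfderiv_eq_fderiv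

theorem mder_id (y : M) : mder E E (fun z : M => z) y = ContinuousLinearMap.id ℝ E := mfderiv_id

section Chart
variable [IsManifold 𝓘(ℝ, E) ∞ M]

theorem smoothAt_chart {z y : M} (hy : y ∈ (chartAt E z).source) :
    SmoothAt E E (extChartAt 𝓘(ℝ, E) z) y := contMDiffAt_extChartAt' hy

theorem smoothAt_chart_symm {z : M} {q : E} (hq : q ∈ (extChartAt 𝓘(ℝ, E) z).target) :
    SmoothAt E E (extChartAt 𝓘(ℝ, E) z).symm q :=
  (contMDiffOn_extChartAt_symm z).contMDiffAt ((isOpen_extChartAt_target z).mem_nhds hq)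

theorem mder_chart_self (z : M) :
    mder E E (extChartAt 𝓘(ℝ, E) z) z = ContinuousLinearMap.id ℝ E := by
  have : IsManifold 𝓘(ℝ, E) 1 M := IsManifold.of_le (n := ∞) (by simp)
  exact mfderiv_extChartAt_self

variable [FiniteDimensional ℝ E]
omit [FiniteDimensional ℝ E] in
theorem mder_chart_symm_self (z : M) : mder E E (extChartAt 𝓘(ℝ, E) z).symm
    (extChartAt 𝓘(ℝ, E) z z) = ContinuousLinearMap.id ℝ E := by
  have h := mder_comp (M := M) (E := E) (F := E) (H := E) (g := (extChartAt 𝓘(ℝ, E) z).symm)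
    (f := extChartAt 𝓘(ℝ, E) z) (y := z)
    (smoothAt_chart_symm (mem_extChartAt_target z)) (smoothAt_chart (mem_chart_source E z))
  rw [mder_congr (g := fun z => z), mder_id, mder_chart_self] at h
  · exact h.symm
  · filter_upwards [extChartAt_source_mem_nhds (I := 𝓘(ℝ, E)) z] with q hq
      using (extChartAt 𝓘(ℝ, E) z).left_inv hq

/-- The expression of a bilinear form on `M` in a chart. -/
def chartForm (s : M → E →L[ℝ] E →L[ℝ] ℝ) (z : M) (q : E) : E →L[ℝ] E →L[ℝ] ℝ :=
  (s ((extChartAt 𝓘(ℝ, E) z).symm q)).bilinearComp (mder E E (extChartAt 𝓘(ℝ, E) z).symm q)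
    (mder E E (extChartAt 𝓘(ℝ, E) z).symm q)

omit [FiniteDimensional ℝ E] [IsManifold 𝓘(ℝ, E) ∞ M] in
theorem chartForm_apply (s : M → E →L[ℝ] E →L[ℝ] ℝ) (z : M) (q u v : E) :
    chartForm s z q u v = s ((extChartAt 𝓘(ℝ, E) z).symm q)
      (mder E E (extChartAt 𝓘(ℝ, E) z).symm q u) (mder E E (extChartAt 𝓘(ℝ, E) z).symm q v) := rfl

omit [FiniteDimensional ℝ E] in
-- The trivialization of the tangent bundle at z is the derivative of the chart at z, so a section
-- of the bundle of bilinear forms, read in the trivialization, is its chart expression. Smoothness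
-- of metrics can then be checked in E.
theorem contMDiffAt_form_iff
    (s : ∀ y : M, TangentSpace 𝓘(ℝ, E) y →L[ℝ] TangentSpace 𝓘(ℝ, E) y →L[ℝ] ℝ) (z : M) :
    ContMDiffAt 𝓘(ℝ, E) (𝓘(ℝ, E).prod 𝓘(ℝ, E →L[ℝ] E →L[ℝ] ℝ)) ∞
      (fun y : M => TotalSpace.mk' (E →L[ℝ] E →L[ℝ] ℝ) y (s y)) z ↔
    ContDiffAt ℝ ∞ (chartForm s z) (extChartAt 𝓘(ℝ, E) z z) := by
  have : IsManifold 𝓘(ℝ, E) 1 M := IsManifold.of_le (n := ∞) (by simp)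
  rw [contMDiffAt_section]
  have key : (fun y : M => ((trivializationAt (E →L[ℝ] E →L[ℝ] ℝ)
      (fun y : M => TangentSpace 𝓘(ℝ, E) y →L[ℝ] TangentSpace 𝓘(ℝ, E) y →L[ℝ] ℝ) z)
        ⟨y, s y⟩).2) =ᶠ[𝓝 z] fun y => chartForm s z (extChartAt 𝓘(ℝ, E) z y) := by
    filter_upwards [(chartAt E z).open_source.mem_nhds (mem_chart_source E z)] with y hy
    have h1 := TangentBundle.symmL_trivializationAt (I := 𝓘(ℝ, E)) hy
    have h2 : (extChartAt 𝓘(ℝ, E) z).symm (extChartAt 𝓘(ℝ, E) z y) = y :=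
      (extChartAt 𝓘(ℝ, E) z).left_inv (by simpa using hy)
    have hb : y ∈ (trivializationAt E (TangentSpace 𝓘(ℝ, E)) z).baseSet := by simpa using hy
    have e : ∀ w : E, (trivializationAt E (TangentSpace 𝓘(ℝ, E)) z).symm y w =
        mder E E (extChartAt 𝓘(ℝ, E) z).symm (extChartAt 𝓘(ℝ, E) z y) w := fun w => by
      rw [← Trivialization.symmL_apply (R := ℝ) _ hb, h1]
      simp [mder]
      rfl
    ext u v
    simp only [hom_trivializationAt_apply]
    rw [inCoordinates_apply_eq₂ hb hb (Set.mem_univ _), e, e]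
    refine Eq.trans ?_ (chartForm_apply _ _ _ _ _).symm
    refine Eq.trans ?_ (congrArg (fun y' => (s y' : E →L[ℝ] E →L[ℝ] ℝ)
      (mder E E (extChartAt 𝓘(ℝ, E) z).symm (extChartAt 𝓘(ℝ, E) z y) u)
      (mder E E (extChartAt 𝓘(ℝ, E) z).symm (extChartAt 𝓘(ℝ, E) z y) v)) h2.symm)
    simp
  rw [key.contMDiffAt_iff, ← contMDiffAt_iff_contDiffAt]
  constructor
  · intro h
    have h2 : (extChartAt 𝓘(ℝ, E) z).symm (extChartAt 𝓘(ℝ, E) z z) = z := by simp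
    have h3 := ContMDiffAt.comp_of_eq h
      (smoothAt_chart_symm (mem_extChartAt_target (I := 𝓘(ℝ, E)) z)) h2
    refine h3.congr_of_eventuallyEq ?_
    filter_upwards [extChartAt_target_mem_nhds (I := 𝓘(ℝ, E)) z] with q hq
    exact congrArg (chartForm (fun y => s y) z) ((extChartAt 𝓘(ℝ, E) z).right_inv hq).symm
  · intro h
    exact ContMDiffAt.comp (I' := 𝓘(ℝ, E)) (g := chartForm (fun y => s y) z) z h (smoothAt_chart (mem_chart_source E z))
end Chart

section LocalInverse
variable [FiniteDimensional ℝ E]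

/-- Inverse function theorem, with smoothness of the inverse in a neighbourhood. -/
theorem exists_local_inverse_model {f : E → E} {U : Set E} (hU : IsOpen U) {p : E} (hp : p ∈ U)
    (hf : ContDiffOn ℝ ∞ f U) (L : E ≃L[ℝ] E) (hL : fderiv ℝ f p = L) :
    ∃ Θ : OpenPartialHomeomorph E E, p ∈ Θ.source ∧ Θ.source ⊆ U ∧ (∀ q, Θ q = f q) ∧
      (∀ q ∈ Θ.target, ContDiffAt ℝ ∞ Θ.symm q) := by
  have hfa : ∀ q ∈ U, ContDiffAt ℝ ∞ f q := fun q hq => hf.contDiffAt (hU.mem_nhds hq)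
  have hd : HasFDerivAt f (L : E →L[ℝ] E) p := by
    rw [← hL]; exact ((hfa p hp).differentiableAt (by simp)).hasFDerivAt
  let Θ₀ := (hfa p hp).toOpenPartialHomeomorph f hd (by simp)
  have hcont : ContinuousOn (fderiv ℝ f) U := hf.continuousOn_fderiv_of_isOpen hU (by simp)
  -- The inverse is smooth at the image of every point where the derivative is invertible; such
  -- points form an open set, and restricting to it gives smoothness on the whole target.
  have hO : IsOpen (U ∩ fderiv ℝ f ⁻¹' range ((↑) : (E ≃L[ℝ] E) → E →L[ℝ] E)) :=
    hcont.isOpen_inter_preimage hU ContinuousLinearEquiv.isOpen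
  refine ⟨Θ₀.restrOpen _ hO, ?_, ?_, fun q => rfl, ?_⟩
  · exact ⟨(hfa p hp).mem_toOpenPartialHomeomorph_source hd (by simp), hp, L, hL.symm⟩
  · exact fun q hq => hq.2.1
  · intro q hq
    have hq' := (Θ₀.restrOpen _ hO).map_target hq
    obtain ⟨-, hqU, L', hL'⟩ := hq'
    refine (Θ₀.restrOpen _ hO).contDiffAt_symm (f₀' := L') hq ?_ (hfa _ hqU)
    rw [hL']
    exact ((hfa _ hqU).differentiableAt (by simp)).hasFDerivAt

variable [IsManifold 𝓘(ℝ, E) ∞ M]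

theorem exists_local_inverse {f : E → M} {U : Set E} (hU : IsOpen U) {p : E} (hp : p ∈ U)
    (hf : ∀ q ∈ U, SmoothAt E E f q) (L : E ≃L[ℝ] E) (hL : mder E E f p = L) :
    ∃ Θ : OpenPartialHomeomorph E M, p ∈ Θ.source ∧ Θ.source ⊆ U ∧ (∀ q ∈ Θ.source, Θ q = f q) ∧
      (∀ q ∈ Θ.target, SmoothAt E E Θ.symm q) := by
  let c := chartAt E (f p)
  have hcont : ContinuousOn f U := fun q hq => (hf q hq).continuousAt.continuousWithinAt
  have hU' : IsOpen (U ∩ f ⁻¹' c.source) := hcont.isOpen_inter_preimage hU c.open_source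
  have hpU : p ∈ U ∩ f ⁻¹' c.source := ⟨hp, mem_chart_source E (f p)⟩
  have hs : ∀ q ∈ U ∩ f ⁻¹' c.source, SmoothAt E E (fun q => c (f q)) q := fun q hq =>
    ContMDiffAt.comp q (smoothAt_chart (z := f p) hq.2) (hf q hq.1)
  obtain ⟨Θ, h1, h2, h3, h4⟩ := exists_local_inverse_model hU' hpU
    (f := fun q => c (f q)) (fun q hq => (contMDiffAt_iff_contDiffAt.1 (hs q hq)).contDiffWithinAt)
    L (by
      rw [← mder_eq_fderiv]
      refine (mder_comp (smoothAt_chart (z := f p) hpU.2) (hf p hp)).trans ?_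
      rw [hL, mder_chart_self]; rfl)
  refine ⟨Θ.trans c.symm, ?_, ?_, ?_, ?_⟩
  · rw [OpenPartialHomeomorph.trans_source]
    refine ⟨h1, ?_⟩
    simp only [mem_preimage, h3]
    exact c.map_source hpU.2
  · exact fun q hq => (h2 hq.1).1
  · intro q hq
    simp only [OpenPartialHomeomorph.coe_trans, Function.comp, h3]
    exact c.left_inv (h2 hq.1).2
  · intro q hq
    rw [OpenPartialHomeomorph.trans_target] at hq
    refine ContMDiffAt.comp (I' := 𝓘(ℝ, E)) (g := Θ.symm) q ?_ (smoothAt_chart (z := f p) hq.1)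
    exact contMDiffAt_iff_contDiffAt.2 (h4 _ hq.2)

theorem exists_local_inverse' {f : M → E} {U : Set M} (hU : IsOpen U) {p : M} (hp : p ∈ U)
    (hf : ∀ q ∈ U, SmoothAt E E f q) (L : E ≃L[ℝ] E) (hL : mder E E f p = L) :
    ∃ Θ : OpenPartialHomeomorph M E, p ∈ Θ.source ∧ Θ.source ⊆ U ∧ (∀ q ∈ Θ.source, Θ q = f q) ∧
      (∀ q ∈ Θ.target, SmoothAt E E Θ.symm q) := by
  let c := chartAt E p
  have hV : IsOpen (c.target ∩ c.symm ⁻¹' U) := c.isOpen_inter_preimage_symm hU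
  have hpc : c.symm (c p) = p := c.left_inv (mem_chart_source E p)
  have hpV : c p ∈ c.target ∩ c.symm ⁻¹' U := ⟨c.map_source (mem_chart_source E p), by
    rwa [mem_preimage, hpc]⟩
  have hsy : ∀ q ∈ c.target, SmoothAt E E c.symm q := fun q hq =>
    smoothAt_chart_symm (z := p) (by simpa using hq)
  have hs : ∀ q ∈ c.target ∩ c.symm ⁻¹' U, SmoothAt E E (fun q => f (c.symm q)) q := fun q hq =>
    ContMDiffAt.comp q (hf _ hq.2) (hsy q hq.1)
  have hid : mder E E c.symm (c p) = ContinuousLinearMap.id ℝ E := mder_chart_symm_self p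
  obtain ⟨Θ, h1, h2, h3, h4⟩ := exists_local_inverse_model hV hpV
    (f := fun q => f (c.symm q))
    (fun q hq => (contMDiffAt_iff_contDiffAt.1 (hs q hq)).contDiffWithinAt) L (by
      rw [← mder_eq_fderiv, mder_comp (by rw [hpc]; exact hf p hp) (hsy _ hpV.1), hid, hpc, hL]
      rfl)
  refine ⟨c.trans Θ, ?_, ?_, ?_, ?_⟩
  · rw [OpenPartialHomeomorph.trans_source]
    exact ⟨mem_chart_source E p, h1⟩
  · intro q hq
    have : c.symm (c q) ∈ U := (h2 hq.2).2
    rwa [c.left_inv hq.1] at this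
  · intro q hq
    simp only [OpenPartialHomeomorph.coe_trans, Function.comp, h3]
    rw [c.left_inv hq.1]
  · intro q hq
    rw [OpenPartialHomeomorph.trans_target] at hq
    exact ContMDiffAt.comp (I' := 𝓘(ℝ, E)) (g := c.symm) q (hsy _ hq.2)
      (contMDiffAt_iff_contDiffAt.2 (h4 _ hq.1))

end LocalInverse

end Calculus

/-! ### Smoothness of integrals over a compact manifold depending on a parameter. -/

section ParametricIntegral

variable {E : Type*} [NormedAddCommGroup E] [NormedSpace ℝ E] [FiniteDimensional ℝ E]
  {F : Type*} [NormedAddCommGroup F] [NormedSpace ℝ F] [FiniteDimensional ℝ F]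
  {H : Type*} [NormedAddCommGroup H] [NormedSpace ℝ H]
  {N : Type*} [TopologicalSpace N] [ChartedSpace H N] [IsManifold 𝓘(ℝ, H) ∞ N]

omit [FiniteDimensional ℝ E] [FiniteDimensional ℝ F] in
theorem contMDiffAt_fderiv_param {h : N → E → F} {a : N} {q : E}
    (hh : ContMDiffAt (𝓘(ℝ, H).prod 𝓘(ℝ, E)) 𝓘(ℝ, F) ∞ (fun p : N × E => h p.1 p.2) (a, q)) :
    ContMDiffAt (𝓘(ℝ, H).prod 𝓘(ℝ, E)) 𝓘(ℝ, E →L[ℝ] F) ∞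
      (fun p : N × E => fderiv ℝ (h p.1) p.2) (a, q) := by
  have : IsManifold 𝓘(ℝ, H) 1 N := IsManifold.of_le (n := ∞) (by simp)
  have h1 := ContMDiffAt.mfderiv (J := 𝓘(ℝ, H).prod 𝓘(ℝ, E)) (I := 𝓘(ℝ, E)) (I' := 𝓘(ℝ, F))
    (x₀ := (a, q)) (n := ∞) (m := ∞) (fun (p : N × E) (q : E) => h p.1 q) (fun p => p.2)
    (by
      refine ContMDiffAt.comp (I' := 𝓘(ℝ, H).prod 𝓘(ℝ, E)) (g := fun p : N × E => h p.1 p.2)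
        (f := fun p : (N × E) × E => (p.1.1, p.2)) _ hh ?_
      exact (contMDiff_fst.comp contMDiff_fst).contMDiffAt.prodMk contMDiffAt_snd)
    contMDiffAt_snd (by simp)
  refine h1.congr_of_eventuallyEq (Eventually.of_forall fun p => ?_)
  have h2 := congrFun (inTangentCoordinates_model_space (I := 𝓘(ℝ, E)) (I' := 𝓘(ℝ, F))
    (fun p : N × E => p.2) (fun p => h p.1 p.2) (fun p => mder E F (h p.1) p.2) (a, q)) p
  exact ((mder_eq_fderiv (h p.1) p.2).symm.trans h2.symm)

variable [CompactSpace N] [MeasurableSpace N] [BorelSpace N] (μ : Measure N) [IsFiniteMeasure μ]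

/-- The derivative in the parameter is jointly continuous, hence bounded on the compact product of N
with a closed ball, and a constant dominates on a finite measure. -/
theorem hasFDerivAt_integral_param {h : N → E → F} {Ω : Set E} (hΩ : IsOpen Ω)
    (hh : ∀ a, ∀ q ∈ Ω, ContMDiffAt (𝓘(ℝ, H).prod 𝓘(ℝ, E)) 𝓘(ℝ, F) ∞
      (fun p : N × E => h p.1 p.2) (a, q)) {q : E} (hq : q ∈ Ω) :
    HasFDerivAt (fun q => ∫ a, h a q ∂μ) (∫ a, fderiv ℝ (h a) q ∂μ) q := by
  have hcont : ∀ q ∈ Ω, Continuous fun a => h a q := fun q hq => continuous_iff_continuousAt.2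
    fun a => (hh a q hq).continuousAt.comp (f := fun a : N => (a, q)) (by fun_prop)
  have hcont' : ∀ q ∈ Ω, Continuous fun a => fderiv ℝ (h a) q := fun q hq =>
    continuous_iff_continuousAt.2 fun a => (contMDiffAt_fderiv_param (hh a q hq)).continuousAt.comp
      (f := fun a : N => (a, q)) (by fun_prop)
  have : ProperSpace F := FiniteDimensional.proper_real F
  have : ProperSpace (E →L[ℝ] F) := FiniteDimensional.proper_real _
  have : ProperSpace E := FiniteDimensional.proper_real E
  obtain ⟨r, hr, hball⟩ := Metric.nhds_basis_closedBall.mem_iff.1 (hΩ.mem_nhds hq)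
  have hK : IsCompact ((univ : Set N) ×ˢ Metric.closedBall q r) :=
    isCompact_univ.prod (isCompact_closedBall q r)
  obtain ⟨C, hC⟩ := hK.exists_bound_of_continuousOn (f := fun p : N × E => fderiv ℝ (h p.1) p.2)
    fun p hp => (contMDiffAt_fderiv_param (hh p.1 p.2 (hball hp.2))).continuousAt.continuousWithinAt
  refine hasFDerivAt_integral_of_dominated_of_fderiv_le (𝕜 := ℝ)
    (F := fun q a => h a q) (F' := fun q a => fderiv ℝ (h a) q) (bound := fun _ => C)
    (Metric.closedBall_mem_nhds q hr) ?_ ?_ ?_ ?_ ?_ ?_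
  · filter_upwards [hΩ.mem_nhds hq] with q' hq' using (hcont q' hq').aestronglyMeasurable
  · exact (hcont q hq).integrable_of_hasCompactSupport (HasCompactSupport.of_compactSpace _)
  · exact (hcont' q hq).aestronglyMeasurable
  · exact Eventually.of_forall fun a q' hq' => hC (a, q') ⟨mem_univ _, hq'⟩
  · exact integrable_const C
  · refine Eventually.of_forall fun a q' hq' => ?_
    have h1 : ContMDiffAt 𝓘(ℝ, E) 𝓘(ℝ, F) ∞ (h a) q' :=
      ContMDiffAt.comp (I' := 𝓘(ℝ, H).prod 𝓘(ℝ, E)) (g := fun p : N × E => h p.1 p.2)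
        (f := fun q : E => (a, q)) q' (hh a q' (hball hq')) (contMDiffAt_const.prodMk contMDiffAt_id)
    exact ((contMDiffAt_iff_contDiffAt.1 h1).differentiableAt (by simp)).hasFDerivAt

/-- Induction on the order, over all families h at once: a directional derivative of the integral is
again an integral of a jointly smooth family. -/
theorem contDiffOn_integral_param {h : N → E → F} {Ω : Set E} (hΩ : IsOpen Ω)
    (hh : ∀ a, ∀ q ∈ Ω, ContMDiffAt (𝓘(ℝ, H).prod 𝓘(ℝ, E)) 𝓘(ℝ, F) ∞
      (fun p : N × E => h p.1 p.2) (a, q)) :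
    ContDiffOn ℝ ∞ (fun q => ∫ a, h a q ∂μ) Ω := by
  rw [contDiffOn_infty]
  intro n
  induction n generalizing h with
  | zero =>
    exact contDiffOn_zero.2 fun q hq =>
      (hasFDerivAt_integral_param μ hΩ hh hq).continuousAt.continuousWithinAt
  | succ n ih =>
    refine contDiffOn_succ_of_fderiv_apply (𝕜 := ℝ)
      (fun q hq => (hasFDerivAt_integral_param μ hΩ hh hq).differentiableAt.differentiableWithinAt)
      (fun h => absurd h (WithTop.natCast_ne_top n)) fun v => ?_
    have hv : ∀ a, ∀ q ∈ Ω, ContMDiffAt (𝓘(ℝ, H).prod 𝓘(ℝ, E)) 𝓘(ℝ, F) ∞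
        (fun p : N × E => fderiv ℝ (h p.1) p.2 v) (a, q) := fun a q hq =>
      (contMDiffAt_fderiv_param (hh a q hq)).clm_apply contMDiffAt_const
    refine (ih (h := fun a q => fderiv ℝ (h a) q v) hv).congr fun q hq => ?_
    rw [fderivWithin_of_isOpen hΩ hq, (hasFDerivAt_integral_param μ hΩ hh hq).fderiv]
    have : ProperSpace (E →L[ℝ] F) := FiniteDimensional.proper_real _
    refine ContinuousLinearMap.integral_apply (Continuous.integrable_of_hasCompactSupport ?_
      (HasCompactSupport.of_compactSpace _)) v
    exact continuous_iff_continuousAt.2 fun a =>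
      (contMDiffAt_fderiv_param (hh a q hq)).continuousAt.comp
        (f := fun a : N => (a, q)) (by fun_prop)

end ParametricIntegral

/-! ### The geodesic equation for straight lines in suitable coordinates. -/

section Geodesic
variable {E : Type*} [NormedAddCommGroup E] [NormedSpace ℝ E]

/-- The geodesic equation for the image of a line under a local diffeomorphism `f` with inverse `k`,
when the pulled back metric has constant coefficients `λ = ⟨v, ·⟩` along the line and
`⟨v, v⟩ = 1` everywhere. -/
theorem geodesic_equation_of_line {Q : E → E →L[ℝ] E →L[ℝ] ℝ} {f k : E → E} {v : E} {t : ℝ}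
    {c : ℝ → E} {l : E →L[ℝ] ℝ}
    (hf : ContDiffAt ℝ ∞ f (t • v)) (hk : ContDiffAt ℝ ∞ k (f (t • v)))
    (hfk : ∀ᶠ q in 𝓝 (f (t • v)), f (k q) = q) (hkf : ∀ᶠ p in 𝓝 (t • v), k (f p) = p)
    (hQ : DifferentiableAt ℝ Q (f (t • v)))
    (hsymm : ∀ u w, Q (f (t • v)) u w = Q (f (t • v)) w u)
    (hc : c =ᶠ[𝓝 t] fun s => f (s • v))
    (h1 : ∀ᶠ p in 𝓝 (t • v), Q (f p) (fderiv ℝ f p v) (fderiv ℝ f p v) = 1)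
    (h2 : ∀ᶠ s in 𝓝 t, ∀ u, Q (f (s • v)) (fderiv ℝ f (s • v) v) (fderiv ℝ f (s • v) u) = l u)
    (w : E) :
    deriv (fun s => Q (c s) (deriv c s) w) t =
      (1 / 2) * fderiv ℝ (fun q => Q q (deriv c t) (deriv c t)) (c t) w := by
  set p₀ := t • v with hp₀
  set q₀ := f p₀ with hq₀
  have hline : Tendsto (fun s : ℝ => s • v) (𝓝 t) (𝓝 p₀) :=
    (continuous_id.smul continuous_const).tendsto t
  have hkq : k q₀ = p₀ := hkf.self_of_nhds
  have hkt : Tendsto k (𝓝 q₀) (𝓝 p₀) := by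
    have := hk.continuousAt.tendsto; rwa [hkq] at this
  have hfd : ∀ᶠ p in 𝓝 p₀, DifferentiableAt ℝ f p :=
    ((hf.of_le (m := 1) (by simp)).eventually (by simp)).mono
      fun p hp => hp.differentiableAt (by simp)
  have hkd : ∀ᶠ q in 𝓝 q₀, DifferentiableAt ℝ k q :=
    ((hk.of_le (m := 1) (by simp)).eventually (by simp)).mono
      fun p hp => hp.differentiableAt (by simp)
  have hkd2 : DifferentiableAt ℝ (fderiv ℝ k) q₀ :=
    (hk.fderiv_right (m := ∞) (by simp)).differentiableAt (by simp)
  have hfd2 : DifferentiableAt ℝ (fderiv ℝ f) p₀ :=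
    (hf.fderiv_right (m := ∞) (by simp)).differentiableAt (by simp)
  have hinv1 : ∀ᶠ p in 𝓝 p₀, ∀ u, fderiv ℝ k (f p) (fderiv ℝ f p u) = u := by
    filter_upwards [hkf.eventually_nhds, hfd, hf.continuousAt.tendsto.eventually hkd]
      with p hp hp1 hp2 u
    have h := (hp2.hasFDerivAt.comp p hp1.hasFDerivAt).unique
      ((hasFDerivAt_id p).congr_of_eventuallyEq hp)
    exact congrArg (fun L : E →L[ℝ] E => L u) h
  have hinv2 : ∀ᶠ q in 𝓝 q₀, ∀ u, fderiv ℝ f (k q) (fderiv ℝ k q u) = u := by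
    filter_upwards [hfk.eventually_nhds, hkd, hkt.eventually hfd] with q hq hq1 hq2 u
    have h := (hq2.hasFDerivAt.comp q hq1.hasFDerivAt).unique
      ((hasFDerivAt_id q).congr_of_eventuallyEq hq)
    exact congrArg (fun L : E →L[ℝ] E => L u) h
  -- The constant field v pushed forward by f; it extends the velocity of c to a neighbourhood of
  -- the curve, so that |R| = 1 can be differentiated in every direction.
  set R : E → E := fun q => fderiv ℝ f (k q) v with hR
  have hR0 : R q₀ = fderiv ℝ f p₀ v := by rw [hR]; simp only [hkq]
  have hRd : DifferentiableAt ℝ R q₀ := by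
    have h3 : DifferentiableAt ℝ (fun q => fderiv ℝ f (k q)) q₀ :=
      DifferentiableAt.comp q₀ (g := fderiv ℝ f) (by rwa [hkq]) hkd.self_of_nhds
    exact h3.clm_apply (differentiableAt_const v)
  have hdc : ∀ᶠ s in 𝓝 t, deriv c s = fderiv ℝ f (s • v) v := by
    filter_upwards [hc.eventually_nhds, hline.eventually hfd] with s hs hs1
    have h3 : HasDerivAt (fun s : ℝ => f (s • v)) (fderiv ℝ f (s • v) v) s := by
      have h4 : HasDerivAt (fun s : ℝ => s • v) v s := by
        simpa using (hasDerivAt_id s).smul_const v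
      exact hs1.hasFDerivAt.comp_hasDerivAt s h4
    exact (h3.congr_of_eventuallyEq hs).deriv
  have hct : c t = q₀ := hc.self_of_nhds
  have hdct : deriv c t = R q₀ := by rw [hdc.self_of_nhds, hR0]
  -- the left-hand side
  have hL : deriv (fun s => Q (c s) (deriv c s) w) t =
      l (fderiv ℝ (fderiv ℝ k) q₀ (R q₀) w) := by
    have h3 : (fun s => Q (c s) (deriv c s) w) =ᶠ[𝓝 t]
        fun s => l (fderiv ℝ k (f (s • v)) w) := by
      filter_upwards [hc, hdc, h2, hline.eventually hkf,
        (hf.continuousAt.tendsto.comp hline).eventually hinv2] with s hs1 hs2 hs3 hs4 hs5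
      have h4 := hs5 w
      simp only [Function.comp, hs4] at h4
      rw [← hs3, h4, hs1, hs2]
    rw [h3.deriv_eq]
    have h4 : HasDerivAt (fun s : ℝ => s • v) v t := by
      simpa using (hasDerivAt_id t).smul_const v
    have h5 : HasDerivAt (fun s : ℝ => f (s • v)) (R q₀) t := by
      rw [hR0]
      exact hfd.self_of_nhds.hasFDerivAt.comp_hasDerivAt t h4
    have h6 := hkd2.hasFDerivAt.comp_hasDerivAt t h5
    exact (l.hasFDerivAt.comp_hasDerivAt t (h6.clm_apply (hasDerivAt_const t w))).deriv.trans
      (by simp)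
  -- differentiating `Q q (R q) (R q) = 1`
  have e1 : fderiv ℝ Q q₀ w (R q₀) (R q₀) + 2 * Q q₀ (R q₀) (fderiv ℝ R q₀ w) = 0 := by
    have h3 : (fun q => Q q (R q) (R q)) =ᶠ[𝓝 q₀] fun _ => 1 := by
      filter_upwards [hkt.eventually h1, hfk] with q hq hq1
      simpa only [hq1] using hq
    have h4 := ((hQ.hasFDerivAt.clm_apply hRd.hasFDerivAt).clm_apply hRd.hasFDerivAt).unique
      ((hasFDerivAt_const (1 : ℝ) q₀).congr_of_eventuallyEq h3)
    have h5 := congrArg (fun L : E →L[ℝ] ℝ => L w) h4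
    simp at h5
    have := hsymm (fderiv ℝ R q₀ w) (R q₀)
    linarith
  -- differentiating `Dk q (R q) = v`
  have e2 : fderiv ℝ (fderiv ℝ k) q₀ w (R q₀) + fderiv ℝ k q₀ (fderiv ℝ R q₀ w) = 0 := by
    have h3 : (fun q => fderiv ℝ k q (R q)) =ᶠ[𝓝 q₀] fun _ => v := by
      filter_upwards [hkt.eventually hinv1, hfk] with q hq hq1
      have := hq v
      rwa [hq1] at this
    have h4 := (hkd2.hasFDerivAt.clm_apply hRd.hasFDerivAt).unique
      ((hasFDerivAt_const v q₀).congr_of_eventuallyEq h3)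
    have h5 := congrArg (fun L : E →L[ℝ] E => L w) h4
    simp at h5
    rw [add_comm]; exact h5
  have e3 : Q q₀ (R q₀) (fderiv ℝ R q₀ w) = l (fderiv ℝ k q₀ (fderiv ℝ R q₀ w)) := by
    rw [← h2.self_of_nhds, hR0]
    have := hinv2.self_of_nhds (fderiv ℝ R q₀ w)
    rw [hkq] at this
    rw [← hp₀, this]
  have e4 : fderiv ℝ (fderiv ℝ k) q₀ (R q₀) w = fderiv ℝ (fderiv ℝ k) q₀ w (R q₀) :=
    (hk.isSymmSndFDerivAt (by simpa using ENat.LEInfty.out)).eq _ _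
  have e5 : fderiv ℝ (fun q => Q q (deriv c t) (deriv c t)) (c t) w =
      fderiv ℝ Q q₀ w (R q₀) (R q₀) := by
    rw [hct, hdct]
    have h3 := (hQ.hasFDerivAt.clm_apply (hasFDerivAt_const (R q₀) q₀)).clm_apply
      (hasFDerivAt_const (R q₀) q₀)
    rw [h3.fderiv]; simp
  -- The chain is l(D²k(R,w)) = l(D²k(w,R)) = -l(Dk(DR w)) = -Q(R, DR w) = ½ (DQ w)(R,R), by
  -- symmetry of D²k and then `e2`, `e3`, `e1`.
  have e6 := congrArg l e2
  rw [map_add, map_zero] at e6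
  rw [hL, e5, e4]
  linarith


variable {M : Type*} [TopologicalSpace M] [ChartedSpace E M] [IsManifold 𝓘(ℝ, E) ∞ M]

/-- The metric as a family of bilinear forms on the model space. -/
def met (g : RMetric E M) (y : M) : E →L[ℝ] E →L[ℝ] ℝ := g.inner y

theorem contDiffAt_chartForm_met (g : RMetric E M) (z : M) :
    ContDiffAt ℝ ∞ (chartForm (met g) z) (extChartAt 𝓘(ℝ, E) z z) :=
  (contMDiffAt_form_iff _ z).1 (g.contMDiff z)

/-- The Euler-Lagrange equation does not depend on coordinates; in the coordinates `Θ` it says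
d/dt⟨v,u⟩ = ½ ∂_u⟨v,v⟩. The right side differentiates across the line, so `h1` is needed on a
neighbourhood, while `h2` is needed only along the line. The proof transfers this to the chart at γ
t, with f the chart composed with `Θ`. -/
theorem geodesicEqAt_of_line (g : RMetric E M) {γ : ℝ → M} {t : ℝ} (Θ : OpenPartialHomeomorph E M)
    {v : E} {l : E →L[ℝ] ℝ} (hv : t • v ∈ Θ.source) (hΘ : ∀ p ∈ Θ.source, SmoothAt E E Θ p)
    (hΘs : ∀ y ∈ Θ.target, SmoothAt E E Θ.symm y) (hγ : γ =ᶠ[𝓝 t] fun s => Θ (s • v))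
    (h1 : ∀ᶠ p in 𝓝 (t • v), met g (Θ p) (mder E E Θ p v) (mder E E Θ p v) = 1)
    (h2 : ∀ᶠ s in 𝓝 t, ∀ u,
      met g (Θ (s • v)) (mder E E Θ (s • v) v) (mder E E Θ (s • v) u) = l u) :
    GeodesicEqAt g γ t := by
  have hγt : γ t = Θ (t • v) := hγ.self_of_nhds
  set z := γ t with hz
  have hline : Tendsto (fun s : ℝ => s • v) (𝓝 t) (𝓝 (t • v)) :=
    (continuous_id.smul continuous_const).tendsto t
  have hzs : Θ (t • v) ∈ (chartAt E z).source := by rw [← hγt]; exact mem_chart_source E z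
  have hq : extChartAt 𝓘(ℝ, E) z (Θ (t • v)) = extChartAt 𝓘(ℝ, E) z z := by rw [← hγt]
  have hΘc : ContinuousAt Θ (t • v) := (hΘ _ hv).continuousAt
  have hsrc : ∀ᶠ p in 𝓝 (t • v), p ∈ Θ.source := Θ.open_source.mem_nhds hv
  have hchart : ∀ᶠ p in 𝓝 (t • v), Θ p ∈ (chartAt E z).source :=
    hΘc.tendsto.eventually ((chartAt E z).open_source.mem_nhds hzs)
  have hsymm0 : (extChartAt 𝓘(ℝ, E) z).symm (extChartAt 𝓘(ℝ, E) z z) = Θ (t • v) := by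
    rw [extChartAt_to_inv, hγt]
  have htgt : Θ (t • v) ∈ Θ.target := Θ.map_source hv
  have hψ : SmoothAt E E (extChartAt 𝓘(ℝ, E) z).symm (extChartAt 𝓘(ℝ, E) z z) :=
    smoothAt_chart_symm (mem_extChartAt_target z)
  -- values of the metric in the chart
  have hval : ∀ᶠ p in 𝓝 (t • v), ∀ u w,
      chartForm (met g) z (extChartAt 𝓘(ℝ, E) z (Θ p))
        (fderiv ℝ (fun p => extChartAt 𝓘(ℝ, E) z (Θ p)) p u)
        (fderiv ℝ (fun p => extChartAt 𝓘(ℝ, E) z (Θ p)) p w) =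
      met g (Θ p) (mder E E Θ p u) (mder E E Θ p w) := by
    filter_upwards [hsrc, hchart, hchart.eventually_nhds] with p hp hpc hpe u w
    have hinv : (extChartAt 𝓘(ℝ, E) z).symm (extChartAt 𝓘(ℝ, E) z (Θ p)) = Θ p :=
      (extChartAt 𝓘(ℝ, E) z).left_inv (by simpa using hpc)
    have hs : SmoothAt E E (fun p => extChartAt 𝓘(ℝ, E) z (Θ p)) p :=
      ContMDiffAt.comp p (smoothAt_chart hpc) (hΘ p hp)
    have hm : ∀ u, mder E E (extChartAt 𝓘(ℝ, E) z).symm (extChartAt 𝓘(ℝ, E) z (Θ p))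
        (fderiv ℝ (fun p => extChartAt 𝓘(ℝ, E) z (Θ p)) p u) = mder E E Θ p u := fun u => by
      rw [← mder_eq_fderiv]
      refine (mder_comp_apply (f := fun p => extChartAt 𝓘(ℝ, E) z (Θ p))
        (smoothAt_chart_symm ((extChartAt 𝓘(ℝ, E) z).map_source (by simpa using hpc))) hs u).symm.trans
        (congrArg (fun L : E →L[ℝ] E => L u) (mder_congr ?_))
      filter_upwards [hpe] with p' hp'
      exact (extChartAt 𝓘(ℝ, E) z).left_inv (by simpa using hp')
    rw [chartForm_apply, hm, hm, hinv]
  unfold GeodesicEqAt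
  intro c w
  refine geodesic_equation_of_line (Q := chartForm (met g) z) (v := v) (l := l) (t := t) (c := c)
    (f := fun p => extChartAt 𝓘(ℝ, E) z (Θ p))
    (k := fun q => Θ.symm ((extChartAt 𝓘(ℝ, E) z).symm q)) ?_ ?_ ?_ ?_ ?_ ?_ ?_ ?_ ?_ w
  · exact contMDiffAt_iff_contDiffAt.1 (ContMDiffAt.comp _ (smoothAt_chart hzs) (hΘ _ hv))
  · simp only [hq]
    refine contMDiffAt_iff_contDiffAt.1 (ContMDiffAt.comp (I' := 𝓘(ℝ, E)) (g := Θ.symm) _ ?_ hψ)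
    rw [hsymm0]; exact hΘs _ htgt
  · simp only [hq]
    have h3 : ∀ᶠ q in 𝓝 (extChartAt 𝓘(ℝ, E) z z), (extChartAt 𝓘(ℝ, E) z).symm q ∈ Θ.target := by
      refine hψ.continuousAt.tendsto.eventually (Θ.open_target.mem_nhds ?_)
      rwa [hsymm0]
    filter_upwards [h3, extChartAt_target_mem_nhds (I := 𝓘(ℝ, E)) z] with q hq1 hq2
    rw [Θ.right_inv hq1, (extChartAt 𝓘(ℝ, E) z).right_inv hq2]
  · filter_upwards [hsrc, hchart] with p hp hpc
    rw [(extChartAt 𝓘(ℝ, E) z).left_inv (by simpa using hpc), Θ.left_inv hp]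
  · simp only [hq]
    exact (contDiffAt_chartForm_met g z).differentiableAt (by simp)
  · intro u w
    exact g.symm _ _ _
  · filter_upwards [hγ] with s hs
    simp only [c, hs, ← hz]
  · filter_upwards [hval, h1] with p hp hp1
    rw [hp, hp1]
  · filter_upwards [hline.eventually hval, h2] with s hs hs2 u
    rw [hs, hs2]

end Geodesic

/-! ### Action fields, the adjoint representation and the isotropy representation. -/

section SmoothActions

variable {EG : Type*} [NormedAddCommGroup EG] [NormedSpace ℝ EG]
  {G : Type*} [TopologicalSpace G] [ChartedSpace EG G] [Group G]
  {E : Type*} [NormedAddCommGroup E] [NormedSpace ℝ E]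
  {M : Type*} [TopologicalSpace M] [ChartedSpace E M] [MulAction G M]

variable (EG G E) in
/-- The derivative at the identity of the orbit map of `y`, between the model spaces. -/
def act (y : M) : EG →L[ℝ] E := mder EG E (fun a : G => a • y) 1

variable (E) in
/-- The derivative at `y` of the action of `a`, between the model spaces. -/
def dsm (a : G) (y : M) : E →L[ℝ] E := mder E E (fun z : M => a • z) y

/-- The adjoint representation as a continuous linear map of the model space. -/
def adL (a : G) : EG →L[ℝ] EG := mder EG EG (fun h : G => a * h * a⁻¹) 1

section
variable [ContMDiffSMul 𝓘(ℝ, EG) 𝓘(ℝ, E) ∞ G M]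

theorem SmoothAt.smul {F : Type*} [NormedAddCommGroup F] [NormedSpace ℝ F]
    {N : Type*} [TopologicalSpace N] [ChartedSpace F N] {f : N → G} {h : N → M} {z : N}
    (hf : SmoothAt F EG f z) (hh : SmoothAt F E h z) : SmoothAt F E (fun z => f z • h z) z :=
  ContMDiffAt.smul (I := 𝓘(ℝ, EG)) hf hh

theorem smoothAt_const_smul (EG : Type*) [NormedAddCommGroup EG] [NormedSpace ℝ EG]
    [ChartedSpace EG G] [ContMDiffSMul 𝓘(ℝ, EG) 𝓘(ℝ, E) ∞ G M]
    (a : G) (y : M) : SmoothAt E E (fun z : M => a • z) y :=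
  SmoothAt.smul (EG := EG) contMDiffAt_const contMDiffAt_id

theorem smoothAt_smul_const (y : M) (a : G) : SmoothAt EG E (fun a : G => a • y) a :=
  SmoothAt.smul contMDiffAt_id contMDiffAt_const

theorem dsm_mul (EG : Type*) [NormedAddCommGroup EG] [NormedSpace ℝ EG]
    [ChartedSpace EG G] [ContMDiffSMul 𝓘(ℝ, EG) 𝓘(ℝ, E) ∞ G M]
    (a b : G) (y : M) : dsm E (a * b) y = (dsm E a (b • y)).comp (dsm E b y) := by
  have h := mder_comp (smoothAt_const_smul EG (E := E) a (b • y)) (smoothAt_const_smul EG b y)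
  refine Eq.trans ?_ h
  simp only [dsm, mul_smul]

omit [TopologicalSpace G] in
theorem dsm_one (y : M) : dsm E (1 : G) y = ContinuousLinearMap.id ℝ E := by
  unfold dsm
  simp only [one_smul]
  exact mder_id y

theorem dsm_inv_apply (EG : Type*) [NormedAddCommGroup EG] [NormedSpace ℝ EG]
    [ChartedSpace EG G] [ContMDiffSMul 𝓘(ℝ, EG) 𝓘(ℝ, E) ∞ G M]
    (a : G) (y : M) (v : E) : dsm E a⁻¹ (a • y) (dsm E a y v) = v := by
  have h := dsm_mul EG (E := E) a⁻¹ a y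
  rw [inv_mul_cancel, dsm_one] at h
  exact (congrArg (fun L : E →L[ℝ] E => L v) h).symm

variable [LieGroup 𝓘(ℝ, EG) ∞ G]

omit [MulAction G M] [ContMDiffSMul 𝓘(ℝ, EG) 𝓘(ℝ, E) ∞ G M] in
theorem SmoothAt.mul {F : Type*} [NormedAddCommGroup F] [NormedSpace ℝ F]
    {N : Type*} [TopologicalSpace N] [ChartedSpace F N] {f h : N → G} {z : N}
    (hf : SmoothAt F EG f z) (hh : SmoothAt F EG h z) : SmoothAt F EG (fun z => f z * h z) z :=
  ContMDiffAt.mul hf hh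

theorem SmoothAt.inv {F : Type*} [NormedAddCommGroup F] [NormedSpace ℝ F]
    {N : Type*} [TopologicalSpace N] [ChartedSpace F N] {f : N → G} {z : N}
    (hf : SmoothAt F EG f z) : SmoothAt F EG (fun z => (f z)⁻¹) z :=
  ContMDiffAt.inv hf

/-- Differentiate (a h a⁻¹) • (a • y) = a • (h • y) in h at the identity. -/
theorem act_smul (a : G) (y : M) (X : EG) :
    act EG G E (a • y) (adL a X) = dsm E a y (act EG G E y X) := by
  have hc : SmoothAt EG EG (fun h : G => a * h * a⁻¹) 1 :=
    (SmoothAt.mul contMDiffAt_const contMDiffAt_id).mul contMDiffAt_const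
  have h0 : a * (1 : G) * a⁻¹ = 1 := by simp
  have h1 := mder_comp_apply (P := M) (g := fun b : G => b • a • y) (f := fun h : G => a * h * a⁻¹)
    (y := 1) (smoothAt_smul_const (E := E) (a • y) _) hc X
  have h2 := mder_comp_apply (f := fun b : G => b • y) (y := (1 : G))
    (smoothAt_const_smul EG (E := E) a _) (smoothAt_smul_const y 1) X
  simp only [h0] at h1
  simp only [one_smul] at h2
  rw [act, adL, ← h1, act, dsm, ← h2]
  congr 2
  funext h
  simp [mul_smul]

theorem act_smul' (a : G) (y : M) (X : EG) :
    act EG G E (a • y) X = dsm E a y (act EG G E y (adL a⁻¹ X)) := by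
  rw [← act_smul, ← ContinuousLinearMap.comp_apply (adL a)]
  congr 1
  have hc : ∀ a z : G, SmoothAt EG EG (fun h : G => a * h * a⁻¹) z := fun a z =>
    (SmoothAt.mul contMDiffAt_const contMDiffAt_id).mul contMDiffAt_const
  have h1 := mder_comp_apply (g := fun h : G => a * h * a⁻¹) (f := fun h : G => a⁻¹ * h * a⁻¹⁻¹)
    (y := 1) (hc _ _) (hc _ _) X
  have h0 : a⁻¹ * (1 : G) * a⁻¹⁻¹ = 1 := by simp
  have h3 : (fun z : G => a * (a⁻¹ * z * a⁻¹⁻¹) * a⁻¹) = fun z => z := by funext z; group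
  rw [h0, h3, mder_id] at h1
  exact h1

/-- Derivatives of orbit maps take values in the tangent spaces of the orbits. -/
theorem mder_orbit_mem_range (y : M) (a : G) (u : EG) :
    mder EG E (fun a : G => a • y) a u ∈ LinearMap.range (act EG G E (a • y)).toLinearMap := by
  have hc : SmoothAt EG EG (fun h : G => h * a⁻¹) a := SmoothAt.mul contMDiffAt_id contMDiffAt_const
  have h1 := mder_comp_apply (P := M) (g := fun b : G => b • a • y) (f := fun h : G => h * a⁻¹)
    (y := a) (smoothAt_smul_const (E := E) (a • y) _) hc u
  have h3 : (fun h : G => (h * a⁻¹) • a • y) = fun h => h • y := by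
    funext h; simp [smul_smul]
  rw [h3, mul_inv_cancel] at h1
  exact ⟨_, h1.symm⟩

/-- The tangent space of the orbit at a • y is contained in the image under the derivative of a of
the one at y. -/
theorem finrank_range_act_smul_le [FiniteDimensional ℝ E] (a : G) (y : M) :
    Module.finrank ℝ (LinearMap.range (act EG G E (a • y)).toLinearMap) ≤
      Module.finrank ℝ (LinearMap.range (act EG G E y).toLinearMap) := by
  refine le_trans (Submodule.finrank_mono (t := Submodule.map (dsm E a y).toLinearMap
    (LinearMap.range (act EG G E y).toLinearMap)) ?_) (Submodule.finrank_map_le _ _)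
  rintro _ ⟨X, rfl⟩
  exact ⟨_, ⟨_, rfl⟩, (act_smul' a y X).symm⟩

end

section Metric
variable [IsManifold 𝓘(ℝ, E) ∞ M]

omit [TopologicalSpace G] in
theorem met_smul {g : RMetric E M} (hg : IsInvariantMetric G g) (a : G) (y : M) (v w : E) :
    met g (a • y) (dsm E a y v) (dsm E a y w) = met g y v w := hg a y v w

theorem met_symm (g : RMetric E M) (y : M) (v w : E) : met g y v w = met g y w v := g.symm y v w

theorem met_pos (g : RMetric E M) (y : M) {v : E} (hv : v ≠ 0) : 0 < met g y v v := g.pos y v hv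

end Metric

section Isotropy
variable {x : M} {k : G}

theorem dsm_mul_of_mem (EG : Type*) [NormedAddCommGroup EG] [NormedSpace ℝ EG]
    [ChartedSpace EG G] [ContMDiffSMul 𝓘(ℝ, EG) 𝓘(ℝ, E) ∞ G M]
    (hk : k ∈ MulAction.stabilizer G x) (a : G) (v : E) :
    dsm E (a * k) x v = dsm E a x (dsm E k x v) := by
  have : k • x = x := hk
  rw [dsm_mul EG, this]; rfl

omit [TopologicalSpace G] in
theorem met_dsm_of_mem [IsManifold 𝓘(ℝ, E) ∞ M] {g : RMetric E M} (hg : IsInvariantMetric G g)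
    (hk : k ∈ MulAction.stabilizer G x) (v w : E) :
    met g x (dsm E k x v) (dsm E k x w) = met g x v w := by
  have h := met_smul hg k x v w
  have hk' : k • x = x := hk
  rwa [hk'] at h

end Isotropy

end SmoothActions

/-! ### Averaging over the isotropy group. -/

section Averaging

/-- Haar measure of K pushed forward to G: averages over K become integrals over the manifold G, and
K itself needs no smooth structure. -/
theorem exists_subgroup_haar {G : Type*} [TopologicalSpace G] [Group G] [IsTopologicalGroup G]
    [CompactSpace G] [MeasurableSpace G] [BorelSpace G] (K : Subgroup G)
    (hK : IsClosed (K : Set G)) :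
    ∃ μ : Measure G, IsProbabilityMeasure μ ∧ (∀ᵐ a ∂μ, a ∈ K) ∧
      ∀ k ∈ K, μ.map (fun a => k * a) = μ := by
  have : CompactSpace K := isCompact_iff_compactSpace.1 hK.isCompact
  let ν : Measure K := Measure.haarMeasure ⊤
  have hν : IsProbabilityMeasure ν := ⟨by
    simpa using Measure.haarMeasure_self (K₀ := (⊤ : TopologicalSpace.PositiveCompacts K))⟩
  have hm : Measurable (Subtype.val : K → G) := measurable_subtype_coe
  refine ⟨ν.map Subtype.val, Measure.isProbabilityMeasure_map hm.aemeasurable, ?_, ?_⟩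
  · refine (ae_map_iff (p := fun a => a ∈ K) hm.aemeasurable hK.measurableSet).2 ?_
    exact Eventually.of_forall fun a => a.2
  · intro k hk
    have h1 : Measurable fun a : G => k * a := (continuous_const_mul k).measurable
    have h2 : Measurable fun a : K => (⟨k, hk⟩ : K) * a := (continuous_const_mul _).measurable
    rw [Measure.map_map h1 hm]
    conv_rhs => rw [← map_mul_left_eq_self ν (⟨k, hk⟩ : K), Measure.map_map hm h2]
    rfl

variable {EG : Type*} [NormedAddCommGroup EG] [NormedSpace ℝ EG]
  {G : Type*} [TopologicalSpace G] [ChartedSpace EG G] [Group G]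
  [LieGroup 𝓘(ℝ, EG) ∞ G] [CompactSpace G]
  {E : Type*} [NormedAddCommGroup E] [NormedSpace ℝ E] [FiniteDimensional ℝ E]
  {M : Type*} [TopologicalSpace M] [ChartedSpace E M] [IsManifold 𝓘(ℝ, E) ∞ M] [T2Space M]
  [MulAction G M]

omit [FiniteDimensional ℝ E] [LieGroup 𝓘(ℝ, EG) ∞ G] [CompactSpace G] [T2Space M] in
variable (EG) in
theorem smoothAt_smul_chart_symm [ContMDiffSMul 𝓘(ℝ, EG) 𝓘(ℝ, E) ∞ G M] (z : M) (a : G) {q : E}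
    (hq : q ∈ (extChartAt 𝓘(ℝ, E) z).target) :
    ContMDiffAt (𝓘(ℝ, EG).prod 𝓘(ℝ, E)) 𝓘(ℝ, E) ∞
      (fun p : G × E => p.1 • (extChartAt 𝓘(ℝ, E) z).symm p.2) (a, q) :=
  ContMDiffAt.smul (I := 𝓘(ℝ, EG)) (f := Prod.fst) contMDiffAt_fst
    (ContMDiffAt.comp (I' := 𝓘(ℝ, E)) (g := (extChartAt 𝓘(ℝ, E) z).symm) (a, q)
      (smoothAt_chart_symm hq) contMDiffAt_snd)

/-- A globally defined smooth map to the model space, with derivative the identity at a point. -/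
theorem exists_global_chart (x : M) : ∃ φ : M → E, (∀ y, SmoothAt E E φ y) ∧ φ x = 0 ∧
    mder E E φ x = ContinuousLinearMap.id ℝ E := by
  obtain ⟨f⟩ : Nonempty (SmoothBumpFunction 𝓘(ℝ, E) x) := inferInstance
  have hs : ∀ y ∈ (chartAt E x).source, SmoothAt E E
      (fun y => extChartAt 𝓘(ℝ, E) x y - extChartAt 𝓘(ℝ, E) x x) y := fun y hy =>
    (smoothAt_chart hy).sub contMDiffAt_const
  refine ⟨fun y => f y • (extChartAt 𝓘(ℝ, E) x y - extChartAt 𝓘(ℝ, E) x x), ?_, by simp, ?_⟩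
  · exact f.contMDiff_smul fun y hy => (hs y hy).contMDiffWithinAt
  · have h1 : (fun y => f y • (extChartAt 𝓘(ℝ, E) x y - extChartAt 𝓘(ℝ, E) x x)) =ᶠ[𝓝 x]
        fun y => (fun q : E => q - extChartAt 𝓘(ℝ, E) x x) (extChartAt 𝓘(ℝ, E) x y) := by
      filter_upwards [f.eventuallyEq_one] with y hy
      rw [hy]; simp
    rw [mder_congr h1, mder_comp (g := fun q : E => q - extChartAt 𝓘(ℝ, E) x x)
      (contMDiffAt_id.sub contMDiffAt_const)
      (smoothAt_chart (mem_chart_source E x)), mder_chart_self, mder_eq_fderiv,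
      fderiv_sub_const, fderiv_fun_id]
    rfl

/-- Local linearization of the action of the isotropy group, by averaging. -/
theorem exists_equivariant_chart (EG : Type*) [NormedAddCommGroup EG] [NormedSpace ℝ EG]
    [ChartedSpace EG G] [LieGroup 𝓘(ℝ, EG) ∞ G] [ContMDiffSMul 𝓘(ℝ, EG) 𝓘(ℝ, E) ∞ G M] (x : M) : ∃ φ : M → E, (∀ y, SmoothAt E E φ y) ∧ φ x = 0 ∧
    mder E E φ x = ContinuousLinearMap.id ℝ E ∧
    ∀ k ∈ MulAction.stabilizer G x, ∀ y, φ (k • y) = dsm E k x (φ y) := by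
  have : IsTopologicalGroup G := topologicalGroup_of_lieGroup 𝓘(ℝ, EG) ∞
  have : ContinuousSMul G M := ContMDiffSMul.continuousSMul (I := 𝓘(ℝ, EG)) (I' := 𝓘(ℝ, E)) ∞
  let _ : MeasurableSpace G := borel G
  have : BorelSpace G := ⟨rfl⟩
  obtain ⟨φ, hφ, hφ0, hφd⟩ := exists_global_chart (E := E) x
  have hK : IsClosed (MulAction.stabilizer G x : Set G) :=
    isClosed_eq (f := fun a : G => a • x) (by fun_prop) continuous_const
  obtain ⟨μ, hμ, hμK, hμinv⟩ := exists_subgroup_haar _ hK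
  let q₀ : E := extChartAt 𝓘(ℝ, E) x x
  have hxx : (extChartAt 𝓘(ℝ, E) x).symm q₀ = x := extChartAt_to_inv x
  have hq₀ : q₀ ∈ (extChartAt 𝓘(ℝ, E) x).target := mem_extChartAt_target x
  -- A smooth extension to all of G of the isotropy representation k ↦ dk of K: for k in K the
  -- derivative at q₀ is dk, because φ has derivative the identity at x (`hLK`).
  let L : G → E →L[ℝ] E := fun a => fderiv ℝ (fun q => φ (a • (extChartAt 𝓘(ℝ, E) x).symm q)) q₀
  have hφs : ∀ (z : M) (a : G), ∀ q ∈ (extChartAt 𝓘(ℝ, E) z).target,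
      ContMDiffAt (𝓘(ℝ, EG).prod 𝓘(ℝ, E)) 𝓘(ℝ, E) ∞
        (fun p : G × E => φ (p.1 • (extChartAt 𝓘(ℝ, E) z).symm p.2)) (a, q) := fun z a q hq =>
    ContMDiffAt.comp (I' := 𝓘(ℝ, E)) (a, q) (hφ _) (smoothAt_smul_chart_symm EG z a hq)
  have hL : ∀ a, ContMDiffAt 𝓘(ℝ, EG) 𝓘(ℝ, E →L[ℝ] E) ∞ L a := fun a =>
    ContMDiffAt.comp (I' := 𝓘(ℝ, EG).prod 𝓘(ℝ, E)) (f := fun a : G => (a, q₀))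
      (g := fun p : G × E =>
        fderiv ℝ (fun q => φ (p.1 • (extChartAt 𝓘(ℝ, E) x).symm q)) p.2) a
      (contMDiffAt_fderiv_param (h := fun (a : G) q => φ (a • (extChartAt 𝓘(ℝ, E) x).symm q))
        (hφs x a q₀ hq₀)) (contMDiffAt_id.prodMk contMDiffAt_const)
  have hLK : ∀ k ∈ MulAction.stabilizer G x, L k = dsm E k x := by
    intro k hk
    have hkx : k • x = x := hk
    have h1 := mder_comp (g := fun y : M => k • y) (f := (extChartAt 𝓘(ℝ, E) x).symm) (y := q₀)
      (smoothAt_const_smul EG k _) (smoothAt_chart_symm hq₀)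
    have h2 := mder_comp (g := φ) (f := fun q => k • (extChartAt 𝓘(ℝ, E) x).symm q) (y := q₀)
      (hφ _) ((smoothAt_const_smul EG k _).comp q₀ (smoothAt_chart_symm hq₀))
    simp only [L]
    rw [← mder_eq_fderiv, h2, hxx, hkx, hφd, h1, hxx, mder_chart_symm_self]
    rfl
  let h : M → G → E → E := fun z a q => L a (φ (a⁻¹ • (extChartAt 𝓘(ℝ, E) z).symm q))
  have hh : ∀ z a, ∀ q ∈ (extChartAt 𝓘(ℝ, E) z).target,
      ContMDiffAt (𝓘(ℝ, EG).prod 𝓘(ℝ, E)) 𝓘(ℝ, E) ∞ (fun p : G × E => h z p.1 p.2) (a, q) := by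
    intro z a q hq
    refine ContMDiffAt.clm_apply ((hL a).comp (a, q) contMDiffAt_fst) ?_
    exact ContMDiffAt.comp (I' := 𝓘(ℝ, EG).prod 𝓘(ℝ, E)) (f := fun p : G × E => (p.1⁻¹, p.2))
      (g := fun p : G × E => φ (p.1 • (extChartAt 𝓘(ℝ, E) z).symm p.2)) (a, q)
      (hφs z a⁻¹ q hq) ((contMDiffAt_fst.inv).prodMk contMDiffAt_snd)
  -- The average over K of dk ∘ φ ∘ k⁻¹. Each term has derivative the identity at x, and left
  -- invariance of μ gives equivariance.
  let Φ : M → E := fun y => ∫ a, L a (φ (a⁻¹ • y)) ∂μ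
  have hΦ : ∀ z, Φ =ᶠ[𝓝 z] fun y => (fun q => ∫ a, h z a q ∂μ) (extChartAt 𝓘(ℝ, E) z y) := by
    intro z
    filter_upwards [extChartAt_source_mem_nhds (I := 𝓘(ℝ, E)) z] with y hy
    simp only [Φ, h, (extChartAt 𝓘(ℝ, E) z).left_inv hy]
  have hΦs : ∀ z, SmoothAt E E (fun q => ∫ a, h z a q ∂μ) (extChartAt 𝓘(ℝ, E) z z) := fun z =>
    contMDiffAt_iff_contDiffAt.2 ((contDiffOn_integral_param μ (isOpen_extChartAt_target z)
      (hh z)).contDiffAt (extChartAt_target_mem_nhds z))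
  refine ⟨Φ, fun z => ?_, ?_, ?_, ?_⟩
  · exact ((hΦs z).comp z (smoothAt_chart (mem_chart_source E z))).congr_of_eventuallyEq (hΦ z)
  · refine integral_eq_zero_of_ae ?_
    filter_upwards [hμK] with a ha
    have : a⁻¹ • x = x := (MulAction.stabilizer G x).inv_mem ha
    simp [this, hφ0]
  · rw [mder_congr (hΦ x), mder_comp (hΦs x) (smoothAt_chart (mem_chart_source E x)),
      mder_chart_self, mder_eq_fderiv,
      (hasFDerivAt_integral_param μ (isOpen_extChartAt_target x) (hh x) hq₀).fderiv]
    have h1 : ∀ᵐ a ∂μ, fderiv ℝ (h x a) q₀ = ContinuousLinearMap.id ℝ E := by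
      filter_upwards [hμK] with a ha
      have ha' := (MulAction.stabilizer G x).inv_mem ha
      have h2 : DifferentiableAt ℝ (fun q => φ (a⁻¹ • (extChartAt 𝓘(ℝ, E) x).symm q)) q₀ :=
        (contMDiffAt_iff_contDiffAt.1 ((hφ _).comp q₀
          ((smoothAt_const_smul EG a⁻¹ _).comp q₀ (smoothAt_chart_symm hq₀)))).differentiableAt
          (by simp)
      have h3 := ((L a).hasFDerivAt.comp q₀ h2.hasFDerivAt).fderiv
      refine h3.trans ?_
      have h4 : L a⁻¹ = dsm E a⁻¹ x := hLK _ ha'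
      rw [hLK a ha]
      refine (congrArg (fun T => (dsm E a x).comp T) h4).trans ?_
      have h5 := dsm_mul EG (E := E) a a⁻¹ x
      have h6 : a⁻¹ • x = x := ha'
      rw [mul_inv_cancel, dsm_one, h6] at h5
      exact h5.symm
    rw [integral_congr_ae h1]
    simp
  · intro k hk y
    have hc : Continuous fun a : G => L a (φ (a⁻¹ • (k • y))) :=
      (continuous_iff_continuousAt.2 fun a => (hL a).continuousAt).clm_apply
        ((continuous_iff_continuousAt.2 fun z => (hφ z).continuousAt).comp
          (continuous_inv.smul continuous_const))
    have : ProperSpace E := FiniteDimensional.proper_real E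
    simp only [Φ]
    rw [← ContinuousLinearMap.integral_comp_comm]
    · conv_lhs => rw [← hμinv k hk]
      rw [integral_map (by fun_prop) hc.aestronglyMeasurable]
      refine integral_congr_ae ?_
      filter_upwards [hμK] with a ha
      rw [hLK _ (mul_mem hk ha), hLK a ha, dsm_mul_of_mem EG ha, mul_inv_rev, mul_smul,
        inv_smul_smul]
    · refine Continuous.integrable_of_hasCompactSupport ?_ (HasCompactSupport.of_compactSpace _)
      exact (continuous_iff_continuousAt.2 fun a => (hL a).continuousAt).clm_apply
        ((continuous_iff_continuousAt.2 fun z => (hφ z).continuousAt).comp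
          (continuous_inv.smul continuous_const))

end Averaging

/-! ### Positive definite forms and the orthogonal splitting along an orbit. -/

section LinearAlgebra
variable {E : Type*} [NormedAddCommGroup E] [NormedSpace ℝ E] [FiniteDimensional ℝ E]

theorem exists_mul_sq_norm_le {b : E →L[ℝ] E →L[ℝ] ℝ} (hb : ∀ v, v ≠ 0 → 0 < b v v) :
    ∃ c > 0, ∀ v, c * ‖v‖ ^ 2 ≤ b v v := by
  have : ProperSpace E := FiniteDimensional.proper_real E
  by_cases hE : (Metric.sphere (0 : E) 1).Nonempty
  · obtain ⟨u, hu, hmin⟩ := (isCompact_sphere (0 : E) 1).exists_isMinOn hE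
      (f := fun v => b v v) (b.continuous.clm_apply continuous_id).continuousOn
    have hu0 : u ≠ 0 := by
      rintro rfl
      simp at hu
    refine ⟨b u u, hb u hu0, fun v => ?_⟩
    by_cases hv : v = 0
    · simp [hv]
    · have hn : ‖v‖ ≠ 0 := norm_ne_zero_iff.2 hv
      have h1 : b u u ≤ b (‖v‖⁻¹ • v) (‖v‖⁻¹ • v) := hmin (by simp [norm_smul, hn])
      simp only [map_smul, smul_apply, smul_eq_mul] at h1
      calc b u u * ‖v‖ ^ 2 ≤ (‖v‖⁻¹ * (‖v‖⁻¹ * b v v)) * ‖v‖ ^ 2 := by gcongr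
        _ = b v v := by field_simp
  · refine ⟨1, one_pos, fun v => ?_⟩
    have : v = 0 := by
      by_contra hv
      exact hE ⟨‖v‖⁻¹ • v, by simp [norm_smul, hv]⟩
    simp [this]

theorem exists_form_ball_subset {b : E →L[ℝ] E →L[ℝ] ℝ} (hb : ∀ v, v ≠ 0 → 0 < b v v)
    {S : Set E} (hS : S ∈ 𝓝 (0 : E)) : ∃ r > 0, ∀ v, b v v < r → v ∈ S := by
  obtain ⟨c, hc, h⟩ := exists_mul_sq_norm_le hb
  obtain ⟨ε, hε, hball⟩ := Metric.mem_nhds_iff.1 hS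
  refine ⟨c * ε ^ 2, by positivity, fun v hv => hball ?_⟩
  have h1 : ‖v‖ ^ 2 < ε ^ 2 := lt_of_mul_lt_mul_left ((h v).trans_lt hv) hc.le
  simpa using lt_of_pow_lt_pow_left₀ 2 hε.le h1

omit [FiniteDimensional ℝ E] in
theorem form_ball_mem_nhds (b : E →L[ℝ] E →L[ℝ] ℝ) {r : ℝ} {v : E} (hv : b v v < r) :
    ∀ᶠ w in 𝓝 v, b w w < r :=
  (isOpen_lt (b.continuous.clm_apply continuous_id) continuous_const).mem_nhds hv

theorem isVonNBounded_form_ball {b : E →L[ℝ] E →L[ℝ] ℝ} (hb : ∀ v, v ≠ 0 → 0 < b v v) :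
    Bornology.IsVonNBounded ℝ {v : E | b v v < 1} := by
  obtain ⟨c, hc, h⟩ := exists_mul_sq_norm_le hb
  rw [NormedSpace.isVonNBounded_iff]
  refine (Metric.isBounded_ball (x := (0 : E)) (r := c⁻¹ + 1)).subset fun v hv => ?_
  have h1 : c * ‖v‖ ^ 2 < 1 := (h v).trans_lt hv
  have h2 : ‖v‖ ^ 2 < c⁻¹ := by
    simpa using (lt_inv_mul_iff₀ hc (b := (1 : ℝ))).2 h1
  have h3 : 0 < c⁻¹ := by positivity
  rw [Metric.mem_ball, dist_zero_right]
  nlinarith [norm_nonneg v]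

/-- Linear maps splitting `E` into the range of `τ`, parametrized by `m`, and its orthogonal
complement. -/
structure IsSplitting {V : Type*} [NormedAddCommGroup V] [NormedSpace ℝ V]
    (b : E →L[ℝ] E →L[ℝ] ℝ) (τ : V →L[ℝ] E) (m : Submodule ℝ V) (pr : E →L[ℝ] E) (q : E →L[ℝ] V) :
    Prop where
  mem : ∀ u, q u ∈ m
  add_eq : ∀ u, τ (q u) + pr u = u
  orth : ∀ u Z, b (pr u) (τ Z) = 0
  inj : ∀ X ∈ m, τ X = 0 → X = 0
  pos : ∀ v, v ≠ 0 → 0 < b v v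

namespace IsSplitting
variable {V : Type*} [NormedAddCommGroup V] [NormedSpace ℝ V]
    {b : E →L[ℝ] E →L[ℝ] ℝ} {τ : V →L[ℝ] E} {m : Submodule ℝ V} {pr : E →L[ℝ] E} {q : E →L[ℝ] V}

omit [FiniteDimensional ℝ E]

theorem eq_zero_of_form (h : IsSplitting b τ m pr q) {v : E} (hv : b v v = 0) : v = 0 := by
  by_contra h0
  exact (h.pos v h0).ne' hv

/-- The difference of two candidates for the normal part lies in the range of τ and is orthogonal to
it, so it vanishes; injectivity of τ on m does the rest. -/
theorem unique (h : IsSplitting b τ m pr q) {X : V} {v : E} (hX : X ∈ m)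
    (hv : ∀ Z, b v (τ Z) = 0) : q (τ X + v) = X ∧ pr (τ X + v) = v := by
  have h1 := h.add_eq (τ X + v)
  have h2 : pr (τ X + v) - v = τ (X - q (τ X + v)) := by
    rw [map_sub τ, sub_eq_sub_iff_add_eq_add, add_comm, h1]
  have h5 : b (pr (τ X + v) - v) (τ (X - q (τ X + v))) = 0 := by
    rw [map_sub b, sub_apply, h.orth, hv, sub_zero]
  have h3 : pr (τ X + v) - v = 0 := h.eq_zero_of_form (by rw [← h2] at h5; exact h5)
  have h4 : X - q (τ X + v) = 0 := h.inj _ (m.sub_mem hX (h.mem _)) (by rw [← h2, h3])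
  exact ⟨(sub_eq_zero.1 h4).symm, sub_eq_zero.1 h3⟩

theorem map_of_mem (h : IsSplitting b τ m pr q) {X : V} (hX : X ∈ m) :
    q (τ X) = X ∧ pr (τ X) = 0 := by
  simpa using h.unique (v := 0) hX (by simp)

theorem map_of_orth (h : IsSplitting b τ m pr q) {v : E} (hv : ∀ Z, b v (τ Z) = 0) :
    q v = 0 ∧ pr v = v := by
  simpa using h.unique m.zero_mem hv

theorem q_pr (h : IsSplitting b τ m pr q) (u : E) : q (pr u) = 0 := (h.map_of_orth (h.orth u)).1

theorem pr_pr (h : IsSplitting b τ m pr q) (u : E) : pr (pr u) = pr u :=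
  (h.map_of_orth (h.orth u)).2

theorem pr_range (h : IsSplitting b τ m pr q) (Z : V) : pr (τ Z) = 0 := by
  have h1 := h.add_eq (τ Z)
  have h2 : pr (τ Z) = τ (Z - q (τ Z)) := by rw [map_sub, eq_sub_iff_add_eq, add_comm, h1]
  have h3 := h.orth (τ Z) (Z - q (τ Z))
  rw [← h2] at h3
  exact h.eq_zero_of_form h3

end IsSplitting

/-- Since m complements the kernel of τ, it maps onto the range of τ; q is the orthogonal projection
onto that range followed by a linear section into m. -/
theorem exists_splitting {V : Type*} [NormedAddCommGroup V] [NormedSpace ℝ V]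
    {b : E →L[ℝ] E →L[ℝ] ℝ} (hb : ∀ v, v ≠ 0 → 0 < b v v) (hs : ∀ u v, b u v = b v u)
    (τ : V →L[ℝ] E) {m : Submodule ℝ V}
    (h1 : LinearMap.ker τ.toLinearMap ⊓ m = ⊥) (h2 : LinearMap.ker τ.toLinearMap ⊔ m = ⊤) :
    ∃ pr q, IsSplitting b τ m pr q := by
  let B : LinearMap.BilinForm ℝ E := LinearMap.mk₂ ℝ (fun u v => b u v) (by simp) (by simp) (by simp)
    (by simp)
  let W : Submodule ℝ E := LinearMap.range τ.toLinearMap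
  have hB : ∀ u v, B u v = b u v := fun u v => rfl
  have hW : (B.restrict W).Nondegenerate := by
    have h0 : ∀ w : W, b w w = 0 → w = 0 := fun w hw => by
      by_contra hw0
      exact (hb w (by simpa using hw0)).ne' hw
    exact ⟨fun w hw => h0 w (hw w), fun w hw => h0 w (hw w)⟩
  have hc : IsCompl W (B.orthogonal W) :=
    LinearMap.BilinForm.isCompl_orthogonal_of_restrict_nondegenerate
      (fun u v h => by rw [hB] at *; rw [hs]; exact h) hW
  let T : m →ₗ[ℝ] W := τ.toLinearMap.rangeRestrict.comp m.subtype
  have hT : Function.Surjective T := by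
    rintro ⟨_, Z, rfl⟩
    have hZ : Z ∈ LinearMap.ker τ.toLinearMap ⊔ m := by rw [h2]; trivial
    obtain ⟨Y, hY, X, hX, rfl⟩ := Submodule.mem_sup.1 hZ
    refine ⟨⟨X, hX⟩, Subtype.ext ?_⟩
    have hY' : τ Y = 0 := hY
    simp [T, hY']
  obtain ⟨s, hs'⟩ := T.exists_rightInverse_of_surjective (LinearMap.range_eq_top.2 hT)
  let P : E →ₗ[ℝ] W := W.projectionOnto _ hc
  let q : E →L[ℝ] V := ((m.subtype.comp (s.comp P) : E →ₗ[ℝ] V)).toContinuousLinearMap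
  have hq : ∀ u, τ (q u) = P u := fun u => congrArg (Subtype.val) (LinearMap.congr_fun hs' (P u))
  refine ⟨ContinuousLinearMap.id ℝ E - τ.comp q, q, fun u => (s (P u)).2, fun u => by simp,
    ?_, ?_, hb⟩
  · intro u Z
    have h3 : u - P u ∈ B.orthogonal W := by
      have : P (u - P u) = 0 := by
        rw [map_sub, Submodule.projectionOnto_apply_left, sub_self]
      rwa [Submodule.projectionOnto_apply_eq_zero_iff] at this
    have h4 := h3 (τ Z) ⟨Z, rfl⟩
    replace h4 : b (τ Z) (u - P u) = 0 := h4
    simp only [sub_apply, ContinuousLinearMap.id_apply,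
      ContinuousLinearMap.comp_apply, hq]
    rw [hs, h4]
  · intro X hX h0
    have : X ∈ LinearMap.ker τ.toLinearMap ⊓ m := ⟨h0, hX⟩
    rwa [h1] at this

end LinearAlgebra

/-! ### Equivariant parametrization of a neighbourhood of x. -/

section Slice

variable {EG : Type*} [NormedAddCommGroup EG] [NormedSpace ℝ EG]
  {G : Type*} [TopologicalSpace G] [ChartedSpace EG G] [Group G]

/-- A smooth parametrization of a neighbourhood of the identity by the Lie algebra. -/
def chartExp (Z : EG) : G :=
  (extChartAt 𝓘(ℝ, EG) (1 : G)).symm (extChartAt 𝓘(ℝ, EG) (1 : G) 1 + Z)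

theorem chartExp_zero : (chartExp (0 : EG) : G) = 1 := by simp [chartExp]

theorem smoothAt_chartExp [IsManifold 𝓘(ℝ, EG) ∞ G] :
    ∀ᶠ Z in 𝓝 (0 : EG), SmoothAt EG EG (chartExp : EG → G) Z := by
  have h : Continuous fun Z : EG => extChartAt 𝓘(ℝ, EG) (1 : G) 1 + Z := by fun_prop
  have h1 : ∀ᶠ Z in 𝓝 (0 : EG), extChartAt 𝓘(ℝ, EG) (1 : G) 1 + Z ∈
      (extChartAt 𝓘(ℝ, EG) (1 : G)).target :=
    h.continuousAt.eventually_mem (by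
      rw [add_zero]; exact extChartAt_target_mem_nhds (I := 𝓘(ℝ, EG)) (1 : G))
  filter_upwards [h1] with Z hZ
  exact ContMDiffAt.comp (I' := 𝓘(ℝ, EG)) (f := fun Z : EG => extChartAt 𝓘(ℝ, EG) (1 : G) 1 + Z) Z
    (smoothAt_chart_symm hZ) (contMDiffAt_iff_contDiffAt.2 (by fun_prop))

theorem mder_chartExp [IsManifold 𝓘(ℝ, EG) ∞ G] :
    mder EG EG (chartExp : EG → G) 0 = ContinuousLinearMap.id ℝ EG := by
  have h := mder_comp (g := (extChartAt 𝓘(ℝ, EG) (1 : G)).symm)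
    (f := fun Z : EG => extChartAt 𝓘(ℝ, EG) (1 : G) 1 + Z) (y := 0) (E := EG) (F := EG) (H := EG)
    (by rw [add_zero]; exact smoothAt_chart_symm (mem_extChartAt_target (I := 𝓘(ℝ, EG)) (1 : G)))
    (contMDiffAt_iff_contDiffAt.2 (by fun_prop))
  rw [add_zero, mder_chart_symm_self, mder_eq_fderiv, fderiv_const_add, fderiv_fun_id] at h
  exact h

variable [LieGroup 𝓘(ℝ, EG) ∞ G] [CompactSpace G]
  {E : Type*} [NormedAddCommGroup E] [NormedSpace ℝ E] [FiniteDimensional ℝ E]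
  {M : Type*} [TopologicalSpace M] [ChartedSpace E M] [IsManifold 𝓘(ℝ, E) ∞ M] [T2Space M]
  [MulAction G M]

/-- A smooth equivariant parametrization of a neighbourhood of `x` by a ball in the isotropy
representation. -/
structure IsEquivariantParam (g : RMetric E M) (x : M) (G : Type*) [Group G] [MulAction G M]
    (ν : E → M) (r : ℝ) : Prop where
  pos : 0 < r
  zero : ν 0 = x
  smooth : ∀ w, met g x w w < r → SmoothAt E E ν w
  mder_zero : mder E E ν 0 = ContinuousLinearMap.id ℝ E
  equivariant : ∀ k ∈ MulAction.stabilizer G x, ∀ w, met g x w w < r →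
    ν (dsm E k x w) = k • ν w
  inj : ∀ w w', met g x w w < r → met g x w' w' < r → ν w = ν w' → w = w'

/-- Local inverse of the equivariant chart. By compactness of K the radius can be chosen so that all
K-translates of the ball's image stay where the chart is injective. -/
theorem exists_equivariant_param (EG : Type*) [NormedAddCommGroup EG] [NormedSpace ℝ EG]
    [ChartedSpace EG G] [LieGroup 𝓘(ℝ, EG) ∞ G] [ContMDiffSMul 𝓘(ℝ, EG) 𝓘(ℝ, E) ∞ G M]
    (g : RMetric E M) (x : M) :
    ∃ ν r, IsEquivariantParam g x G ν r := by
  have : ContinuousSMul G M := ContMDiffSMul.continuousSMul (I := 𝓘(ℝ, EG)) (I' := 𝓘(ℝ, E)) ∞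
  obtain ⟨φ, hφ, hφ0, hφd, hφK⟩ := exists_equivariant_chart (G := G) (E := E) EG x
  obtain ⟨Θ, h1, -, h3, h4⟩ := exists_local_inverse' (E := E) isOpen_univ (mem_univ x)
    (fun q _ => hφ q) (ContinuousLinearEquiv.refl ℝ E) hφd
  have hΘx : Θ x = 0 := by rw [h3 x h1, hφ0]
  have h0 : (0 : E) ∈ Θ.target := by rw [← hΘx]; exact Θ.map_source h1
  have hsymm0 : Θ.symm 0 = x := by rw [← hΘx]; exact Θ.left_inv h1
  have hK : IsCompact (MulAction.stabilizer G x : Set G) :=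
    (isClosed_eq (f := fun a : G => a • x) (by fun_prop) continuous_const).isCompact
  have hO : ∀ᶠ y in 𝓝 x, ∀ k ∈ (MulAction.stabilizer G x : Set G), k • y ∈ Θ.source := by
    refine hK.eventually_forall_of_forall_eventually (P := fun y k => k • y ∈ Θ.source) ?_
    intro k hk
    have hk' : k • x = x := hk
    have hc : Continuous fun z : M × G => z.2 • z.1 := by fun_prop
    exact hc.continuousAt.eventually_mem (by rw [hk']; exact Θ.open_source.mem_nhds h1)
  have hev : ∀ᶠ w in 𝓝 (0 : E), w ∈ Θ.target ∧
      ∀ k ∈ (MulAction.stabilizer G x : Set G), k • Θ.symm w ∈ Θ.source := by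
    refine (Θ.open_target.eventually_mem h0).and ?_
    have hc : Tendsto Θ.symm (𝓝 0) (𝓝 x) := by
      have := (h4 0 h0).continuousAt.tendsto
      rwa [hsymm0] at this
    exact hc.eventually hO
  obtain ⟨r, hr, hball⟩ := exists_form_ball_subset (b := met g x) (fun v hv => met_pos g x hv) hev
  refine ⟨Θ.symm, r, hr, hsymm0, fun w hw => h4 w (hball w hw).1, ?_, ?_, ?_⟩
  · have h5 := mder_comp (g := φ) (f := Θ.symm) (y := (0 : E)) (hφ _) (h4 0 h0)
    rw [mder_congr (g := fun w : E => w), mder_id, hsymm0, hφd] at h5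
    · exact h5.symm
    · filter_upwards [Θ.open_target.mem_nhds h0] with w hw
      rw [← h3 _ (Θ.map_target hw), Θ.right_inv hw]
  · intro k hk w hw
    obtain ⟨hw1, hw2⟩ := hball w hw
    rw [← Θ.left_inv (hw2 k hk), h3 _ (hw2 k hk), hφK k hk, ← h3 _ (Θ.map_target hw1),
      Θ.right_inv hw1]
  · intro w w' hw hw' h
    rw [← Θ.right_inv (hball w hw).1, h, Θ.right_inv (hball w' hw').1]

end Slice

section LocalHomeo
variable {E : Type*} [NormedAddCommGroup E] [NormedSpace ℝ E]
  {M : Type*} [TopologicalSpace M] [ChartedSpace E M] {Θ : OpenPartialHomeomorph E M}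

theorem mder_symm_mder (h1 : ∀ u ∈ Θ.source, SmoothAt E E Θ u)
    (h2 : ∀ y ∈ Θ.target, SmoothAt E E Θ.symm y) {u : E} (hu : u ∈ Θ.source) (v : E) :
    mder E E Θ.symm (Θ u) (mder E E Θ u v) = v := by
  rw [← mder_comp_apply (h2 _ (Θ.map_source hu)) (h1 u hu), mder_congr (g := fun w : E => w),
    mder_id]
  · rfl
  · filter_upwards [Θ.open_source.mem_nhds hu] with w hw using Θ.left_inv hw

theorem mder_mder_symm (h1 : ∀ u ∈ Θ.source, SmoothAt E E Θ u)
    (h2 : ∀ y ∈ Θ.target, SmoothAt E E Θ.symm y) {y : M} (hy : y ∈ Θ.target) (v : E) :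
    mder E E Θ (Θ.symm y) (mder E E Θ.symm y v) = v := by
  rw [← mder_comp_apply (h1 _ (Θ.map_target hy)) (h2 y hy), mder_congr (g := fun w : M => w),
    mder_id]
  · rfl
  · filter_upwards [Θ.open_target.mem_nhds hy] with w hw using Θ.right_inv hw

end LocalHomeo

/-! ### The tube map and its derivative. -/

section Tube

variable {EG : Type*} [NormedAddCommGroup EG] [NormedSpace ℝ EG]
  {G : Type*} [TopologicalSpace G] [ChartedSpace EG G] [Group G]
  {E : Type*} [NormedAddCommGroup E] [NormedSpace ℝ E]
  {M : Type*} [TopologicalSpace M] [ChartedSpace E M]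
  [MulAction G M] [ContMDiffSMul 𝓘(ℝ, EG) 𝓘(ℝ, E) ∞ G M]

/-- Product rule: the derivative of (u, u') ↦ f u • h u' along the diagonal is the sum of those
along the two factors. -/
theorem mder_smul {F : Type*} [NormedAddCommGroup F] [NormedSpace ℝ F] {f : F → G} {h : F → M}
    {w : F} (hf : SmoothAt F EG f w) (hh : SmoothAt F E h w) (v : F) :
    mder F E (fun u => f u • h u) w v =
      mder EG E (fun a : G => a • h w) (f w) (mder F EG f w v) +
        dsm E (f w) (h w) (mder F E h w v) := by
  have hfst : SmoothAt (F × F) EG (fun p : F × F => f p.1) (w, w) :=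
    ContMDiffAt.comp (I' := 𝓘(ℝ, F)) (w, w) hf contDiff_fst.contMDiff.contMDiffAt
  have hsnd : SmoothAt (F × F) E (fun p : F × F => h p.2) (w, w) :=
    ContMDiffAt.comp (I' := 𝓘(ℝ, F)) (w, w) hh contDiff_snd.contMDiff.contMDiffAt
  have hk := hfst.smul hsnd
  have e0 := mder_comp_apply (g := fun p : F × F => f p.1 • h p.2) (f := fun u : F => (u, u))
    (y := w) hk (contMDiffAt_iff_contDiffAt.2 (by fun_prop)) v
  have e1 := mder_comp_apply (g := fun p : F × F => f p.1 • h p.2) (f := fun u : F => (u, w))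
    (y := w) hk (contMDiffAt_iff_contDiffAt.2 (by fun_prop)) v
  have e2 := mder_comp_apply (g := fun p : F × F => f p.1 • h p.2) (f := fun u : F => (w, u))
    (y := w) hk (contMDiffAt_iff_contDiffAt.2 (by fun_prop)) v
  have d0 : mder F (F × F) (fun u : F => (u, u)) w v = (v, v) := by
    rw [mder_eq_fderiv]
    exact congrArg (fun L : F →L[ℝ] F × F => L v)
      ((hasFDerivAt_id w).prodMk (hasFDerivAt_id w)).fderiv
  have d1 : mder F (F × F) (fun u : F => (u, w)) w v = (v, 0) := by
    rw [mder_eq_fderiv]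
    exact congrArg (fun L : F →L[ℝ] F × F => L v)
      ((hasFDerivAt_id w).prodMk (hasFDerivAt_const w w)).fderiv
  have d2 : mder F (F × F) (fun u : F => (w, u)) w v = (0, v) := by
    rw [mder_eq_fderiv]
    exact congrArg (fun L : F →L[ℝ] F × F => L v)
      ((hasFDerivAt_const w w).prodMk (hasFDerivAt_id w)).fderiv
  have s1 := mder_comp_apply (g := fun a : G => a • h w) (f := f) (y := w)
    (smoothAt_smul_const (E := E) _ _) hf v
  have s2 := mder_comp_apply (g := fun y : M => f w • y) (f := h) (y := w)
    (smoothAt_const_smul EG _ _) hh v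
  rw [d0] at e0
  rw [d1] at e1
  rw [d2] at e2
  rw [← s1, dsm, ← s2, e0, e1, e2, ← map_add, Prod.mk_add_mk, zero_add, add_zero]

/-- The local model `chartExp (q u) • ν (pr u)` of a neighbourhood of an orbit. -/
def tubeMap (G : Type*) [TopologicalSpace G] [ChartedSpace EG G] [Group G] [MulAction G M]
    (ν : E → M) (pr : E →L[ℝ] E) (q : E →L[ℝ] EG) (u : E) : M :=
  (chartExp (q u) : G) • ν (pr u)

omit [MulAction G M] [ContMDiffSMul 𝓘(ℝ, EG) 𝓘(ℝ, E) ∞ G M] in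
theorem SmoothAt.comp_clm {F F' : Type*} [NormedAddCommGroup F] [NormedSpace ℝ F]
    [NormedAddCommGroup F'] [NormedSpace ℝ F'] {ν : F → M} {L : F' →L[ℝ] F} {u : F'}
    (h : SmoothAt F E ν (L u)) : SmoothAt F' E (fun u => ν (L u)) u :=
  ContMDiffAt.comp (I' := 𝓘(ℝ, F)) u h L.contDiff.contMDiff.contMDiffAt

omit [MulAction G M] [ContMDiffSMul 𝓘(ℝ, EG) 𝓘(ℝ, E) ∞ G M] in
theorem mder_comp_clm {F F' : Type*} [NormedAddCommGroup F] [NormedSpace ℝ F]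
    [NormedAddCommGroup F'] [NormedSpace ℝ F'] {ν : F → M} {L : F' →L[ℝ] F} {u : F'}
    (h : SmoothAt F E ν (L u)) (v : F') :
    mder F' E (fun u => ν (L u)) u v = mder F E ν (L u) (L v) := by
  have := mder_comp_apply (f := L) (g := ν) (y := u) h L.contDiff.contMDiff.contMDiffAt v
  rw [this, mder_eq_fderiv, L.fderiv]

section TubeMap
variable {ν : E → M} {pr : E →L[ℝ] E} {q : E →L[ℝ] EG}

theorem smoothAt_tubeMap {u : E} (h1 : SmoothAt EG EG (chartExp : EG → G) (q u))
    (h2 : SmoothAt E E ν (pr u)) : SmoothAt E E (tubeMap G ν pr q) u :=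
  h1.comp_clm.smul h2.comp_clm

theorem mder_tubeMap {u : E} (h1 : SmoothAt EG EG (chartExp : EG → G) (q u))
    (h2 : SmoothAt E E ν (pr u)) (v : E) : mder E E (tubeMap G ν pr q) u v =
      mder EG E (fun a : G => a • ν (pr u)) (chartExp (q u))
        (mder EG EG (chartExp : EG → G) (q u) (q v)) +
      dsm E (chartExp (q u) : G) (ν (pr u)) (mder E E ν (pr u) (pr v)) := by
  have h := mder_smul (h1.comp_clm (F' := E)) (h2.comp_clm (F' := E)) v
  rw [mder_comp_clm h1, mder_comp_clm h2] at h
  exact h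

theorem mder_tubeMap_slice [IsManifold 𝓘(ℝ, EG) ∞ G] {w : E} (hq : q w = 0) (hp : pr w = w)
    (h2 : SmoothAt E E ν w) (v : E) : mder E E (tubeMap G ν pr q) w v =
      act EG G E (ν w) (q v) + mder E E ν w (pr v) := by
  have h1 : SmoothAt EG EG (chartExp : EG → G) (q w) := by
    rw [hq]; exact smoothAt_chartExp.self_of_nhds
  rw [mder_tubeMap h1 (by rwa [hp])]
  have e : (chartExp (0 : EG) : G) = 1 := chartExp_zero
  simp only [hq, hp, mder_chartExp, e, dsm_one]
  rfl

end TubeMap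

section TubeChart

variable [IsManifold 𝓘(ℝ, E) ∞ M]

/-- `Θ` is a local diffeomorphism at `0` given by the local model of a neighbourhood of an orbit. -/
structure IsTubeChart (g : RMetric E M) (x : M) (G : Type*) [TopologicalSpace G]
    [ChartedSpace EG G] [Group G] [MulAction G M] (m : Submodule ℝ EG) (ν : E → M) (r : ℝ)
    (pr : E →L[ℝ] E) (q : E →L[ℝ] EG) (Θ : OpenPartialHomeomorph E M) : Prop where
  param : IsEquivariantParam g x G ν r
  split : IsSplitting (met g x) (act EG G E x) m pr q
  zero_mem : 0 ∈ Θ.source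
  eq_tubeMap : ∀ u ∈ Θ.source, Θ u = tubeMap G ν pr q u
  lt : ∀ u ∈ Θ.source, met g x (pr u) (pr u) < r
  smooth_chartExp : ∀ u ∈ Θ.source, SmoothAt EG EG (chartExp : EG → G) (q u)
  smooth : ∀ u ∈ Θ.source, SmoothAt E E Θ u
  smooth_symm : ∀ y ∈ Θ.target, SmoothAt E E Θ.symm y

variable {g : RMetric E M} {x : M} {m : Submodule ℝ EG} {ν : E → M} {r : ℝ}
    {pr : E →L[ℝ] E} {q : E →L[ℝ] EG}

/-- At 0 the derivative of the tube map is act ∘ q + pr, the identity by the splitting. -/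
theorem exists_tubeChart [IsManifold 𝓘(ℝ, EG) ∞ G] [FiniteDimensional ℝ E]
    (hν : IsEquivariantParam g x G ν r)
    (hs : IsSplitting (met g x) (act EG G E x) m pr q) :
    ∃ Θ, IsTubeChart g x G m ν r pr q Θ := by
  have hev : ∀ᶠ u in 𝓝 (0 : E), met g x (pr u) (pr u) < r ∧
      SmoothAt EG EG (chartExp : EG → G) (q u) := by
    refine Eventually.and ?_ ?_
    · refine pr.continuous.continuousAt.eventually (form_ball_mem_nhds (met g x) ?_)
      simpa using hν.pos
    · refine q.continuous.continuousAt.eventually ?_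
      rw [map_zero]
      exact smoothAt_chartExp
  obtain ⟨U, hU, hUo, h0⟩ := mem_nhds_iff.1 hev
  have hsm : ∀ u ∈ U, SmoothAt E E (tubeMap G ν pr q) u := fun u hu =>
    smoothAt_tubeMap (hU hu).2 (hν.smooth _ (hU hu).1)
  obtain ⟨Θ, t1, t2, t3, t4⟩ := exists_local_inverse hUo h0 hsm (ContinuousLinearEquiv.refl ℝ E)
    (by
      ext v
      rw [mder_tubeMap_slice (map_zero q) (map_zero pr)
        (hν.smooth 0 (by simpa using hν.pos)), hν.zero, hν.mder_zero]
      exact hs.add_eq v)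
  exact ⟨Θ, hν, hs, t1, t3, fun u hu => (hU (t2 hu)).1, fun u hu => (hU (t2 hu)).2,
    fun u hu => (hsm u (t2 hu)).congr_of_eventuallyEq
      (by filter_upwards [Θ.open_source.mem_nhds hu] with w hw using t3 w hw), t4⟩

namespace IsTubeChart
variable {Θ : OpenPartialHomeomorph E M} (h : IsTubeChart g x G m ν r pr q Θ)
include h

omit [ContMDiffSMul 𝓘(ℝ, EG) 𝓘(ℝ, E) ∞ G M] in
theorem map_zero : Θ 0 = x := by
  rw [h.eq_tubeMap 0 h.zero_mem, tubeMap, _root_.map_zero, _root_.map_zero, chartExp_zero, one_smul,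
    h.param.zero]

omit [ContMDiffSMul 𝓘(ℝ, EG) 𝓘(ℝ, E) ∞ G M] in
theorem symm_x : Θ.symm x = 0 := by
  conv_lhs => rw [← h.map_zero]
  exact Θ.left_inv h.zero_mem

omit [ContMDiffSMul 𝓘(ℝ, EG) 𝓘(ℝ, E) ∞ G M] in
theorem x_mem : x ∈ Θ.target := by
  rw [← h.map_zero]; exact Θ.map_source h.zero_mem

theorem mder_eq {u : E} (hu : u ∈ Θ.source) (v : E) : mder E E Θ u v =
      mder EG E (fun a : G => a • ν (pr u)) (chartExp (q u))
        (mder EG EG (chartExp : EG → G) (q u) (q v)) +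
      dsm E (chartExp (q u) : G) (ν (pr u)) (mder E E ν (pr u) (pr v)) := by
  rw [← mder_tubeMap (h.smooth_chartExp u hu) (h.param.smooth _ (h.lt u hu))]
  congr 1
  refine mder_congr ?_
  filter_upwards [Θ.open_source.mem_nhds hu] with w hw using h.eq_tubeMap w hw

variable [LieGroup 𝓘(ℝ, EG) ∞ G] [FiniteDimensional ℝ E]

/-- At points of the orbit of `x`, the tangent space of the orbit is mapped by the chart to the
tangent space of the orbit at `x`. -/
theorem pr_mder_symm_orbit {a : G} (ha : a • x ∈ Θ.target) {v : E}
    (hv : v ∈ LinearMap.range (act EG G E (a • x)).toLinearMap) :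
    pr (mder E E Θ.symm (a • x) v) = 0 := by
  set y := a • x with hy
  set u := Θ.symm y with hu
  have hus : u ∈ Θ.source := Θ.map_target ha
  have hΘu : Θ u = y := Θ.right_inv ha
  have hyt : (chartExp (q u) : G) • ν (pr u) = y := by rw [← hΘu, h.eq_tubeMap u hus]; rfl
  let R := LinearMap.range (act EG G E x).toLinearMap
  have hinj : Function.Injective (mder E E Θ u) := fun v w hvw => by
    rw [← mder_symm_mder h.smooth h.smooth_symm hus v, hvw,
      mder_symm_mder h.smooth h.smooth_symm hus w]
  have hle : R.map (mder E E Θ u).toLinearMap ≤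
      LinearMap.range (act EG G E y).toLinearMap := by
    rintro _ ⟨_, ⟨X, rfl⟩, rfl⟩
    have h1 := h.mder_eq hus (act EG G E x X)
    rw [h.split.pr_range, _root_.map_zero, _root_.map_zero, add_zero] at h1
    change mder E E Θ u (act EG G E x X) ∈ _
    rw [h1, ← hyt]
    exact mder_orbit_mem_range _ _ _
  -- dΘ_u is injective and the orbit has at a • x no larger tangent space than at x, so the
  -- inclusion `hle` is an equality and can be inverted.
  have heq := Submodule.eq_of_le_of_finrank_le hle (by
    rw [(Submodule.equivMapOfInjective (mder E E Θ u).toLinearMap hinj R).finrank_eq.symm]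
    exact finrank_range_act_smul_le a x)
  rw [← heq] at hv
  obtain ⟨_, ⟨X, rfl⟩, rfl⟩ := hv
  have h2 := mder_symm_mder h.smooth h.smooth_symm hus (act EG G E x X)
  rw [hΘu] at h2
  exact (congrArg pr h2).trans (h.split.pr_range X)

end IsTubeChart
end TubeChart

end Tube

/-! ### The slice theorem. -/

section Slice

variable {EG : Type*} [NormedAddCommGroup EG] [NormedSpace ℝ EG]
  {G : Type*} [TopologicalSpace G] [ChartedSpace EG G] [Group G]
  [LieGroup 𝓘(ℝ, EG) ∞ G]
  {E : Type*} [NormedAddCommGroup E] [NormedSpace ℝ E]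
  {M : Type*} [TopologicalSpace M] [ChartedSpace E M] [IsManifold 𝓘(ℝ, E) ∞ M]
  [MulAction G M] [ContMDiffSMul 𝓘(ℝ, EG) 𝓘(ℝ, E) ∞ G M]

theorem met_dsm_act_eq_zero {g : RMetric E M} {x : M} (hg : IsInvariantMetric G g) {k : G}
    (hk : k ∈ MulAction.stabilizer G x) {v : E} (hv : ∀ Z, met g x v (act EG G E x Z) = 0)
    (Z : EG) : met g x (dsm E k x v) (act EG G E x Z) = 0 := by
  have hk' : k • x = x := hk
  have h1 := act_smul' (E := E) k x Z
  rw [hk'] at h1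
  rw [h1, met_dsm_of_mem hg hk, hv]

omit [LieGroup 𝓘(ℝ, EG) ∞ G] in
theorem chartExp_chart_sub :
    ∀ᶠ a in 𝓝 (1 : G), chartExp (extChartAt 𝓘(ℝ, EG) (1 : G) a -
      extChartAt 𝓘(ℝ, EG) (1 : G) 1) = a := by
  filter_upwards [extChartAt_source_mem_nhds (I := 𝓘(ℝ, EG)) (1 : G)] with a ha
  rw [chartExp, add_sub_cancel, (extChartAt 𝓘(ℝ, EG) (1 : G)).left_inv ha]

variable {g : RMetric E M} {x : M} {m : Submodule ℝ EG} {ν : E → M} {r : ℝ}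
    {pr : E →L[ℝ] E} {q : E →L[ℝ] EG}

namespace IsTubeChart
variable {Θ : OpenPartialHomeomorph E M} (h : IsTubeChart g x G m ν r pr q Θ)
include h

theorem pr_dsm (hg : IsInvariantMetric G g) {k : G} (hk : k ∈ MulAction.stabilizer G x) {w : E}
    (hw : pr w = w) : pr (dsm E k x w) = dsm E k x w ∧ q (dsm E k x w) = 0 := by
  have h1 : ∀ Z, met g x w (act EG G E x Z) = 0 := fun Z => by
    rw [← hw]; exact h.split.orth w Z
  exact (h.split.map_of_orth (met_dsm_act_eq_zero hg hk h1)).symm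

omit [LieGroup 𝓘(ℝ, EG) ∞ G] [ContMDiffSMul 𝓘(ℝ, EG) 𝓘(ℝ, E) ∞ G M] in
theorem map_slice {w : E} (hw : pr w = w) (hs : w ∈ Θ.source) : Θ w = ν w := by
  rw [h.eq_tubeMap w hs, tubeMap, hw, ← hw, h.split.q_pr, chartExp_zero, one_smul, hw]

variable [FiniteDimensional ℝ E]

/-- Near `x`, the orbit of `x` is contained in the zero section of the tube. -/
theorem eventually_pr_symm_orbit :
    ∀ᶠ a in 𝓝 (1 : G), a • x ∈ Θ.target ∧ pr (Θ.symm (a • x)) = 0 := by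
  have hcs : Continuous fun a : G => a • x := continuous_iff_continuousAt.2 fun a =>
    (smoothAt_smul_const (EG := EG) (E := E) x a).continuousAt
  have hc0 : ContinuousAt (chartExp : EG → G) 0 := smoothAt_chartExp.self_of_nhds.continuousAt
  have hT : ∀ᶠ a in 𝓝 (1 : G), a • x ∈ Θ.target :=
    hcs.continuousAt.eventually_mem (by
      rw [one_smul]; exact Θ.open_target.mem_nhds h.x_mem)
  have hev : ∀ᶠ Z in 𝓝 (0 : EG), (chartExp Z : G) • x ∈ Θ.target ∧
      SmoothAt EG EG (chartExp : EG → G) Z :=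
    Eventually.and (hc0.eventually (by rw [chartExp_zero]; exact hT)) smoothAt_chartExp
  obtain ⟨ε, hε, hball⟩ := Metric.mem_nhds_iff.1 hev
  -- The transverse coordinate along the orbit map. Its derivative vanishes on a ball by
  -- `pr_mder_symm_orbit`, so it is constant; no submanifold structure on the orbit is needed.
  let θ : EG → E := fun Z => pr (Θ.symm ((chartExp Z : G) • x))
  have hsm : ∀ Z ∈ Metric.ball (0 : EG) ε,
      SmoothAt EG E (fun Z : EG => Θ.symm ((chartExp Z : G) • x)) Z := fun Z hZ =>
    ContMDiffAt.comp (I' := 𝓘(ℝ, E)) (g := Θ.symm) Z (h.smooth_symm _ (hball hZ).1)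
      ((hball hZ).2.smul contMDiffAt_const)
  have hd : ∀ Z ∈ Metric.ball (0 : EG) ε, HasFDerivAt θ (0 : EG →L[ℝ] E) Z := by
    intro Z hZ
    have hdiff : DifferentiableAt ℝ (fun Z : EG => Θ.symm ((chartExp Z : G) • x)) Z :=
      (contMDiffAt_iff_contDiffAt.1 (hsm Z hZ)).differentiableAt (by simp)
    have h1 := (pr.hasFDerivAt (x := Θ.symm ((chartExp Z : G) • x))).comp Z hdiff.hasFDerivAt
    refine h1.congr_fderiv ?_
    ext v
    have hs2 := (smoothAt_smul_const (E := E) x (chartExp Z : G)).comp (I' := 𝓘(ℝ, EG)) Z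
      (hball hZ).2
    have e1 := mder_comp_apply (g := Θ.symm) (f := fun Z : EG => (chartExp Z : G) • x) (y := Z)
      (h.smooth_symm _ (hball hZ).1) hs2 v
    have e2 := mder_comp_apply (g := fun a : G => a • x) (f := (chartExp : EG → G)) (y := Z)
      (smoothAt_smul_const (E := E) x (chartExp Z : G)) (hball hZ).2 v
    rw [ContinuousLinearMap.comp_apply, ← mder_eq_fderiv, e1, e2]
    exact h.pr_mder_symm_orbit (hball hZ).1 (mder_orbit_mem_range _ _ _)
  have hθ : ∀ Z ∈ Metric.ball (0 : EG) ε, θ Z = 0 := by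
    intro Z hZ
    have h2 := Metric.isOpen_ball.is_const_of_fderiv_eq_zero (𝕜 := ℝ)
      (convex_ball (0 : EG) ε).isPreconnected
      (fun Z hZ => (hd Z hZ).differentiableAt.differentiableWithinAt)
      (fun Z hZ => (hd Z hZ).fderiv) hZ (Metric.mem_ball_self hε)
    rw [h2]
    simp only [θ]
    rw [chartExp_zero, one_smul, h.symm_x, _root_.map_zero]
  have hlog : ContinuousAt (fun a : G => extChartAt 𝓘(ℝ, EG) (1 : G) a -
      extChartAt 𝓘(ℝ, EG) (1 : G) 1) 1 :=
    (continuousAt_extChartAt (I := 𝓘(ℝ, EG)) (1 : G)).sub continuousAt_const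
  filter_upwards [hT, chartExp_chart_sub (EG := EG) (G := G), hlog.eventually_mem (by
    rw [sub_self]; exact Metric.ball_mem_nhds 0 hε)] with a h1 h2 h3
  refine ⟨h1, ?_⟩
  have h4 := hθ _ h3
  simp only [θ] at h4
  rwa [h2] at h4

omit [LieGroup 𝓘(ℝ, EG) ∞ G] [ContMDiffSMul 𝓘(ℝ, EG) 𝓘(ℝ, E) ∞ G M] [FiniteDimensional ℝ E] in
/-- The component in the isotropy group of a group element near the identity. -/
theorem component_mem {a : G} (ha : a • x ∈ Θ.target) (h0 : pr (Θ.symm (a • x)) = 0) :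
    (chartExp (q (Θ.symm (a • x))))⁻¹ * a ∈ MulAction.stabilizer G x := by
  have h1 : a • x = (chartExp (q (Θ.symm (a • x))) : G) • x := by
    conv_lhs => rw [← Θ.right_inv ha, h.eq_tubeMap _ (Θ.map_target ha), tubeMap, h0, h.param.zero]
  rw [MulAction.mem_stabilizer_iff, mul_smul, inv_smul_eq_iff]
  exact h1

omit [FiniteDimensional ℝ E] in
-- Write a = c k with c = `chartExp (q u)`, u = Θ⁻¹(a • x), and k in K. Then k moves w linearly
-- inside the slice, and c translates the slice to the fibre over u.
theorem smul_param (hg : IsInvariantMetric G g) {a : G} (ha : a • x ∈ Θ.target)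
    (h0 : pr (Θ.symm (a • x)) = 0) {w : E} (hw : pr w = w) (hr : met g x w w < r) :
    a • ν w = tubeMap G ν pr q
      (Θ.symm (a • x) + dsm E ((chartExp (q (Θ.symm (a • x))))⁻¹ * a) x w) := by
  have hk := h.component_mem ha h0
  obtain ⟨h1, h2⟩ := h.pr_dsm hg hk hw
  rw [tubeMap, map_add, map_add, h0, h1, h2, add_zero, zero_add, h.param.equivariant _ hk _ hr,
    smul_smul, mul_inv_cancel_left]

/-- In `Θ` a small a acts on the slice as a K-rotation followed by a translation. K preserves the
g_x-norm, so one radius s serves for all a near 1: both summands stay in a ball of radius ε/2. -/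
theorem exists_local_form (hg : IsInvariantMetric G g) :
    ∃ s > 0, s ≤ r ∧ (∀ w, met g x w w < s → w ∈ Θ.source) ∧
      ∀ᶠ a in 𝓝 (1 : G), a • x ∈ Θ.target ∧ pr (Θ.symm (a • x)) = 0 ∧
        ∀ w, pr w = w → met g x w w < s →
          Θ.symm (a • x) + dsm E ((chartExp (q (Θ.symm (a • x))))⁻¹ * a) x w ∈ Θ.source ∧
          a • ν w = Θ (Θ.symm (a • x) + dsm E ((chartExp (q (Θ.symm (a • x))))⁻¹ * a) x w) := by
  obtain ⟨ε, hε, hball⟩ := Metric.mem_nhds_iff.1 (Θ.open_source.mem_nhds h.zero_mem)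
  obtain ⟨s, hs, hs'⟩ := exists_form_ball_subset (b := met g x) (fun v hv => met_pos g x hv)
    (Metric.ball_mem_nhds (0 : E) (half_pos hε))
  refine ⟨min s r, lt_min hs h.param.pos, min_le_right _ _, fun w hw => hball ?_, ?_⟩
  · exact Metric.ball_subset_ball (half_le_self hε.le) (hs' w (lt_of_lt_of_le hw (min_le_left _ _)))
  · have hcs : ContinuousAt (fun a : G => a • x) 1 :=
      (smoothAt_smul_const (EG := EG) (E := E) x 1).continuousAt
    have hc2 : ContinuousAt (fun a : G => Θ.symm (a • x)) 1 :=
      ContinuousAt.comp (g := Θ.symm) (by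
        rw [one_smul]; exact (h.smooth_symm x h.x_mem).continuousAt) hcs
    have hu : ∀ᶠ a in 𝓝 (1 : G), Θ.symm (a • x) ∈ Metric.ball (0 : E) (ε / 2) :=
      hc2.eventually_mem (by
        rw [one_smul, h.symm_x]; exact Metric.ball_mem_nhds 0 (half_pos hε))
    filter_upwards [h.eventually_pr_symm_orbit, hu] with a ha hua
    refine ⟨ha.1, ha.2, fun w hw hws => ?_⟩
    have hk := h.component_mem ha.1 ha.2
    have hmem : Θ.symm (a • x) + dsm E ((chartExp (q (Θ.symm (a • x))))⁻¹ * a) x w ∈ Θ.source := by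
      refine hball ?_
      have h1 := hs' (dsm E ((chartExp (q (Θ.symm (a • x))))⁻¹ * a) x w) (by
        rw [met_dsm_of_mem hg hk]; exact lt_of_lt_of_le hws (min_le_left _ _))
      rw [mem_ball_zero_iff] at *
      exact (norm_add_le _ _).trans_lt (by linarith)
    refine ⟨hmem, ?_⟩
    rw [h.eq_tubeMap _ hmem]
    exact h.smul_param hg ha.1 ha.2 hw (lt_of_lt_of_le hws (min_le_right _ _))

end IsTubeChart

/-- A neighbourhood of the orbit of `x` is an equivariant tube: besides the local description,
group elements moving a small slice to a point of the slice fix `x`. -/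
structure IsTube (g : RMetric E M) (x : M) (G : Type*) [TopologicalSpace G]
    [ChartedSpace EG G] [Group G] [MulAction G M] (m : Submodule ℝ EG) (ν : E → M)
    (r : ℝ) (pr : E →L[ℝ] E) (q : E →L[ℝ] EG) (Θ : OpenPartialHomeomorph E M) (s : ℝ) : Prop where
  chart : IsTubeChart g x G m ν r pr q Θ
  pos : 0 < s
  le : s ≤ r
  invariant : IsInvariantMetric G g
  ad_mem : ∀ k ∈ MulAction.stabilizer G x, ∀ X ∈ m, adL k X ∈ m
  mem : ∀ w, met g x w w < s → w ∈ Θ.source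
  slice : ∀ (a : G) (w w' : E), pr w = w → pr w' = w' → met g x w w < s → met g x w' w' < s →
    a • ν w = ν w' → a ∈ MulAction.stabilizer G x
  local_form : ∀ᶠ a in 𝓝 (1 : G), a • x ∈ Θ.target ∧ pr (Θ.symm (a • x)) = 0 ∧
    ∀ w, pr w = w → met g x w w < s →
      Θ.symm (a • x) + dsm E ((chartExp (q (Θ.symm (a • x))))⁻¹ * a) x w ∈ Θ.source ∧
      a • ν w = Θ (Θ.symm (a • x) + dsm E ((chartExp (q (Θ.symm (a • x))))⁻¹ * a) x w)

open scoped Pointwise in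
theorem exists_tube [CompactSpace G] [T2Space M] [FiniteDimensional ℝ E] (hg : IsInvariantMetric G g)
    {Θ : OpenPartialHomeomorph E M} (h : IsTubeChart g x G m ν r pr q Θ)
    (had : ∀ k ∈ MulAction.stabilizer G x, ∀ X ∈ m, adL k X ∈ m) :
    ∃ s, IsTube g x G m ν r pr q Θ s := by
  have hGt : IsTopologicalGroup G := topologicalGroup_of_lieGroup 𝓘(ℝ, EG) ∞
  have hcs : ContinuousSMul G M := ContMDiffSMul.continuousSMul (I := 𝓘(ℝ, EG)) (I' := 𝓘(ℝ, E)) ∞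
  obtain ⟨s, hs, hsr, hsm, hloc⟩ := h.exists_local_form hg
  obtain ⟨Ω, hΩ, hΩo, h1⟩ := mem_nhds_iff.1 hloc
  -- Elements of C do not fix x, so by compactness of C they move a small slice off itself. The
  -- elements left have the form a₁ k with a₁ near 1 and k in K.
  let C : Set G := (Ω * (MulAction.stabilizer G x : Set G))ᶜ
  have hC : IsCompact C := (hΩo.mul_right.isClosed_compl).isCompact
  have hν : ContinuousAt ν 0 := (h.param.smooth 0 (by simpa using h.param.pos)).continuousAt
  have hev : ∀ᶠ p : E × E in 𝓝 0, ∀ a ∈ C, a • ν p.1 ≠ ν p.2 := by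
    refine hC.eventually_forall_of_forall_eventually
      (P := fun (p : E × E) (a : G) => a • ν p.1 ≠ ν p.2) fun a ha => ?_
    have hax : a • x ≠ x := fun hax => ha ⟨1, h1, a, hax, one_mul a⟩
    have c1 : ContinuousAt (fun z : (E × E) × G => z.2 • ν z.1.1) (0, a) :=
      continuousAt_snd.smul (ContinuousAt.comp (g := ν) (f := fun z : (E × E) × G => z.1.1) hν
        (by fun_prop))
    have c2 : ContinuousAt (fun z : (E × E) × G => ν z.1.2) (0, a) :=
      ContinuousAt.comp (g := ν) (f := fun z : (E × E) × G => z.1.2) hν (by fun_prop)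
    exact (isOpen_ne_fun continuous_fst continuous_snd).mem_nhds (x := (a • ν 0, ν 0)) (by simpa [h.param.zero] using hax) |> (c1.prodMk c2).eventually_mem
  rw [show (0 : E × E) = (0, 0) from rfl, nhds_prod_eq] at hev
  obtain ⟨S, hS, T, hT, hST⟩ := Filter.eventually_prod_iff.1 hev
  obtain ⟨s', hs', hs''⟩ := exists_form_ball_subset (b := met g x) (fun v hv => met_pos g x hv)
    (hS.and hT)
  refine ⟨min s s', h, lt_min hs hs', (min_le_left _ _).trans hsr, hg, had,
    fun w hw => hsm w (lt_min_iff.1 hw).1, ?_, ?_⟩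
  · intro a w w' hw hw' hws hws' e
    rw [lt_min_iff] at hws hws'
    have haC : a ∉ C := fun ha => hST (hs'' w hws.2).1 (hs'' w' hws'.2).2 a ha e
    obtain ⟨a₁, ha₁, k, hk, rfl⟩ := notMem_compl_iff.1 haC
    obtain ⟨t1, t2, t3⟩ := hΩ ha₁
    have hk' : k ∈ MulAction.stabilizer G x := hk
    have hrs : met g x w w < r := hws.1.trans_le hsr
    have hkw : met g x (dsm E k x w) (dsm E k x w) < s := by rw [met_dsm_of_mem hg hk']; exact hws.1
    have hpk := (h.pr_dsm hg hk' hw).1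
    obtain ⟨t4, t5⟩ := t3 _ hpk hkw
    have hκ := h.component_mem t1 t2
    have e2 : Θ (Θ.symm (a₁ • x) + dsm E ((chartExp (q (Θ.symm (a₁ • x))))⁻¹ * a₁) x
        (dsm E k x w)) = Θ w' := by
      rw [← t5, h.param.equivariant k hk' w hrs, smul_smul, h.map_slice hw' (hsm w' hws'.1)]
      exact e
    have e3 := Θ.injOn t4 (hsm w' hws'.1) e2
    -- Injectivity of `Θ` compares q-coordinates: the target lies in the slice, so a₁ • x has
    -- q-coordinate 0 as well as pr-coordinate 0, and a₁ fixes x.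
    have e4 := congrArg q e3
    rw [map_add, (h.pr_dsm hg hκ hpk).2, add_zero, ← hw', h.split.q_pr] at e4
    have e5 : Θ.symm (a₁ • x) = 0 := by
      have := h.split.add_eq (Θ.symm (a₁ • x))
      rw [e4, t2, map_zero, add_zero] at this
      exact this.symm
    have e6 : a₁ • x = x := by rw [← Θ.right_inv t1, e5, h.map_zero]
    exact Subgroup.mul_mem _ e6 hk'
  · filter_upwards [hloc] with a ha
    exact ⟨ha.1, ha.2.1, fun w hw hws => ha.2.2 w hw (lt_min_iff.1 hws).1⟩

end Slice

/-! ### The invariant metric on the tube and its extension by a cutoff. -/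

section TubeMetric

variable {EG : Type*} [NormedAddCommGroup EG] [NormedSpace ℝ EG]
  {G : Type*} [TopologicalSpace G] [ChartedSpace EG G] [Group G]
  [LieGroup 𝓘(ℝ, EG) ∞ G]
  {E : Type*} [NormedAddCommGroup E] [NormedSpace ℝ E]
  {M : Type*} [TopologicalSpace M] [ChartedSpace E M] [IsManifold 𝓘(ℝ, E) ∞ M]
  [MulAction G M] [ContMDiffSMul 𝓘(ℝ, EG) 𝓘(ℝ, E) ∞ G M]

/-- The point `y` is the image of the point `p.2` of the slice under the action of `p.1`. -/
structure IsTubeCoord (g : RMetric E M) (x : M) (ν : E → M) (pr : E →L[ℝ] E) (s : ℝ) (y : M)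
    (p : G × E) : Prop where
  slice : pr p.2 = p.2
  lt : met g x p.2 p.2 < s
  eq : p.1 • ν p.2 = y

/-- The identification of the tangent space at `p.1 • ν p.2` with the tangent space at the centre
of the tube. -/
def tubeDer (Θ : OpenPartialHomeomorph E M) (ν : E → M) (y : M) (p : G × E) : E →L[ℝ] E :=
  (mder E E Θ.symm (ν p.2)).comp (dsm E p.1⁻¹ y)

variable {g : RMetric E M} {x : M} {m : Submodule ℝ EG} {ν : E → M} {r s : ℝ}
    {pr : E →L[ℝ] E} {q : E →L[ℝ] EG} {Θ : OpenPartialHomeomorph E M}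

namespace IsTube
variable (h : IsTube g x G m ν r pr q Θ s)
include h

omit [LieGroup 𝓘(ℝ, EG) ∞ G] [ContMDiffSMul 𝓘(ℝ, EG) 𝓘(ℝ, E) ∞ G M] in
theorem map_slice {w : E} (hw : pr w = w) (hs : met g x w w < s) :
    Θ w = ν w ∧ ν w ∈ Θ.target ∧ Θ.symm (ν w) = w := by
  have h1 := h.chart.map_slice hw (h.mem w hs)
  exact ⟨h1, by rw [← h1]; exact Θ.map_source (h.mem w hs),
    by rw [← h1]; exact Θ.left_inv (h.mem w hs)⟩

omit [LieGroup 𝓘(ℝ, EG) ∞ G] [ContMDiffSMul 𝓘(ℝ, EG) 𝓘(ℝ, E) ∞ G M] in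
theorem q_slice {w : E} (hw : pr w = w) : q w = 0 := by rw [← hw]; exact h.chart.split.q_pr w

theorem mder_slice {w : E} (hw : pr w = w) (hs : met g x w w < s) (v : E) :
    mder E E Θ w v = act EG G E (ν w) (q v) + mder E E ν w (pr v) := by
  rw [← mder_tubeMap_slice (h.q_slice hw) hw (h.chart.param.smooth w (hs.trans_le h.le))]
  congr 1
  refine mder_congr ?_
  filter_upwards [Θ.open_source.mem_nhds (h.mem w hs)] with u hu using h.chart.eq_tubeMap u hu

omit [LieGroup 𝓘(ℝ, EG) ∞ G] [ContMDiffSMul 𝓘(ℝ, EG) 𝓘(ℝ, E) ∞ G M] in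
theorem mder_symm_mder {w : E} (hw : pr w = w) (hs : met g x w w < s) (v : E) :
    mder E E Θ.symm (ν w) (mder E E Θ w v) = v := by
  have := CohomOne.mder_symm_mder h.chart.smooth h.chart.smooth_symm (h.mem w hs) v
  rwa [(h.map_slice hw hs).1] at this

omit [LieGroup 𝓘(ℝ, EG) ∞ G] [ContMDiffSMul 𝓘(ℝ, EG) 𝓘(ℝ, E) ∞ G M] in
theorem mder_mder_symm {w : E} (hw : pr w = w) (hs : met g x w w < s) (v : E) :
    mder E E Θ w (mder E E Θ.symm (ν w) v) = v := by
  have := CohomOne.mder_mder_symm h.chart.smooth h.chart.smooth_symm (h.map_slice hw hs).2.1 v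
  rwa [(h.map_slice hw hs).2.2] at this

/-- dΘ at w is the action field of q u plus dν(pr u), and K intertwines both terms: `ν` is
equivariant, and q is because m is Ad(K)-invariant and K preserves the splitting. -/
theorem mder_symm_dsm {k : G} (hk : k ∈ MulAction.stabilizer G x) {w : E} (hw : pr w = w)
    (hs : met g x w w < s) (v : E) :
    mder E E Θ.symm (k • ν w) (dsm E k (ν w) v) = dsm E k x (mder E E Θ.symm (ν w) v) := by
  obtain ⟨u, rfl⟩ : ∃ u, v = mder E E Θ w u := ⟨_, (h.mder_mder_symm hw hs v).symm⟩
  have hk' : k • x = x := hk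
  have hkw := (h.chart.pr_dsm h.invariant hk hw).1
  have hks : met g x (dsm E k x w) (dsm E k x w) < s := by
    rwa [met_dsm_of_mem h.invariant hk]
  have hrs := hs.trans_le h.le
  have e0 : ν (dsm E k x w) = k • ν w := h.chart.param.equivariant k hk w hrs
  have hνs := h.chart.param.smooth w hrs
  have e1 : mder E E ν (dsm E k x w) (dsm E k x (pr u)) = dsm E k (ν w) (mder E E ν w (pr u)) := by
    rw [← mder_comp_clm (h.chart.param.smooth _ (hks.trans_le h.le)) (pr u)]
    refine Eq.trans ?_ (mder_comp_apply (smoothAt_const_smul EG k (ν w)) hνs (pr u))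
    congr 1
    refine mder_congr ?_
    filter_upwards [form_ball_mem_nhds (met g x) hrs] with w' hw'
    exact h.chart.param.equivariant k hk w' hw'
  have e2 := act_smul (E := E) k (ν w) (q u)
  have e3 : act EG G E x (adL k (q u)) = dsm E k x (act EG G E x (q u)) := by
    have := act_smul (E := E) k x (q u)
    rwa [hk'] at this
  have hpp := (h.chart.pr_dsm h.invariant hk (h.chart.split.pr_pr u)).1
  have e4 := h.chart.split.unique (h.ad_mem k hk _ (h.chart.split.mem u))
    (v := dsm E k x (pr u)) (fun Z => by rw [← hpp]; exact h.chart.split.orth _ Z)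
  rw [e3, ← map_add, h.chart.split.add_eq] at e4
  have e5 := h.mder_slice hkw hks (dsm E k x u)
  rw [e4.1, e4.2, e1, e0, e2, ← map_add, ← h.mder_slice hw hs] at e5
  rw [← e5, ← e0, h.mder_symm_mder hkw hks, h.mder_symm_mder hw hs]

omit [LieGroup 𝓘(ℝ, EG) ∞ G] [ContMDiffSMul 𝓘(ℝ, EG) 𝓘(ℝ, E) ∞ G M] in
theorem coord_unique {y : M} {p p' : G × E} (hp : IsTubeCoord g x ν pr s y p)
    (hp' : IsTubeCoord g x ν pr s y p') :
    p'.1⁻¹ * p.1 ∈ MulAction.stabilizer G x ∧ p'.2 = dsm E (p'.1⁻¹ * p.1) x p.2 := by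
  have e : (p'.1⁻¹ * p.1) • ν p.2 = ν p'.2 := by
    rw [mul_smul, hp.eq, inv_smul_eq_iff, hp'.eq]
  have hk := h.slice _ _ _ hp.slice hp'.slice hp.lt hp'.lt e
  refine ⟨hk, (h.chart.param.inj _ _ ?_ (hp'.lt.trans_le h.le) ?_).symm⟩
  · rw [met_dsm_of_mem h.invariant hk]; exact hp.lt.trans_le h.le
  · rw [h.chart.param.equivariant _ hk _ (hp.lt.trans_le h.le), e]

theorem tubeDer_coord {y : M} {p p' : G × E} (hp : IsTubeCoord g x ν pr s y p)
    (hp' : IsTubeCoord g x ν pr s y p') (v : E) :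
    tubeDer Θ ν y p' v = dsm E (p'.1⁻¹ * p.1) x (tubeDer Θ ν y p v) := by
  obtain ⟨hk, -⟩ := h.coord_unique hp hp'
  have e : (p'.1⁻¹ * p.1) • ν p.2 = ν p'.2 := by
    rw [mul_smul, hp.eq, inv_smul_eq_iff, hp'.eq]
  have h1 : p.1⁻¹ • y = ν p.2 := by rw [inv_smul_eq_iff, hp.eq]
  have h2 := dsm_mul EG (E := E) (p'.1⁻¹ * p.1) p.1⁻¹ y
  rw [mul_inv_cancel_right, h1] at h2
  rw [tubeDer, ContinuousLinearMap.comp_apply, h2, ContinuousLinearMap.comp_apply, ← e,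
    h.mder_symm_dsm hk hp.slice hp.lt]
  rfl

omit [LieGroup 𝓘(ℝ, EG) ∞ G] in
theorem tubeDer_ne_zero {y : M} {p : G × E} (hp : IsTubeCoord g x ν pr s y p) {v : E}
    (hv : v ≠ 0) : tubeDer Θ ν y p v ≠ 0 := by
  intro h0
  have h1 : p.1⁻¹ • y = ν p.2 := by rw [inv_smul_eq_iff, hp.eq]
  have h2 := h.mder_mder_symm hp.slice hp.lt (dsm E p.1⁻¹ y v)
  have h3 := dsm_inv_apply EG p.1⁻¹ y v
  change mder E E Θ p.2 (tubeDer Θ ν y p v) = _ at h2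
  rw [h0, map_zero] at h2
  rw [← h2, map_zero] at h3
  exact hv h3.symm

end IsTube

/-- The standard metric of the tube, cut off near the boundary of the tube. -/
def tubeForm (g : RMetric E M) (x : M) (G : Type*) [Group G] [MulAction G M] (ν : E → M)
    (pr : E →L[ℝ] E) (Θ : OpenPartialHomeomorph E M) (s : ℝ) (y : M) : E →L[ℝ] E →L[ℝ] ℝ :=
  open Classical in
  if hp : ∃ p : G × E, IsTubeCoord g x ν pr s y p then
    Real.smoothTransition (2 - 3 / s * met g x hp.choose.2 hp.choose.2) •
        (met g x).bilinearComp (tubeDer Θ ν y hp.choose) (tubeDer Θ ν y hp.choose) +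
      (1 - Real.smoothTransition (2 - 3 / s * met g x hp.choose.2 hp.choose.2)) • met g y
  else met g y

namespace IsTube
variable (h : IsTube g x G m ν r pr q Θ s)
include h

/-- Any coordinates of y may replace the chosen ones: they differ by an element of K, which acts
isometrically at x and so changes neither the cutoff nor the form. -/
theorem tubeForm_apply {y : M} {p : G × E} (hp : IsTubeCoord g x ν pr s y p) (u v : E) :
    tubeForm g x G ν pr Θ s y u v =
      Real.smoothTransition (2 - 3 / s * met g x p.2 p.2) *
        met g x (tubeDer Θ ν y p u) (tubeDer Θ ν y p v) +
      (1 - Real.smoothTransition (2 - 3 / s * met g x p.2 p.2)) * met g y u v := by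
  have hex : ∃ p : G × E, IsTubeCoord g x ν pr s y p := ⟨p, hp⟩
  obtain ⟨hk, h2⟩ := h.coord_unique hex.choose_spec hp
  have h3 : met g x p.2 p.2 = met g x hex.choose.2 hex.choose.2 := by
    rw [h2, met_dsm_of_mem h.invariant hk]
  have h4 : met g x (tubeDer Θ ν y p u) (tubeDer Θ ν y p v) =
      met g x (tubeDer Θ ν y hex.choose u) (tubeDer Θ ν y hex.choose v) := by
    rw [h.tubeDer_coord hex.choose_spec hp, h.tubeDer_coord hex.choose_spec hp,
      met_dsm_of_mem h.invariant hk]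
  rw [tubeForm, dif_pos hex, h3, h4]
  rfl

omit [TopologicalSpace G] h [LieGroup 𝓘(ℝ, EG) ∞ G] [ContMDiffSMul 𝓘(ℝ, EG) 𝓘(ℝ, E) ∞ G M] in
theorem tubeForm_of_forall_not {y : M} (hp : ∀ p : G × E, ¬ IsTubeCoord g x ν pr s y p) :
    tubeForm g x G ν pr Θ s y = met g y := dif_neg (not_exists.2 hp)

theorem tubeForm_symm (y : M) (u v : E) :
    tubeForm g x G ν pr Θ s y u v = tubeForm g x G ν pr Θ s y v u := by
  by_cases hex : ∃ p : G × E, IsTubeCoord g x ν pr s y p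
  · obtain ⟨p, hp⟩ := hex
    rw [h.tubeForm_apply hp, h.tubeForm_apply hp, met_symm g y u v, met_symm g x (tubeDer Θ ν y p u)]
  · rw [tubeForm_of_forall_not (not_exists.1 hex), met_symm]

theorem tubeForm_pos (y : M) {v : E} (hv : v ≠ 0) : 0 < tubeForm g x G ν pr Θ s y v v := by
  by_cases hex : ∃ p : G × E, IsTubeCoord g x ν pr s y p
  · obtain ⟨p, hp⟩ := hex
    rw [h.tubeForm_apply hp]
    have h1 := met_pos g x (h.tubeDer_ne_zero hp hv)
    have h2 := met_pos g y hv
    set c := Real.smoothTransition (2 - 3 / s * met g x p.2 p.2)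
    have h3 : 0 ≤ c := Real.smoothTransition.nonneg _
    have h4 : c ≤ 1 := Real.smoothTransition.le_one _
    rcases h3.eq_or_lt with h5 | h5
    · rw [← h5]; simpa using h2
    · have := mul_pos h5 h1
      have := mul_nonneg (sub_nonneg.2 h4) h2.le
      linarith
  · rw [tubeForm_of_forall_not (not_exists.1 hex)]
    exact met_pos g y hv

/-- If (b, w) are coordinates of y, then (ab, w) are coordinates of a • y, with the same
identification of tangent spaces and the same cutoff. -/
theorem tubeForm_smul (a : G) (y : M) (u v : E) :
    tubeForm g x G ν pr Θ s (a • y) (dsm E a y u) (dsm E a y v) =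
      tubeForm g x G ν pr Θ s y u v := by
  by_cases hex : ∃ p : G × E, IsTubeCoord g x ν pr s y p
  · obtain ⟨p, hp⟩ := hex
    have hp' : IsTubeCoord g x ν pr s (a • y) (a * p.1, p.2) :=
      ⟨hp.slice, hp.lt, by rw [mul_smul, hp.eq]⟩
    have e : ∀ u, tubeDer Θ ν (a • y) (a * p.1, p.2) (dsm E a y u) = tubeDer Θ ν y p u := by
      intro u
      have h1 := dsm_mul EG (E := E) (p.1⁻¹ * a⁻¹) a y
      rw [inv_mul_cancel_right] at h1
      simp only [tubeDer, mul_inv_rev, ContinuousLinearMap.comp_apply, h1]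
    rw [h.tubeForm_apply hp', h.tubeForm_apply hp, e, e, met_smul h.invariant]
  · have hex' : ∀ p : G × E, ¬ IsTubeCoord g x ν pr s (a • y) p := fun p hp =>
      hex ⟨(a⁻¹ * p.1, p.2), hp.slice, hp.lt, by rw [mul_smul, hp.eq, inv_smul_smul]⟩
    rw [tubeForm_of_forall_not (not_exists.1 hex), tubeForm_of_forall_not hex',
      met_smul h.invariant]

/-- Smooth coordinates of the points near a given point of the tube. -/
theorem exists_smooth_coord {y₀ : M} {p : G × E} (hp : IsTubeCoord g x ν pr s y₀ p) :
    ∃ (A : M → G) (W : M → E), SmoothAt E EG A y₀ ∧ SmoothAt E E W y₀ ∧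
      (∀ᶠ y in 𝓝 y₀, IsTubeCoord g x ν pr s y (A y, W y)) := by
  have h1 : p.1⁻¹ • y₀ = ν p.2 := by rw [inv_smul_eq_iff, hp.eq]
  obtain ⟨-, h2, h3⟩ := h.map_slice hp.slice hp.lt
  have hsm : SmoothAt E E (fun y : M => p.1⁻¹ • y) y₀ := smoothAt_const_smul EG _ _
  have hu : SmoothAt E E (fun y : M => Θ.symm (p.1⁻¹ • y)) y₀ :=
    ContMDiffAt.comp (I' := 𝓘(ℝ, E)) (g := Θ.symm) y₀ (by
      rw [h1]; exact h.chart.smooth_symm _ h2) hsm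
  have hu0 : Θ.symm (p.1⁻¹ • y₀) = p.2 := by rw [h1, h3]
  have hW : SmoothAt E E (fun y : M => pr (Θ.symm (p.1⁻¹ • y))) y₀ :=
    ContMDiffAt.comp (I' := 𝓘(ℝ, E)) (g := pr) y₀ pr.contDiff.contMDiff.contMDiffAt hu
  have hq : SmoothAt E EG (fun y : M => q (Θ.symm (p.1⁻¹ • y))) y₀ :=
    ContMDiffAt.comp (I' := 𝓘(ℝ, E)) (g := q) y₀ q.contDiff.contMDiff.contMDiffAt hu
  have hA : SmoothAt E EG (fun y : M => p.1 * (chartExp (q (Θ.symm (p.1⁻¹ • y))) : G)) y₀ := by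
    refine SmoothAt.mul contMDiffAt_const ?_
    refine ContMDiffAt.comp (I' := 𝓘(ℝ, EG)) (g := (chartExp : EG → G)) y₀ ?_ hq
    rw [hu0, h.q_slice hp.slice]
    exact smoothAt_chartExp.self_of_nhds
  refine ⟨_, _, hA, hW, ?_⟩
  have e1 : ∀ᶠ y in 𝓝 y₀, p.1⁻¹ • y ∈ Θ.target := hsm.continuousAt.eventually_mem (by
    rw [h1]; exact Θ.open_target.mem_nhds h2)
  have e2 : ∀ᶠ y in 𝓝 y₀, met g x (pr (Θ.symm (p.1⁻¹ • y))) (pr (Θ.symm (p.1⁻¹ • y))) < s :=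
    hW.continuousAt.eventually (form_ball_mem_nhds (met g x) (by
      simp only [hu0, hp.slice]; exact hp.lt))
  filter_upwards [e1, e2] with y hy1 hy2
  refine ⟨h.chart.split.pr_pr _, hy2, ?_⟩
  change (p.1 * (chartExp (q (Θ.symm (p.1⁻¹ • y))) : G)) • ν (pr (Θ.symm (p.1⁻¹ • y))) = y
  rw [mul_smul]
  change p.1 • tubeMap G ν pr q (Θ.symm (p.1⁻¹ • y)) = y
  rw [← h.chart.eq_tubeMap _ (Θ.map_target hy1), Θ.right_inv hy1, smul_inv_smul]

theorem contDiffAt_chartForm_tubeForm_of_coord [FiniteDimensional ℝ E] {y₀ : M} {p : G × E}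
    (hp : IsTubeCoord g x ν pr s y₀ p) :
    ContDiffAt ℝ ∞ (chartForm (tubeForm g x G ν pr Θ s) y₀) (extChartAt 𝓘(ℝ, E) y₀ y₀) := by
  obtain ⟨A, W, hA, hW, hAW⟩ := h.exists_smooth_coord hp
  let φ := extChartAt 𝓘(ℝ, E) y₀
  have hφ : SmoothAt E E φ.symm (φ y₀) :=
    smoothAt_chart_symm (mem_extChartAt_target (I := 𝓘(ℝ, E)) y₀)
  have hφ0 : φ.symm (φ y₀) = y₀ := by simp [φ]
  have hA' : SmoothAt E EG (fun z => A (φ.symm z)) (φ y₀) :=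
    ContMDiffAt.comp (I' := 𝓘(ℝ, E)) (g := A) _ (by rw [hφ0]; exact hA) hφ
  have hW' : ContDiffAt ℝ ∞ (fun z => W (φ.symm z)) (φ y₀) :=
    contMDiffAt_iff_contDiffAt.1
      (ContMDiffAt.comp (I' := 𝓘(ℝ, E)) (g := W) _ (by rw [hφ0]; exact hW) hφ)
  have hAW0 := hAW.self_of_nhds
  have e0 : (A y₀)⁻¹ • y₀ = ν (W y₀) := by rw [inv_smul_eq_iff]; exact hAW0.eq.symm
  have hN : SmoothAt (E × E) E
      (fun z : E × E => Θ.symm ((A (φ.symm z.1))⁻¹ • φ.symm z.2)) (φ y₀, φ y₀) := by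
    refine ContMDiffAt.comp (I' := 𝓘(ℝ, E)) (g := Θ.symm) _ ?_ ?_
    · rw [hφ0, e0]
      exact h.chart.smooth_symm _ (h.map_slice hAW0.slice hAW0.lt).2.1
    · refine SmoothAt.smul (EG := EG) (SmoothAt.inv ?_) ?_
      · exact ContMDiffAt.comp (I' := 𝓘(ℝ, E)) (g := fun z => A (φ.symm z)) (φ y₀, φ y₀) hA'
          contDiff_fst.contMDiff.contMDiffAt
      · exact ContMDiffAt.comp (I' := 𝓘(ℝ, E)) (g := φ.symm) (φ y₀, φ y₀) hφ
          contDiff_snd.contMDiff.contMDiffAt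
  -- `tubeDer` differentiates with the group element frozen, so A is evaluated at a separate
  -- variable from the one differentiated; joint smoothness `hN` then gives smoothness on the
  -- diagonal.
  have hD : ContDiffAt ℝ ∞ (fun z : E => fderiv ℝ
      (fun z' : E => Θ.symm ((A (φ.symm z))⁻¹ • φ.symm z')) z) (φ y₀) :=
    ContDiffAt.fderiv (contMDiffAt_iff_contDiffAt.1 hN) contDiffAt_id (by simp)
  have hχ : ContDiffAt ℝ ∞ (fun z : E => Real.smoothTransition
      (2 - 3 / s * met g x (W (φ.symm z)) (W (φ.symm z)))) (φ y₀) :=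
    Real.smoothTransition.contDiff.contDiffAt.comp _ (contDiffAt_const.sub (contDiffAt_const.mul
      (((met g x).contDiff.contDiffAt.comp _ hW').clm_apply hW')))
  have hmet := contDiffAt_chartForm_met g y₀
  refine contDiffAt_clm_apply.2 fun u => contDiffAt_clm_apply.2 fun v => ?_
  have hkey : (fun z => chartForm (tubeForm g x G ν pr Θ s) y₀ z u v) =ᶠ[𝓝 (φ y₀)] fun z =>
      Real.smoothTransition (2 - 3 / s * met g x (W (φ.symm z)) (W (φ.symm z))) *
        met g x (fderiv ℝ (fun z' : E => Θ.symm ((A (φ.symm z))⁻¹ • φ.symm z')) z u)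
          (fderiv ℝ (fun z' : E => Θ.symm ((A (φ.symm z))⁻¹ • φ.symm z')) z v) +
      (1 - Real.smoothTransition (2 - 3 / s * met g x (W (φ.symm z)) (W (φ.symm z)))) *
        chartForm (met g) y₀ z u v := by
    filter_upwards [hφ.continuousAt.eventually (by rw [hφ0]; exact hAW),
      extChartAt_target_mem_nhds (I := 𝓘(ℝ, E)) y₀] with z hz hzt
    have e1 : (A (φ.symm z))⁻¹ • φ.symm z = ν (W (φ.symm z)) := by
      rw [inv_smul_eq_iff]; exact hz.eq.symm
    have e2 : ∀ u, tubeDer Θ ν (φ.symm z) (A (φ.symm z), W (φ.symm z))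
        (mder E E φ.symm z u) =
        fderiv ℝ (fun z' : E => Θ.symm ((A (φ.symm z))⁻¹ • φ.symm z')) z u := by
      intro u
      have c1 : SmoothAt E E φ.symm z := smoothAt_chart_symm hzt
      have c2 := smoothAt_const_smul EG (E := E) (A (φ.symm z))⁻¹ (φ.symm z)
      have c3 : SmoothAt E E Θ.symm ((A (φ.symm z))⁻¹ • φ.symm z) := by
        rw [e1]; exact h.chart.smooth_symm _ (h.map_slice hz.slice hz.lt).2.1
      have c4 : SmoothAt E E (fun z' : E => (A (φ.symm z))⁻¹ • φ.symm z') z :=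
        ContMDiffAt.comp (I' := 𝓘(ℝ, E)) z c2 c1
      have d1 := mder_comp_apply (g := Θ.symm)
        (f := fun z' : E => (A (φ.symm z))⁻¹ • φ.symm z') c3 c4 u
      have d2 := mder_comp_apply (g := fun y : M => (A (φ.symm z))⁻¹ • y) (f := φ.symm) c2 c1 u
      rw [← mder_eq_fderiv, d1, d2, e1]
      rfl
    rw [chartForm_apply, h.tubeForm_apply hz, e2, e2]
    rfl
  refine ContDiffAt.congr_of_eventuallyEq ?_ hkey
  refine (hχ.mul ?_).add ((contDiffAt_const.sub hχ).mul ?_)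
  · exact ((met g x).contDiff.contDiffAt.comp _ (hD.clm_apply contDiffAt_const)).clm_apply
      (hD.clm_apply contDiffAt_const)
  · exact (hmet.clm_apply contDiffAt_const).clm_apply contDiffAt_const

/-- The cutoff is 1 for |w|² ≤ s/3 and 0 for |w|² ≥ 2s/3. The part of the tube with |w|² ≤ 2s/3 is
compact, hence closed, so a point outside the tube has a neighbourhood avoiding it. -/
theorem eventually_tubeForm_eq_met [FiniteDimensional ℝ E] [CompactSpace G] [T2Space M] {y₀ : M}
    (hy : ∀ p : G × E, ¬ IsTubeCoord g x ν pr s y₀ p) :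
    ∀ᶠ y in 𝓝 y₀, tubeForm g x G ν pr Θ s y = met g y := by
  have hGt : IsTopologicalGroup G := topologicalGroup_of_lieGroup 𝓘(ℝ, EG) ∞
  have hcs : ContinuousSMul G M := ContMDiffSMul.continuousSMul (I := 𝓘(ℝ, EG)) (I' := 𝓘(ℝ, E)) ∞
  have hproper : ProperSpace E := FiniteDimensional.proper_real E
  have hs := h.pos
  let B : Set E := {w | pr w = w ∧ met g x w w ≤ 2 / 3 * s}
  have hBs : ∀ w ∈ B, met g x w w < s := fun w hw => hw.2.trans_lt (by linarith)
  have hB : IsCompact B := by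
    refine Metric.isCompact_of_isClosed_isBounded ?_ ?_
    · exact (isClosed_eq pr.continuous continuous_id).inter
        (isClosed_le ((met g x).continuous.clm_apply continuous_id) continuous_const)
    · obtain ⟨c, hc, hcb⟩ := exists_mul_sq_norm_le (b := met g x) (fun v hv => met_pos g x hv)
      refine (Metric.isBounded_ball (x := (0 : E)) (r := c⁻¹ * s + 1)).subset fun w hw => ?_
      have h1 : c * ‖w‖ ^ 2 < s := (hcb w).trans_lt (hBs w hw)
      have h2 : ‖w‖ ^ 2 < c⁻¹ * s := (lt_inv_mul_iff₀ hc).2 h1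
      have h3 : 0 < c⁻¹ * s := by positivity
      rw [mem_ball_zero_iff]
      nlinarith [norm_nonneg w]
  have hC : IsCompact ((fun p : G × E => p.1 • ν p.2) '' (univ ×ˢ B)) := by
    refine (isCompact_univ.prod hB).image_of_continuousOn fun p hp => ?_
    have hc : ContinuousAt ν p.2 :=
      (h.chart.param.smooth _ ((hBs _ hp.2).trans_le h.le)).continuousAt
    exact (continuousAt_fst.smul (ContinuousAt.comp (g := ν) hc continuousAt_snd)).continuousWithinAt
  have hy₀ : y₀ ∈ ((fun p : G × E => p.1 • ν p.2) '' (univ ×ˢ B))ᶜ := by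
    rintro ⟨p, hp, e⟩
    exact hy p ⟨hp.2.1, hBs _ hp.2, e⟩
  filter_upwards [hC.isClosed.isOpen_compl.mem_nhds hy₀] with y hyC
  by_cases hex : ∃ p : G × E, IsTubeCoord g x ν pr s y p
  · obtain ⟨p, hp⟩ := hex
    have hlt : 2 / 3 * s < met g x p.2 p.2 := by
      by_contra! hle
      exact hyC ⟨p, ⟨mem_univ _, hp.slice, hle⟩, hp.eq⟩
    have h0 : Real.smoothTransition (2 - 3 / s * met g x p.2 p.2) = 0 := by
      refine Real.smoothTransition.zero_of_nonpos ?_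
      have : 3 / s * (2 / 3 * s) ≤ 3 / s * met g x p.2 p.2 := by gcongr
      have e : 3 / s * (2 / 3 * s) = 2 := by field_simp
      linarith
    ext u v
    rw [h.tubeForm_apply hp, h0]
    simp
  · exact tubeForm_of_forall_not (not_exists.1 hex)

theorem contMDiff_tubeForm [FiniteDimensional ℝ E] [CompactSpace G] [T2Space M] :
    ContMDiff 𝓘(ℝ, E) (𝓘(ℝ, E).prod 𝓘(ℝ, E →L[ℝ] E →L[ℝ] ℝ)) ∞
      (fun y : M => TotalSpace.mk' (E →L[ℝ] E →L[ℝ] ℝ)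
        (E := fun y : M => TangentSpace 𝓘(ℝ, E) y →L[ℝ] TangentSpace 𝓘(ℝ, E) y →L[ℝ] ℝ) y
        (tubeForm (E := E) g x G ν pr Θ s y)) := by
  intro y₀
  refine (contMDiffAt_form_iff (fun y => tubeForm (E := E) g x G ν pr Θ s y) y₀).2 ?_
  by_cases hex : ∃ p : G × E, IsTubeCoord g x ν pr s y₀ p
  · obtain ⟨p, hp⟩ := hex
    exact h.contDiffAt_chartForm_tubeForm_of_coord hp
  · refine (contDiffAt_chartForm_met g y₀).congr_of_eventuallyEq ?_
    have hφ : SmoothAt E E (extChartAt 𝓘(ℝ, E) y₀).symm (extChartAt 𝓘(ℝ, E) y₀ y₀) :=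
      smoothAt_chart_symm (mem_extChartAt_target (I := 𝓘(ℝ, E)) y₀)
    filter_upwards [hφ.continuousAt.eventually (by
      rw [extChartAt_to_inv]
      exact h.eventually_tubeForm_eq_met (not_exists.1 hex))] with z hz
    simp only [chartForm, hz]

/-- There is an invariant metric for which the tube is isometric to its linear model. -/
theorem exists_tube_metric [FiniteDimensional ℝ E] [CompactSpace G] [T2Space M] :
    ∃ g' : RMetric E M, IsInvariantMetric G g' ∧ ∀ w, pr w = w → met g x w w < s / 3 →
      ∀ u v, met g' (ν w) u v =
        met g x (mder E E Θ.symm (ν w) u) (mder E E Θ.symm (ν w) v) := by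
  let g' : RMetric E M :=
    { inner := fun y => tubeForm (E := E) g x G ν pr Θ s y
      symm := fun y u v => h.tubeForm_symm y u v
      pos := fun y v hv => h.tubeForm_pos y hv
      isVonNBounded := fun y => isVonNBounded_form_ball (E := E) fun v hv => h.tubeForm_pos y hv
      contMDiff := h.contMDiff_tubeForm }
  refine ⟨g', fun a y v w => h.tubeForm_smul a y v w, fun w hw hws u v => ?_⟩
  have hs := h.pos
  have hp : IsTubeCoord g x ν pr s (ν w) ((1 : G), w) := ⟨hw, by linarith, one_smul _ _⟩
  have h1 : Real.smoothTransition (2 - 3 / s * met g x w w) = 1 := by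
    refine Real.smoothTransition.one_of_one_le ?_
    have : 3 / s * met g x w w ≤ 3 / s * (s / 3) := by gcongr
    have e : 3 / s * (s / 3) = 1 := by field_simp
    linarith
  have h2 := h.tubeForm_apply hp u v
  have h3 : ∀ u, tubeDer Θ ν (ν w) ((1 : G), w) u = mder E E Θ.symm (ν w) u := fun u => by
    simp only [tubeDer, inv_one, dsm_one]; rfl
  rw [h1, h3, h3, one_mul, sub_self, zero_mul, add_zero] at h2
  exact h2

end IsTube

end TubeMetric

/-! ### Inner products induced through action fields. -/

section OrbitForm

variable {EG : Type*} [NormedAddCommGroup EG] [NormedSpace ℝ EG]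
  {G : Type*} [TopologicalSpace G] [ChartedSpace EG G] [Group G]
  [LieGroup 𝓘(ℝ, EG) ∞ G]
  {E : Type*} [NormedAddCommGroup E] [NormedSpace ℝ E]
  {M : Type*} [TopologicalSpace M] [ChartedSpace E M] [IsManifold 𝓘(ℝ, E) ∞ M]
  [MulAction G M] [ContMDiffSMul 𝓘(ℝ, EG) 𝓘(ℝ, E) ∞ G M]

/-- The restriction of a bilinear form to a subspace. -/
def restrictForm {F : Type*} [NormedAddCommGroup F] [NormedSpace ℝ F] (L : F →L[ℝ] F →L[ℝ] ℝ)
    (V : Submodule ℝ F) : V →ₗ[ℝ] V →ₗ[ℝ] ℝ :=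
  LinearMap.mk₂ ℝ (fun X Y => L X Y) (fun _ _ _ => by simp) (fun _ _ _ => by simp)
    (fun _ _ _ => by simp) (fun _ _ _ => by simp)

/-- The bilinear form induced through action fields by the metric at `y` on a subspace of the Lie
algebra. -/
def orbitForm (g : RMetric E M) (y : M) (V : Submodule ℝ (GroupLieAlgebra 𝓘(ℝ, EG) G)) :
    V →ₗ[ℝ] V →ₗ[ℝ] ℝ :=
  restrictForm (F := EG) ((met g y).bilinearComp (act EG G E y) (act EG G E y)) V

/-- Positivity holds because no nonzero element of V has a field vanishing at y; invariance because
L fixes y and acts isometrically on its tangent space. -/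
theorem isInvariantInner_orbitForm {g : RMetric E M} (hg : IsInvariantMetric G g) {y : M}
    {V : Submodule ℝ (GroupLieAlgebra 𝓘(ℝ, EG) G)} {L : Subgroup G}
    (hL : L ≤ MulAction.stabilizer G y) (hV : isotropyAlgebra EG G E y ⊓ V = ⊥) :
    IsInvariantInner L V (orbitForm g y V) where
  symm X Y := met_symm g y _ _
  pos X hX := met_pos g y (v := actionField EG G E y X) fun h0 => hX <| by
    have h1 : (X : GroupLieAlgebra 𝓘(ℝ, EG) G) ∈ isotropyAlgebra EG G E y ⊓ V := ⟨h0, X.2⟩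
    rw [hV, Submodule.mem_bot] at h1
    exact Subtype.ext h1
  ad_eq a ha X Y X' Y' hX hY := by
    have ha' : a • y = y := hL ha
    have key : ∀ X : EG, act EG G E y (adL a X) = dsm E a y (act EG G E y X) := fun X => by
      have := act_smul (E := E) a y X
      rwa [ha'] at this
    change met g y (act EG G E y (X' : GroupLieAlgebra 𝓘(ℝ, EG) G))
      (act EG G E y (Y' : GroupLieAlgebra 𝓘(ℝ, EG) G)) = met g y (act EG G E y _) (act EG G E y _)
    rw [hX, hY]
    refine Eq.trans ?_ (met_dsm_of_mem hg (hL ha) _ _)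
    exact congrArg₂ (fun u v => met g y u v) (key _) (key _)

end OrbitForm

/-! ### Action fields along the slice. -/

section Adapted

variable {EG : Type*} [NormedAddCommGroup EG] [NormedSpace ℝ EG]
  {G : Type*} [TopologicalSpace G] [ChartedSpace EG G] [Group G]
  [LieGroup 𝓘(ℝ, EG) ∞ G]
  {E : Type*} [NormedAddCommGroup E] [NormedSpace ℝ E]
  {M : Type*} [TopologicalSpace M] [ChartedSpace E M] [IsManifold 𝓘(ℝ, E) ∞ M]
  [MulAction G M] [ContMDiffSMul 𝓘(ℝ, EG) 𝓘(ℝ, E) ∞ G M]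

variable {g : RMetric E M} {x : M} {m : Submodule ℝ EG} {ν : E → M} {r s : ℝ}
    {pr : E →L[ℝ] E} {q : E →L[ℝ] EG} {Θ : OpenPartialHomeomorph E M}

namespace IsTube
variable (h : IsTube g x G m ν r pr q Θ s)
include h

/-- For X in m the curve of tube coordinates starting at w with direction X*_x moves only the group
factor, in direction X. The result does not depend on w, which is why `α` can be 1. -/
theorem mder_symm_act_of_mem {w : E} (hw : pr w = w) (hs : met g x w w < s) {X : EG}
    (hX : X ∈ m) : mder E E Θ.symm (ν w) (act EG G E (ν w) X) = act EG G E x X := by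
  have h1 := h.mder_slice hw hs (act EG G E x X)
  obtain ⟨h2, h3⟩ := h.chart.split.map_of_mem hX
  rw [h2, h3, map_zero, add_zero] at h1
  rw [← h1, h.mder_symm_mder hw hs]

theorem mder_symm_center (v : E) : mder E E Θ.symm x v = v := by
  have h0 : met g x 0 0 < s := by simpa using h.pos
  have h1 := h.mder_slice (map_zero pr) h0 v
  rw [h.chart.param.zero, h.chart.param.mder_zero] at h1
  have h2 := h.mder_symm_mder (map_zero pr) h0 v
  rw [h1, h.chart.param.zero] at h2
  exact (congrArg _ (h.chart.split.add_eq v).symm).trans h2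

omit [IsManifold 𝓘(ℝ, E) ∞ M] h in
theorem smoothAt_chartExp_smul (y : M) :
    SmoothAt EG E (fun Z : EG => (chartExp Z : G) • y) 0 ∧
      ∀ Z, mder EG E (fun Z : EG => (chartExp Z : G) • y) 0 Z = act EG G E y Z := by
  have h1 : SmoothAt EG EG (chartExp : EG → G) 0 := smoothAt_chartExp.self_of_nhds
  refine ⟨h1.smul contMDiffAt_const, fun Z => ?_⟩
  have h2 := mder_comp_apply (g := fun a : G => a • y) (f := (chartExp : EG → G)) (y := 0)
    (smoothAt_smul_const (E := E) y _) h1 Z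
  rw [h2, mder_chartExp, chartExp_zero]
  rfl

/-- The displacement of a point of the slice in the direction of the slice, under a small group
element. -/
theorem hasFDerivAt_displacement {w : E} (hw : pr w = w) (hs : met g x w w < s) :
    HasFDerivAt (fun Z : EG => Θ.symm ((chartExp Z : G) • ν w) - Θ.symm ((chartExp Z : G) • x))
      ((mder E E Θ.symm (ν w)).comp (act EG G E (ν w)) - act EG G E x) 0 := by
  have key : ∀ y ∈ Θ.target, HasFDerivAt (fun Z : EG => Θ.symm ((chartExp Z : G) • y))
      ((mder E E Θ.symm y).comp (act EG G E y)) 0 := by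
    intro y hy
    obtain ⟨h1, h2⟩ := smoothAt_chartExp_smul (EG := EG) (G := G) (E := E) y
    have h3 : (chartExp (0 : EG) : G) • y = y := by rw [chartExp_zero, one_smul]
    have h4 : SmoothAt E E Θ.symm ((chartExp (0 : EG) : G) • y) := by
      rw [h3]; exact h.chart.smooth_symm y hy
    have h5 : SmoothAt EG E (fun Z : EG => Θ.symm ((chartExp Z : G) • y)) 0 :=
      ContMDiffAt.comp (I' := 𝓘(ℝ, E)) (g := Θ.symm) 0 h4 h1
    refine ((contMDiffAt_iff_contDiffAt.1 h5).differentiableAt (by simp)).hasFDerivAt.congr_fderiv ?_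
    ext Z
    have h6 := mder_comp_apply (g := Θ.symm) (f := fun Z : EG => (chartExp Z : G) • y) h4 h1 Z
    rw [← mder_eq_fderiv, h6, h2, h3]
    rfl
  refine ((key _ (h.map_slice hw hs).2.1).sub (key x h.chart.x_mem)).congr_fderiv ?_
  ext Z
  simp [h.mder_symm_center]

omit [ContMDiffSMul 𝓘(ℝ, EG) 𝓘(ℝ, E) ∞ G M] in
-- The element k depends on Z but not on w; the homogeneity of the vertical part comes from this.
theorem eventually_displacement :
    ∀ᶠ Z in 𝓝 (0 : EG), ∃ k ∈ MulAction.stabilizer G x, ∀ w, pr w = w → met g x w w < s →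
      Θ.symm ((chartExp Z : G) • ν w) - Θ.symm ((chartExp Z : G) • x) = dsm E k x w := by
  have hc : ContinuousAt (chartExp : EG → G) 0 := smoothAt_chartExp.self_of_nhds.continuousAt
  have h1 := h.local_form
  rw [← chartExp_zero (EG := EG)] at h1
  filter_upwards [hc.eventually h1] with Z hZ
  obtain ⟨h2, h3, h4⟩ := hZ
  refine ⟨_, h.chart.component_mem h2 h3, fun w hw hs => ?_⟩
  obtain ⟨h5, h6⟩ := h4 w hw hs
  rw [h6, Θ.left_inv h5, add_sub_cancel_left]

/-- The component in the direction of the slice of an action field at a point of the slice. -/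
theorem exists_vertical (Z : EG) : ∃ D : E → E, ∀ w, pr w = w → met g x w w < s →
    mder E E Θ.symm (ν w) (act EG G E (ν w) Z) = act EG G E x Z + D w ∧ pr (D w) = D w ∧
      met g x w (D w) = 0 ∧ ∀ t : ℝ, met g x (t • w) (t • w) < s → D (t • w) = t • D w := by
  -- D(w) is the derivative at Z = 0 of the displacement k_Z w. Nothing is known about regularity of
  -- k_Z in Z; instead, lying in the slice, having constant norm and homogeneity in w are identities
  -- for Z near 0, and uniqueness of derivatives passes them on to D.
  refine ⟨fun w => ((mder E E Θ.symm (ν w)).comp (act EG G E (ν w)) - act EG G E x) Z,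
    fun w hw hs => ⟨by simp, ?_, ?_, fun t ht => ?_⟩⟩
  · have h1 := h.hasFDerivAt_displacement hw hs
    have h2 := (pr.hasFDerivAt (x := Θ.symm ((chartExp (0 : EG) : G) • ν w) -
      Θ.symm ((chartExp (0 : EG) : G) • x))).comp 0 h1
    have h3 := h2.unique (h1.congr_of_eventuallyEq (by
      filter_upwards [h.eventually_displacement] with Z hZ
      obtain ⟨k, hk, hkw⟩ := hZ
      simp only [Function.comp, hkw w hw hs]
      exact (h.chart.pr_dsm h.invariant hk hw).1))
    exact congrArg (fun L : EG →L[ℝ] E => L Z) h3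
  · have h1 := h.hasFDerivAt_displacement hw hs
    have h2 := (met g x).hasFDerivAt_of_bilinear h1 h1
    have h3 := h2.unique ((hasFDerivAt_const (met g x w w) (0 : EG)).congr_of_eventuallyEq (by
      filter_upwards [h.eventually_displacement] with Z hZ
      obtain ⟨k, hk, hkw⟩ := hZ
      rw [hkw w hw hs, met_dsm_of_mem h.invariant hk]))
    have h4 := congrArg (fun L : EG →L[ℝ] ℝ => L Z) h3
    simp only [chartExp_zero, one_smul, (h.map_slice hw hs).2.2, h.chart.symm_x, sub_zero] at h4
    set d := ((mder E E Θ.symm (ν w)).comp (act EG G E (ν w)) - act EG G E x) Z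
    have h5 : met g x w d + met g x d w = 0 := h4
    rw [met_symm g x d w] at h5
    linarith
  · have htw : pr (t • w) = t • w := by rw [map_smul, hw]
    have h1 := (h.hasFDerivAt_displacement hw hs).const_smul t
    have h2 := h1.unique ((h.hasFDerivAt_displacement htw ht).congr_of_eventuallyEq (by
      filter_upwards [h.eventually_displacement] with Z hZ
      obtain ⟨k, hk, hkw⟩ := hZ
      simp only [Pi.smul_apply, hkw w hw hs, hkw _ htw ht, map_smul]))
    exact (congrArg (fun L : EG →L[ℝ] E => L Z) h2).symm

omit [LieGroup 𝓘(ℝ, EG) ∞ G] [ContMDiffSMul 𝓘(ℝ, EG) 𝓘(ℝ, E) ∞ G M] in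
theorem stabilizer_param {w : E} (hw : pr w = w) (hs : met g x w w < s) {a : G} :
    a ∈ MulAction.stabilizer G (ν w) ↔ a ∈ MulAction.stabilizer G x ∧ dsm E a x w = w := by
  have hr := hs.trans_le h.le
  constructor
  · intro ha
    have ha' : a • ν w = ν w := ha
    have hk := h.slice a w w hw hw hs hs ha'
    refine ⟨hk, h.chart.param.inj _ _ ?_ hr ?_⟩
    · rwa [met_dsm_of_mem h.invariant hk]
    · rw [h.chart.param.equivariant a hk w hr, ha']
  · rintro ⟨hk, e⟩
    rw [MulAction.mem_stabilizer_iff, ← h.chart.param.equivariant a hk w hr, e]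

end IsTube
end Adapted

/-! ### The normal ray and the adapted metric. -/

section Adapted

variable {EG : Type*} [NormedAddCommGroup EG] [NormedSpace ℝ EG]
  {G : Type*} [TopologicalSpace G] [ChartedSpace EG G] [Group G]
  [LieGroup 𝓘(ℝ, EG) ∞ G]
  {E : Type*} [NormedAddCommGroup E] [NormedSpace ℝ E]
  {M : Type*} [TopologicalSpace M] [ChartedSpace E M] [IsManifold 𝓘(ℝ, E) ∞ M]
  [MulAction G M] [ContMDiffSMul 𝓘(ℝ, EG) 𝓘(ℝ, E) ∞ G M]

variable {g : RMetric E M} {x : M} {m : Submodule ℝ EG} {ν : E → M} {r s : ℝ}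
    {pr : E →L[ℝ] E} {q : E →L[ℝ] EG} {Θ : OpenPartialHomeomorph E M}

/-- On the slice, the metric `g'` agrees with that of the linear model of the tube. -/
structure IsTubeMetric (g : RMetric E M) (x : M) (G : Type*) [Group G] [MulAction G M] (ν : E → M)
    (pr : E →L[ℝ] E) (Θ : OpenPartialHomeomorph E M) (s : ℝ) (g' : RMetric E M) : Prop where
  invariant : IsInvariantMetric G g'
  eq : ∀ w, pr w = w → met g x w w < s / 3 → ∀ u v, met g' (ν w) u v =
    met g x (mder E E Θ.symm (ν w) u) (mder E E Θ.symm (ν w) v)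

/-- `v` is a unit vector perpendicular to the orbit and `δ` is the radius of a small tube. -/
structure IsRay (g : RMetric E M) (x : M) (pr : E →L[ℝ] E) (s : ℝ) (v : E) (δ : ℝ) : Prop where
  slice : pr v = v
  unit : met g x v v = 1
  pos : 0 < δ
  sq_lt : δ ^ 2 ≤ s / 3

namespace IsRay
variable {v : E} {δ : ℝ} (hv : IsRay g x pr s v δ)
include hv

theorem slice_smul (t : ℝ) : pr (t • v) = t • v := by rw [map_smul, hv.slice]

theorem met_lt {t : ℝ} (ht : t ∈ Ioo (-δ) δ) : met g x (t • v) (t • v) < s / 3 := by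
  have h1 : met g x (t • v) (t • v) = t ^ 2 := by
    simp only [map_smul, smul_apply, smul_eq_mul, hv.unit]
    ring
  have h2 : t ^ 2 < δ ^ 2 := sq_lt_sq' ht.1 ht.2
  rw [h1]
  exact h2.trans_le hv.sq_lt

theorem met_lt' {t : ℝ} (ht : t ∈ Ioo (-δ) δ) : met g x (t • v) (t • v) < s := by
  have h1 := hv.met_lt ht
  have h2 : 0 < s / 3 := (pow_pos hv.pos 2).trans_le hv.sq_lt
  linarith

end IsRay

namespace IsTube
variable (h : IsTube g x G m ν r pr q Θ s) {v : E} {δ : ℝ} (hv : IsRay g x pr s v δ)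
include h hv

omit [LieGroup 𝓘(ℝ, EG) ∞ G] [ContMDiffSMul 𝓘(ℝ, EG) 𝓘(ℝ, E) ∞ G M] in
theorem smoothAt_ray {t : ℝ} (ht : t ∈ Ioo (-δ) δ) : SmoothAt ℝ E (fun t : ℝ => ν (t • v)) t :=
  ContMDiffAt.comp (I' := 𝓘(ℝ, E)) (g := ν) t
    (h.chart.param.smooth _ ((hv.met_lt' ht).trans_le h.le))
    (contMDiffAt_iff_contDiffAt.2 (by fun_prop))

theorem velocity_ray {t : ℝ} (ht : t ∈ Ioo (-δ) δ) :
    mder ℝ E (fun t : ℝ => ν (t • v)) t 1 = mder E E Θ (t • v) v := by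
  have h1 := mder_comp_apply (g := ν) (f := fun t : ℝ => t • v) (y := t)
    (h.chart.param.smooth _ ((hv.met_lt' ht).trans_le h.le))
    (contMDiffAt_iff_contDiffAt.2 (by fun_prop)) (1 : ℝ)
  have h2 : mder ℝ E (fun t : ℝ => t • v) t (1 : ℝ) = v := by
    have h3 : HasFDerivAt (fun t : ℝ => t • v) (ContinuousLinearMap.toSpanSingleton ℝ v) t :=
      (ContinuousLinearMap.toSpanSingleton ℝ v).hasFDerivAt
    have h4 : mder ℝ E (fun t : ℝ => t • v) t = fderiv ℝ (fun t : ℝ => t • v) t := mfderiv_eq_fderiv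
    rw [h4, h3.fderiv]
    simp
  rw [h1, h2, h.mder_slice (hv.slice_smul t) (hv.met_lt' ht), h.q_slice hv.slice, hv.slice,
    map_zero, zero_add]

variable {g' : RMetric E M} (hg' : IsTubeMetric g x G ν pr Θ s g')
include hg'

omit hv [LieGroup 𝓘(ℝ, EG) ∞ G] [ContMDiffSMul 𝓘(ℝ, EG) 𝓘(ℝ, E) ∞ G M] in
theorem met_slice {w : E} (hw : pr w = w) (hs : met g x w w < s / 3) (u u' : E) :
    met g' (ν w) (mder E E Θ w u) (mder E E Θ w u') = met g x u u' := by
  have hs' : met g x w w < s := by linarith [h.pos]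
  rw [hg'.eq w hw hs, h.mder_symm_mder hw hs', h.mder_symm_mder hw hs']

/-- Off the slice too, v changes only the slice coordinate, so dΘ_p v is the translate by a group
element of the same vector at `pr p`, and invariance reduces to the slice. The geodesic equation
needs this whole neighbourhood. -/
theorem met_radial {p : E} (hp : p ∈ Θ.source) (hs : met g x (pr p) (pr p) < s / 3) :
    met g' (Θ p) (mder E E Θ p v) (mder E E Θ p v) = 1 := by
  have hs' : met g x (pr p) (pr p) < s := by linarith [h.pos]
  have hpp := h.chart.split.pr_pr p
  have h1 := h.chart.mder_eq hp v
  have h2 := h.mder_slice hpp hs' v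
  rw [h.q_slice hv.slice, hv.slice, map_zero, zero_add] at h2
  rw [h.q_slice hv.slice, hv.slice, map_zero, map_zero, zero_add, ← h2] at h1
  rw [h1, h.chart.eq_tubeMap p hp, tubeMap, met_smul hg'.invariant, h.met_slice hg' hpp hs, hv.unit]

theorem geodesicEqAt_ray {t : ℝ} (ht : t ∈ Ioo (-δ) δ) :
    GeodesicEqAt g' (fun t : ℝ => ν (t • v)) t := by
  have hsl : ∀ t ∈ Ioo (-δ) δ, Θ (t • v) = ν (t • v) := fun t ht =>
    (h.map_slice (hv.slice_smul t) (hv.met_lt' ht)).1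
  refine geodesicEqAt_of_line g' Θ (v := v) (l := met g x v) (h.mem _ (hv.met_lt' ht))
    h.chart.smooth h.chart.smooth_symm ?_ ?_ ?_
  · filter_upwards [isOpen_Ioo.mem_nhds ht] with t' ht' using (hsl t' ht').symm
  · have h1 : ∀ᶠ p in 𝓝 (t • v), met g x (pr p) (pr p) < s / 3 :=
      pr.continuous.continuousAt.eventually (form_ball_mem_nhds (met g x) (by
        rw [hv.slice_smul]; exact hv.met_lt ht))
    filter_upwards [h1, Θ.open_source.mem_nhds (h.mem _ (hv.met_lt' ht))] with p hp1 hp2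
      using h.met_radial hv hg' hp2 hp1
  · filter_upwards [isOpen_Ioo.mem_nhds ht] with t' ht' u
    rw [hsl t' ht', h.met_slice hg' (hv.slice_smul t') (hv.met_lt ht')]

theorem perp_ray {t : ℝ} (ht : t ∈ Ioo (-δ) δ) (Z : EG) :
    met g' (ν (t • v)) (mder E E Θ (t • v) v) (act EG G E (ν (t • v)) Z) = 0 := by
  obtain ⟨D, hD⟩ := h.exists_vertical Z
  obtain ⟨h1, -, h3, h4⟩ := hD _ (hv.slice_smul t) (hv.met_lt' ht)
  rw [hg'.eq _ (hv.slice_smul t) (hv.met_lt ht),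
    h.mder_symm_mder (hv.slice_smul t) (hv.met_lt' ht), h1, map_add]
  have h5 := h.chart.split.orth v Z
  rw [hv.slice] at h5
  rw [h5, zero_add]
  -- Orthogonality is known between t v and D(t v); for t ≠ 0 divide by t, and at t = 0 homogeneity
  -- gives D(0) = 0.
  by_cases h0 : t = 0
  · have h6 := h4 0 (by simpa using h.pos)
    rw [zero_smul, zero_smul] at h6
    rw [h0, zero_smul, h6, map_zero]
  · rw [map_smul, smul_apply, smul_eq_mul] at h3
    exact (mul_eq_zero.1 h3).resolve_left h0

theorem isHorizontalGeodesic_ray :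
    IsHorizontalGeodesic EG G g' (fun t : ℝ => ν (t • v)) δ where
  smooth t ht := (h.smoothAt_ray hv ht).contMDiffWithinAt
  geodesic t ht := h.geodesicEqAt_ray hv hg' ht
  unit_speed t ht := by
    change met g' (ν (t • v)) (mder ℝ E (fun t : ℝ => ν (t • v)) t 1)
      (mder ℝ E (fun t : ℝ => ν (t • v)) t 1) = 1
    rw [h.velocity_ray hv ht, h.met_slice hg' (hv.slice_smul t) (hv.met_lt ht), hv.unit]
  perp t ht X := by
    change met g' (ν (t • v)) (mder ℝ E (fun t : ℝ => ν (t • v)) t 1)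
      (act EG G E (ν (t • v)) X) = 0
    rw [h.velocity_ray hv ht]
    exact h.perp_ray hv hg' ht X

omit hg'

omit [LieGroup 𝓘(ℝ, EG) ∞ G] [ContMDiffSMul 𝓘(ℝ, EG) 𝓘(ℝ, E) ∞ G M] in
theorem stabilizer_ray {t : ℝ} (ht : t ∈ Ioo 0 δ) {a : G} :
    a ∈ MulAction.stabilizer G (ν (t • v)) ↔ a ∈ MulAction.stabilizer G x ∧ dsm E a x v = v := by
  have ht' : t ∈ Ioo (-δ) δ := ⟨by linarith [ht.1, hv.pos], ht.2⟩
  rw [h.stabilizer_param (hv.slice_smul t) (hv.met_lt' ht'), map_smul,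
    smul_right_inj (ht.1.ne')]

omit [LieGroup 𝓘(ℝ, EG) ∞ G] [ContMDiffSMul 𝓘(ℝ, EG) 𝓘(ℝ, E) ∞ G M] in
theorem act_ray_eq_zero_iff {t : ℝ} (ht : t ∈ Ioo 0 δ) {Z : EG} {D : E → E}
    (hD : ∀ w, pr w = w → met g x w w < s →
      mder E E Θ.symm (ν w) (act EG G E (ν w) Z) = act EG G E x Z + D w ∧ pr (D w) = D w ∧
      met g x w (D w) = 0 ∧ ∀ t : ℝ, met g x (t • w) (t • w) < s → D (t • w) = t • D w) :
    act EG G E (ν (t • v)) Z = 0 ↔ act EG G E x Z = 0 ∧ D (t • v) = 0 := by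
  have ht' : t ∈ Ioo (-δ) δ := ⟨by linarith [ht.1, hv.pos], ht.2⟩
  obtain ⟨h1, h2, -⟩ := hD _ (hv.slice_smul t) (hv.met_lt' ht')
  constructor
  · intro h0
    rw [h0, map_zero] at h1
    have h3 := congrArg pr h1
    rw [map_zero, map_add, h.chart.split.pr_range, zero_add, h2] at h3
    rw [← h3, add_zero] at h1
    exact ⟨h1.symm, h3.symm⟩
  · rintro ⟨e1, e2⟩
    rw [e1, e2, add_zero] at h1
    rw [← h.mder_mder_symm (hv.slice_smul t) (hv.met_lt' ht') (act EG G E (ν (t • v)) Z), h1,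
      map_zero]

theorem act_ray_eq_zero {t t' : ℝ} (ht : t ∈ Ioo 0 δ) (ht' : t' ∈ Ioo 0 δ) {Z : EG}
    (h0 : act EG G E (ν (t • v)) Z = 0) : act EG G E (ν (t' • v)) Z = 0 := by
  have hmem : ∀ t ∈ Ioo 0 δ, t ∈ Ioo (-δ) δ := fun t ht => ⟨by linarith [ht.1, hv.pos], ht.2⟩
  obtain ⟨D, hD⟩ := h.exists_vertical Z
  rw [h.act_ray_eq_zero_iff hv ht hD] at h0
  rw [h.act_ray_eq_zero_iff hv ht' hD]
  refine ⟨h0.1, ?_⟩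
  have e : t' • v = (t' / t) • t • v := by rw [smul_smul, div_mul_cancel₀ _ ht.1.ne']
  rw [e, (hD _ (hv.slice_smul t) (hv.met_lt' (hmem t ht))).2.2.2 _ (by
    rw [← e]; exact hv.met_lt' (hmem t' ht')), h0.2, smul_zero]

include hg'

/-- Read at x, the fields of X and Y are tangent to the orbit and constant in t, while those of U
and W are normal since their tangential parts vanish; the cross terms drop out. -/
theorem met_act_ray {t : ℝ} (ht : t ∈ Ioo (-δ) δ) {X Y U W : EG} (hX : X ∈ m) (hY : Y ∈ m)
    (hU : act EG G E x U = 0) (hW : act EG G E x W = 0) :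
    met g' (ν (t • v)) (act EG G E (ν (t • v)) (X + U)) (act EG G E (ν (t • v)) (Y + W)) =
      met g x (act EG G E x X) (act EG G E x Y) +
        met g' (ν (t • v)) (act EG G E (ν (t • v)) U) (act EG G E (ν (t • v)) W) := by
  have hp := hv.slice_smul t
  have hs := hv.met_lt' ht
  have key : ∀ U : EG, act EG G E x U = 0 → ∀ X : EG,
      met g x (act EG G E x X) (mder E E Θ.symm (ν (t • v)) (act EG G E (ν (t • v)) U)) = 0 := by
    intro U hU X
    obtain ⟨D, hD⟩ := h.exists_vertical U
    obtain ⟨h1, h2, -⟩ := hD _ hp hs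
    rw [h1, hU, zero_add, met_symm, ← h2, h.chart.split.orth]
  rw [hg'.eq _ hp (hv.met_lt ht), hg'.eq _ hp (hv.met_lt ht)]
  simp only [map_add, add_apply, h.mder_symm_act_of_mem hp hs hX, h.mder_symm_act_of_mem hp hs hY,
    key W hW X]
  rw [met_symm g x (mder E E Θ.symm (ν (t • v)) (act EG G E (ν (t • v)) U)) (act EG G E x Y),
    key U hU Y]
  ring

omit hv in
theorem met_center (u u' : E) : met g' x u u' = met g x u u' := by
  have h1 := hg'.eq 0 (map_zero pr) (by simpa using h.pos) u u'
  rwa [h.chart.param.zero, h.mder_symm_center, h.mder_symm_center] at h1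

theorem isAdaptedNear {m' : Submodule ℝ (GroupLieAlgebra 𝓘(ℝ, EG) G)} (hmm' : m' = m)
    (hm : isotropyAlgebra EG G E x ⊓ m' = ⊥) : IsAdaptedNear g' x m' := by
  have hhalf : δ / 2 ∈ Ioo 0 δ := ⟨half_pos hv.pos, half_lt_self hv.pos⟩
  have hmem : ∀ t ∈ Ioo 0 δ, t ∈ Ioo (-δ) δ := fun t ht => ⟨by linarith [ht.1, hv.pos], ht.2⟩
  have hstab : ∀ t ∈ Ioo 0 δ, MulAction.stabilizer G (ν (t • v)) =
      MulAction.stabilizer G (ν ((δ / 2) • v)) := fun t ht => by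
    ext a
    rw [h.stabilizer_ray hv ht, h.stabilizer_ray hv hhalf]
  have hiso : ∀ t ∈ Ioo 0 δ, isotropyAlgebra EG G E (ν (t • v)) =
      isotropyAlgebra EG G E (ν ((δ / 2) • v)) := fun t ht =>
    le_antisymm (fun Z hZ => h.act_ray_eq_zero hv ht hhalf hZ)
      (fun Z hZ => h.act_ray_eq_zero hv hhalf ht hZ)
  refine ⟨fun t => ν (t • v), δ, MulAction.stabilizer G (ν ((δ / 2) • v)),
    isotropyAlgebra EG G E (ν ((δ / 2) • v)), hv.pos, h.isHorizontalGeodesic_ray hv hg',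
    by simp only [zero_smul]; exact h.chart.param.zero, hstab, hiso, fun p hp => ?_⟩
  have hpk : ∀ U ∈ p, act EG G E x U = 0 := fun U hU => by
    have h1 : p ≤ isotropyAlgebra EG G E x := by rw [← hp.sup_eq]; exact le_sup_right
    exact h1 hU
  -- The whole interval works with `α` = 1; A and B t are the forms induced by g' at x on m' and at
  -- γ t on p.
  refine ⟨δ, fun _ => 1, orbitForm g' x m', fun t => orbitForm g' (ν (t • v)) p, hv.pos, le_rfl,
    contDiffOn_const, fun _ _ => one_pos, tendsto_const_nhds,
    isInvariantInner_orbitForm hg'.invariant le_rfl hm, fun _ _ => rfl, fun t ht =>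
      isInvariantInner_orbitForm hg'.invariant (hstab t ht).ge (by rw [hiso t ht]; exact hp.inf_eq),
    fun t ht X Y U W => ?_⟩
  have h1 := h.met_act_ray hv hg' (hmem t ht) (X := (X : GroupLieAlgebra 𝓘(ℝ, EG) G))
    (Y := (Y : GroupLieAlgebra 𝓘(ℝ, EG) G)) (by rw [← hmm']; exact X.2) (by rw [← hmm']; exact Y.2)
    (hpk U U.2) (hpk W W.2)
  rw [one_pow, one_mul]
  refine h1.trans (congrArg₂ (· + ·) ?_ rfl)
  exact (h.met_center hg' _ _).symm

end IsTube

omit [LieGroup 𝓘(ℝ, EG) ∞ G] [ContMDiffSMul 𝓘(ℝ, EG) 𝓘(ℝ, E) ∞ G M] in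
/-- A singular orbit has a nonzero normal vector. -/
theorem exists_unit_normal [FiniteDimensional ℝ E] (hx : IsSingularAt EG G E x)
    (hs : IsSplitting (met g x) (act EG G E x) m pr q) : ∃ v, pr v = v ∧ met g x v v = 1 := by
  obtain ⟨u, hu⟩ : ∃ u, pr u ≠ 0 := by
    by_contra! h0
    obtain ⟨y, hy1, hy2⟩ := hx
    have h1 : LinearMap.range (act EG G E x).toLinearMap = ⊤ := by
      refine LinearMap.range_eq_top.2 fun u => ⟨q u, ?_⟩
      have := hs.add_eq u
      rwa [h0, add_zero] at this
    have h2 : orbitDim EG G E x = Module.finrank ℝ E := by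
      change Module.finrank ℝ (LinearMap.range (act EG G E x).toLinearMap) = _
      rw [h1, finrank_top]
    omega
  have h1 := met_pos g x hu
  refine ⟨(Real.sqrt (met g x (pr u) (pr u)))⁻¹ • pr u, by rw [map_smul, hs.pr_pr], ?_⟩
  simp only [map_smul, smul_apply, smul_eq_mul]
  rw [← mul_assoc, ← mul_inv, Real.mul_self_sqrt h1.le, inv_mul_cancel₀ h1.ne']

end Adapted

end CohomOne

end

open CohomOne in
theorem proposition2p7
    {EG : Type*} [NormedAddCommGroup EG] [NormedSpace ℝ EG] [FiniteDimensional ℝ EG]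
    {G : Type*} [TopologicalSpace G] [ChartedSpace EG G] [Group G]
    [LieGroup 𝓘(ℝ, EG) ∞ G] [CompactSpace G] [T2Space G]
    {E : Type*} [NormedAddCommGroup E] [NormedSpace ℝ E] [FiniteDimensional ℝ E]
    {M : Type*} [TopologicalSpace M] [ChartedSpace E M] [IsManifold 𝓘(ℝ, E) ∞ M]
    [CompactSpace M] [T2Space M] [ConnectedSpace M]
    [MulAction G M] [ContMDiffSMul 𝓘(ℝ, EG) 𝓘(ℝ, E) ∞ G M]
    (hM : IsCohomogeneityOne EG G E M)
    (x : M) (hx : IsSingularAt EG G E x)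
    (m : Submodule ℝ (GroupLieAlgebra 𝓘(ℝ, EG) G))
    (hm : IsInvariantComplement (MulAction.stabilizer G x) (isotropyAlgebra EG G E x) ⊤ m) :
    ∃ g : RMetric E M, IsInvariantMetric G g ∧ IsAdaptedNear g x m := by
  obtain ⟨⟨g, hg⟩, -⟩ := hM
  obtain ⟨ν, r, hν⟩ := exists_equivariant_param (G := G) EG g x
  obtain ⟨pr, q, hs⟩ := exists_splitting (b := met g x) (fun v hv => met_pos g x hv)
    (fun u v => met_symm g x u v) (act EG G E x) (m := m) hm.inf_eq hm.sup_eq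
  obtain ⟨Θ, hΘ⟩ := exists_tubeChart hν hs
  obtain ⟨s, h⟩ := exists_tube hg hΘ fun k hk X hX => hm.ad_mem k hk X hX
  obtain ⟨g', hg1, hg2⟩ := h.exists_tube_metric
  obtain ⟨v, hv1, hv2⟩ := exists_unit_normal hx hs
  have hs3 : 0 < s / 3 := div_pos h.pos three_pos
  -- For |t| below √(s/3) the point t v lies where the cutoff is 1, so g' is the model metric along
  -- the ray.
  exact ⟨g', hg1, h.isAdaptedNear (v := v) (δ := Real.sqrt (s / 3))
    ⟨hv1, hv2, Real.sqrt_pos.2 hs3, (Real.sq_sqrt hs3.le).le⟩ ⟨hg1, hg2⟩ rfl hm.inf_eq⟩
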